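/- **Setting.** Equip $\mathbb R^6$ (coordinates $x^0,\dots,x^5$) with the Lorentzian product $\langle v,w\rangle={}^tvSw=-v^0w^5-v^5w^0+\sum_{A=1}^4v^Aw^A$; let $L^+=\{v:\langle v,v\rangle=0,\ v^0+v^5>0\}$ and let $\mathbb Q_4\subset\mathbb P^5(\mathbb R)$ be the quadric $\langle v,v\rangle=0$ (the conformal 4-sphere). A *conformal motion* is a linear map preserving $\langle\cdot,\cdot\rangle$ and $L^+$; those of determinant $1$ form the Möbius group $\mathrm{M\ddot ob}(4)$, with Lie algebra $\mathfrak{m\ddot ob}(4)=\{X:{}^tXS+SX=0\}$. Let $I$ be an open interval and $f:I\to\mathbb Q_4$ a smooth immersion. A frame along $f$ is a smooth $e=(e_0|\cdots|e_5)$ with values in $\mathrm{M\ddot ob}(4)$ and $[e_0]=f$; put $\phi=(\phi^a_b)=e^{-1}de$. It is a *Darboux frame* if $\phi^\alpha_0=\phi^\alpha_1=0$ for $\alpha=2,3,4$ and $\phi^1_0$ is a positive form; then write $\phi^0_\alpha=p^\alpha\phi^1_0$. The form $ds=\big(\sum_\alpha(p^\alpha)^2\big)^{1/4}\phi^1_0$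 does not depend on the Darboux frame; $s$ is the *conformal arclength*. A point is *1-generic* if $\sum_\alpha(p^\alpha)^2\ne0$ there. A *third order frame* is a Darboux frame with $\phi^0_2=\phi^1_0$, $\phi^0_3=\phi^0_4=0$; it is *special* if also $\phi^0_0=0$. A 1-generic point is *2-generic* if $(\phi^3_2,\phi^4_2)\ne0$ there for a third order frame. A *Frenet frame* is a special third order frame with $\phi^4_2=0$ and $\phi^3_2=\mu_2\phi^1_0$, $\mu_2>0$; the conformal curvatures $\mu_1,\mu_2,\mu_3$ are given by $\phi^0_1=\mu_1\phi^1_0$, $\phi^3_2=\mu_2\phi^1_0$, $\phi^4_3=\mu_3\phi^1_0$. A 2-generic point is *3-generic* if $\mu_3\ne0$ there. A *conformal geodesic* is a 1-generic immersion $f$ that is critical for the conformal arclength functional $\int_{\mathcal D}ds$ ($\mathcal D\subset I$ any compact interval) with respect to all smooth variations of $f$ through immersions that fix $f$ outside $\mathcal D$. For constants $C_1,C_2,C_3$ put $$P(t)=-t^3+2C_1t^2+C_3t-C_2^2 ;$$ the triple is *admissible* if $P$ has real roots $\xi_-<0<\xi_1<\xi_2$. For $0<\lambda$, $0<\tau_1<\tau_2$,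 a positive function $\mu_2$ and $s_0\in I$ let $\varepsilon=\varepsilon(s)\in\mathbb R^6$ be the curve \begin{align*} \varepsilon^0&=\tfrac{\sqrt{\tau_2^2-\tau_1^2}}{\sqrt2}\sqrt{\mu_2^2+\lambda^2}\,\exp\Big(\lambda\int_{s_0}^s\tfrac{dt}{\mu_2^2+\lambda^2}\Big), & \varepsilon^5&=\tfrac{\sqrt{\tau_2^2-\tau_1^2}}{\sqrt2}\sqrt{\mu_2^2+\lambda^2}\,\exp\Big(-\lambda\int_{s_0}^s\tfrac{dt}{\mu_2^2+\lambda^2}\Big),\\ \varepsilon^1&=\sqrt{\lambda^2+\tau_2^2}\sqrt{\mu_2^2-\tau_1^2}\,\sin\Big(\tau_1\int_{s_0}^s\tfrac{dt}{\tau_1^2-\mu_2^2}\Big), & \varepsilon^2&=\sqrt{\lambda^2+\tau_2^2}\sqrt{\mu_2^2-\tau_1^2}\,\cos\Big(\tau_1\int_{s_0}^s\tfrac{dt}{\tau_1^2-\mu_2^2}\Big),\\ \varepsilon^3&=\sqrt{\lambda^2+\tau_1^2}\sqrt{\tau_2^2-\mu_2^2}\,\sin\Big(\tau_2\int_{s_0}^s\tfrac{dt}{\tau_2^2-\mu_2^2}\Big),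 & \varepsilon^4&=\sqrt{\lambda^2+\tau_1^2}\sqrt{\tau_2^2-\mu_2^2}\,\cos\Big(\tau_2\int_{s_0}^s\tfrac{dt}{\tau_2^2-\mu_2^2}\Big). \end{align*} **Theorem.** (a) Let $f:I\to\mathbb Q_4$ be a 3-generic conformal geodesic parametrized by conformal arclength $s$. Then $f$ has a Frenet frame $e$ on $I$. For any Frenet frame $e$ on $I$ whose curvatures $\mu_1,\mu_2,\mu_3$ are not all constant, with the dot denoting $d/ds$, the matrix $$\Theta=\begin{pmatrix}0&1&-\mu_1-\mu_2^2&\dot\mu_2&\mu_2\mu_3&0\\0&0&0&-\mu_2&0&1\\1&0&0&0&0&-\mu_1-\mu_2^2\\0&\mu_2&0&0&0&\dot\mu_2\\0&0&0&0&0&\mu_2\mu_3\\0&0&1&0&0&0\end{pmatrix}$$ satisfies the Lax equation $\dot\Theta=[\Theta,\phi(\tfrac{d}{ds})]$, and $e\Theta e^{-1}=\omega$ is a fixed element of $\mathfrak{m\ddot ob}(4)$. Moreover there are an admissible triple $(C_1,C_2,C_3)$ with $$\mu_1=-\tfrac32\mu_2^2+C_1,\qquad \mu_3=\frac{C_2}{\mu_2^2},\qquad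 \tfrac12\dot\mu_2^2+\tfrac12\mu_2^4-C_1\mu_2^2+\frac{C_2^2}{2\mu_2^2}=\frac{C_3}2,$$ and $\lambda>0$, $0<\tau_1<\tau_2$ such that $\lambda^2,-\tau_1^2,-\tau_2^2$ are the roots of $P(-x)-x$; they satisfy $-\xi_-<\lambda^2$ and $\tau_1^2<\xi_1\le\mu_2^2\le\xi_2<\tau_2^2$, and the characteristic polynomial of $\omega$ is $$t^6+2C_1t^4-(1+C_3)t^2-C_2^2=(t^2-\lambda^2)(t^2+\tau_1^2)(t^2+\tau_2^2).$$ Finally, for every $s_0\in I$ there is a conformal motion $A$ with $$A\omega A^{-1}=(\lambda)\oplus\begin{pmatrix}0&-\tau_1\\\tau_1&0\end{pmatrix}\oplus\begin{pmatrix}0&-\tau_2\\\tau_2&0\end{pmatrix}\oplus(-\lambda),\qquad A\,e_0(s)=\frac{\varepsilon(s)}{\sqrt{(\tau_2^2-\tau_1^2)(\lambda^2+\tau_1^2)(\lambda^2+\tau_2^2)}}\quad(s\in I),$$ so that $f(s)=[A^{-1}\varepsilon(s)]$: up to a conformal motion, $f$ is the curve $[\varepsilon]$. The determinant of $A$ has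 the sign opposite to that of $C_2$, i.e. of $\mu_3$. (b) Conversely, let $(C_1,C_2,C_3)$ be admissible, let $\lambda>0$, $0<\tau_1<\tau_2$ be such that $\lambda^2,-\tau_1^2,-\tau_2^2$ are the roots of $P(-x)-x$, let $\mu_2$ be a smooth, positive, non-constant solution on $I$ of the last of the three displayed equations for the curvatures, let $s_0\in I$, and let $G$ be a conformal motion whose determinant has the sign opposite to that of $C_2$. Then $f=[G\varepsilon]$ is a 3-generic conformal geodesic on $I$, parametrized by conformal arclength, and it has a Frenet frame with curvatures $-\tfrac32\mu_2^2+C_1,\ \mu_2,\ C_2/\mu_2^2$. -/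

import Mathlib

namespace ConformalGeodesics

open Set Topology
open scoped ContDiff LinearAlgebra.Projectivization

noncomputable section

/-! ### The conformal four-sphere and its conformal group -/

/-- The space of homogeneous coordinates `(x⁰ : x¹ : x² : x³ : x⁴ : x⁵)`. -/
abbrev V6 : Type := Fin 6 → ℝ

abbrev M6 : Type := Matrix (Fin 6) (Fin 6) ℝ

/-- The matrix of the Lorentzian metric `-2 x⁰ x⁵ + (x¹)² + (x²)² + (x³)² + (x⁴)²`. -/
def lorentzS : M6 :=
  !![ 0, 0, 0, 0, 0, -1;
      0, 1, 0, 0, 0, 0;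
      0, 0, 1, 0, 0, 0;
      0, 0, 0, 1, 0, 0;
      0, 0, 0, 0, 1, 0;
     -1, 0, 0, 0, 0, 0]

/-- The Lorentzian inner product. -/
def lorentz (v w : V6) : ℝ := v ⬝ᵥ (lorentzS.mulVec w)

/-- The positive light cone. -/
def posCone : Set V6 := {v | lorentz v v = 0 ∧ 0 < v 0 + v 5}

/-- The Darboux hyperquadric, a subset of five-dimensional real projective space. -/
def Q4 : Set (ℙ ℝ V6) := {p | lorentz p.rep p.rep = 0}

/-- `w` is a vector of homogeneous coordinates of the point `p`. -/
def Represents (w : V6) (p : ℙ ℝ V6) : Prop :=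
  ∃ hw : w ≠ 0, p = Projectivization.mk ℝ w hw

/-- The orthochronous Lorentz group: the linear maps that preserve the metric and the positive
light cone. It is the full group of conformal diffeomorphisms of the four-sphere. -/
def IsConformalMotion (G : M6) : Prop :=
  G.transpose * lorentzS * G = lorentzS ∧ ∀ v ∈ posCone, G.mulVec v ∈ posCone

/-- The Möbius group: the orientation preserving conformal motions, i.e. the identity component
of the Lorentz group. -/
def Moeb : Set M6 := {G | IsConformalMotion G ∧ G.det = 1}

/-- The Lie algebra of the Möbius group. -/
def moebAlg : Set M6 := {X | X.transpose * lorentzS + lorentzS * X = 0}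

/-! ### Curves -/

/-- `f` is a smooth immersion on the open interval `I`. Smoothness is expressed by a smooth lift to
the positive light cone; such lifts are global, as the cone over the quadric has the smooth
section `v⁰ + v⁵ = 1`. -/
def IsImmersedCurve (f : ℝ → Q4) (I : Set ℝ) : Prop :=
  ∃ F : ℝ → V6, ContDiffOn ℝ ∞ F I ∧
    ∀ x ∈ I, F x ∈ posCone ∧ Represents (F x) (f x) ∧ LinearIndependent ℝ ![F x, deriv F x]

/-- The coefficient of `dx` in the pull-back `e⁻¹ de` of the Maurer-Cartan form. The entry in
row `a` and column `b` is `φ^a_b`. -/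
def mcForm (e : ℝ → M6) (x : ℝ) : M6 :=
  (e x)⁻¹ * Matrix.of fun i j => deriv (fun y => e y i j) x

/-- Zeroth order frames along `f` on `U`. -/
def IsFrame (e : ℝ → M6) (f : ℝ → Q4) (U : Set ℝ) : Prop :=
  (∀ i j, ContDiffOn ℝ ∞ (fun y => e y i j) U) ∧
    ∀ y ∈ U, e y ∈ Moeb ∧ Represents (fun i => e y i 0) (f y)

/-- First order frames: `φ^α_0 = 0` for `α = 2, 3, 4`; they are oriented so that `φ^1_0` is a
positive multiple of `dx`. -/
def IsFirstOrderFrame (e : ℝ → M6) (f : ℝ → Q4) (U : Set ℝ) : Prop :=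
  IsFrame e f U ∧ ∀ y ∈ U, 0 < mcForm e y 1 0 ∧
    mcForm e y 2 0 = 0 ∧ mcForm e y 3 0 = 0 ∧ mcForm e y 4 0 = 0

/-- Second order (Darboux) frames: moreover `φ^α_1 = 0`. -/
def IsDarbouxFrame (e : ℝ → M6) (f : ℝ → Q4) (U : Set ℝ) : Prop :=
  IsFirstOrderFrame e f U ∧ ∀ y ∈ U,
    mcForm e y 2 1 = 0 ∧ mcForm e y 3 1 = 0 ∧ mcForm e y 4 1 = 0

/-- `∑_α (p^α)²`, where `φ^0_α = p^α φ^1_0`. -/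
def pSq (e : ℝ → M6) (x : ℝ) : ℝ :=
  (mcForm e x 0 2 / mcForm e x 1 0) ^ 2 + (mcForm e x 0 3 / mcForm e x 1 0) ^ 2 +
    (mcForm e x 0 4 / mcForm e x 1 0) ^ 2

/-- `ρ dx` is the form `(∑_α (p^α)²)^{1/4} φ^1_0` at `x`, computed in a Darboux frame. -/
def HasArclengthDensity (f : ℝ → Q4) (x ρ : ℝ) : Prop :=
  ∃ U : Set ℝ, IsOpen U ∧ x ∈ U ∧ ∃ e, IsDarbouxFrame e f U ∧
    ρ = pSq e x ^ (1 / 4 : ℝ) * mcForm e x 1 0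

/-- The density of the conformal arclength (it does not depend on the Darboux frame). -/
def arclengthDensity (f : ℝ → Q4) (x : ℝ) : ℝ := Classical.epsilon (HasArclengthDensity f x)

/-- The function `s` is a conformal arclength of `f` on `I`. -/
def IsConformalArclength (f : ℝ → Q4) (I : Set ℝ) (s : ℝ → ℝ) : Prop :=
  ∀ x ∈ I, HasDerivAt s (arclengthDensity f x) x

/-! ### Genericity and Frenet frames -/

/-- The point `q` is 1-generic. -/
def Is1Generic (f : ℝ → Q4) (q : ℝ) : Prop :=
  ∃ U : Set ℝ, IsOpen U ∧ q ∈ U ∧ ∃ e, IsDarbouxFrame e f U ∧ pSq e q ≠ 0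

/-- Third order frames: Darboux frames with `φ^0_2 = φ^1_0` and `φ^0_3 = φ^0_4 = 0`. -/
def IsThirdOrderFrame (e : ℝ → M6) (f : ℝ → Q4) (U : Set ℝ) : Prop :=
  IsDarbouxFrame e f U ∧ ∀ y ∈ U,
    mcForm e y 0 2 = mcForm e y 1 0 ∧ mcForm e y 0 3 = 0 ∧ mcForm e y 0 4 = 0

/-- Special third order frames: moreover `φ^0_0 = 0`. -/
def IsSpecialThirdOrderFrame (e : ℝ → M6) (f : ℝ → Q4) (U : Set ℝ) : Prop :=
  IsThirdOrderFrame e f U ∧ ∀ y ∈ U, mcForm e y 0 0 = 0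

/-- The point `q` is 2-generic. -/
def Is2Generic (f : ℝ → Q4) (q : ℝ) : Prop :=
  Is1Generic f q ∧ ∃ U : Set ℝ, IsOpen U ∧ q ∈ U ∧ ∃ e, IsThirdOrderFrame e f U ∧
    (mcForm e q 3 2 ≠ 0 ∨ mcForm e q 4 2 ≠ 0)

/-- Fourth order frames, which for curves in the four-sphere are the Frenet frames:
`φ^4_2 = 0` and `φ^3_2 = μ₂ φ^1_0` with `μ₂ > 0`. -/
def IsFrenetFrame (e : ℝ → M6) (f : ℝ → Q4) (U : Set ℝ) : Prop :=
  IsSpecialThirdOrderFrame e f U ∧ ∀ y ∈ U, 0 < mcForm e y 3 2 ∧ mcForm e y 4 2 = 0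

/-- The point `q` is 3-generic: 2-generic with `φ^4_3 ≠ 0` in a Frenet frame. -/
def Is3Generic (f : ℝ → Q4) (q : ℝ) : Prop :=
  Is2Generic f q ∧ ∃ U : Set ℝ, IsOpen U ∧ q ∈ U ∧ ∃ e, IsFrenetFrame e f U ∧ mcForm e q 4 3 ≠ 0

/-- The conformal curvatures read in a Frenet frame:
`φ^0_1 = μ₁ φ^1_0`, `φ^3_2 = μ₂ φ^1_0`, `φ^4_3 = μ₃ φ^1_0`. -/
def HasCurvatures (e : ℝ → M6) (I : Set ℝ) (μ₁ μ₂ μ₃ : ℝ → ℝ) : Prop :=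
  ∀ x ∈ I, mcForm e x 0 1 = μ₁ x * mcForm e x 1 0 ∧ mcForm e x 3 2 = μ₂ x * mcForm e x 1 0 ∧
    mcForm e x 4 3 = μ₃ x * mcForm e x 1 0

/-! ### Conformal geodesics -/

/-- `v` is an admissible variation of `f`, defined on `I × (-ε, ε)` and supported in `[a, b]`. -/
structure IsAdmissibleVariation (v : ℝ → ℝ → Q4) (f : ℝ → Q4) (I : Set ℝ) (ε a b : ℝ) : Prop where
  smooth : ∃ F : ℝ × ℝ → V6, ContDiffOn ℝ ∞ F (I ×ˢ Ioo (-ε) ε) ∧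
    ∀ x ∈ I, ∀ t ∈ Ioo (-ε) ε, F (x, t) ∈ posCone ∧ Represents (F (x, t)) (v x t)
  immersed : ∀ t ∈ Ioo (-ε) ε, IsImmersedCurve (fun x => v x t) I
  initial : ∀ x ∈ I, v x 0 = f x
  support : ∀ x ∈ I \ Icc a b, ∀ t ∈ Ioo (-ε) ε, v x t = f x

/-- Conformal geodesics: 1-generic immersions that are extremal for the conformal arclength
functional with respect to all compactly supported variations. -/
def IsConformalGeodesic (f : ℝ → Q4) (I : Set ℝ) : Prop :=
  IsImmersedCurve f I ∧ (∀ x ∈ I, Is1Generic f x) ∧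
    ∀ (ε a b : ℝ) (v : ℝ → ℝ → Q4), 0 < ε → a ≤ b → Icc a b ⊆ I →
      IsAdmissibleVariation v f I ε a b →
      HasDerivAt (fun t => ∫ x in a..b, arclengthDensity (fun y => v y t) x) 0 0

/-! ### The explicit solution -/

/-- The matrix `Θ`, a function of the conformal curvatures; derivatives are taken in the
arclength parameter. -/
def thetaMatrix (μ₁ μ₂ μ₃ : ℝ → ℝ) (s : ℝ) : M6 :=
  !![0, 1, -μ₁ s - μ₂ s ^ 2, deriv μ₂ s, μ₂ s * μ₃ s, 0;
     0, 0, 0, -μ₂ s, 0, 1;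
     1, 0, 0, 0, 0, -μ₁ s - μ₂ s ^ 2;
     0, μ₂ s, 0, 0, 0, deriv μ₂ s;
     0, 0, 0, 0, 0, μ₂ s * μ₃ s;
     0, 0, 1, 0, 0, 0]

/-- The first integrals of the Euler-Lagrange system, except for the one that gives `μ₃`:
conservation of energy for `μ₂`. -/
def EnergyEquation (C₁ C₂ C₃ : ℝ) (μ₂ : ℝ → ℝ) (s : ℝ) : Prop :=
  1 / 2 * deriv μ₂ s ^ 2 + 1 / 2 * μ₂ s ^ 4 - C₁ * μ₂ s ^ 2 + C₂ ^ 2 / (2 * μ₂ s ^ 2) = C₃ / 2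

/-- The cubic polynomial `P`. -/
def cubicP (C₁ C₂ C₃ t : ℝ) : ℝ := -t ^ 3 + 2 * C₁ * t ^ 2 + C₃ * t - C₂ ^ 2

/-- `(C₁, C₂, C₃)` is admissible: `P` has real roots `ξ₀ < 0 < ξ₁ < ξ₂`. -/
def IsAdmissibleTriple (C₁ C₂ C₃ ξ₀ ξ₁ ξ₂ : ℝ) : Prop :=
  ξ₀ < 0 ∧ 0 < ξ₁ ∧ ξ₁ < ξ₂ ∧
    cubicP C₁ C₂ C₃ ξ₀ = 0 ∧ cubicP C₁ C₂ C₃ ξ₁ = 0 ∧ cubicP C₁ C₂ C₃ ξ₂ = 0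

/-- `lam ^ 2`, `-τ₁ ^ 2` and `-τ₂ ^ 2` are the roots of `P(-x) - x`, with `lam, τ₁, τ₂` positive
and `τ₁ < τ₂`. -/
def IsSpectralTriple (C₁ C₂ C₃ lam τ₁ τ₂ : ℝ) : Prop :=
  0 < lam ∧ 0 < τ₁ ∧ τ₁ < τ₂ ∧
    ∀ x : ℝ, cubicP C₁ C₂ C₃ (-x) - x = (x - lam ^ 2) * (x + τ₁ ^ 2) * (x + τ₂ ^ 2)

/-- The block diagonal normal form of `ω`. -/
def normalForm (lam τ₁ τ₂ : ℝ) : M6 :=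
  !![lam, 0, 0, 0, 0, 0;
     0, 0, -τ₁, 0, 0, 0;
     0, τ₁, 0, 0, 0, 0;
     0, 0, 0, 0, -τ₂, 0;
     0, 0, 0, τ₂, 0, 0;
     0, 0, 0, 0, 0, -lam]

/-- The explicit homogeneous coordinates of a conformal geodesic. -/
def explicitCurve (lam τ₁ τ₂ : ℝ) (μ₂ : ℝ → ℝ) (s₀ s : ℝ) : V6 :=
  ![√(τ₂ ^ 2 - τ₁ ^ 2) / √2 * √(μ₂ s ^ 2 + lam ^ 2) *
      Real.exp (lam * ∫ t in s₀..s, 1 / (μ₂ t ^ 2 + lam ^ 2)),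
    √(lam ^ 2 + τ₂ ^ 2) * √(μ₂ s ^ 2 - τ₁ ^ 2) *
      Real.sin (τ₁ * ∫ t in s₀..s, 1 / (τ₁ ^ 2 - μ₂ t ^ 2)),
    √(lam ^ 2 + τ₂ ^ 2) * √(μ₂ s ^ 2 - τ₁ ^ 2) *
      Real.cos (τ₁ * ∫ t in s₀..s, 1 / (τ₁ ^ 2 - μ₂ t ^ 2)),
    √(lam ^ 2 + τ₁ ^ 2) * √(τ₂ ^ 2 - μ₂ s ^ 2) *
      Real.sin (τ₂ * ∫ t in s₀..s, 1 / (τ₂ ^ 2 - μ₂ t ^ 2)),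
    √(lam ^ 2 + τ₁ ^ 2) * √(τ₂ ^ 2 - μ₂ s ^ 2) *
      Real.cos (τ₂ * ∫ t in s₀..s, 1 / (τ₂ ^ 2 - μ₂ t ^ 2)),
    √(τ₂ ^ 2 - τ₁ ^ 2) / √2 * √(μ₂ s ^ 2 + lam ^ 2) *
      Real.exp (-(lam * ∫ t in s₀..s, 1 / (μ₂ t ^ 2 + lam ^ 2)))]

end

end ConformalGeodesics

open ConformalGeodesics

namespace ConformalGeodesics

open Set Topology Filter
open scoped ContDiff LinearAlgebra.Projectivization Matrix

noncomputable section

/-! ### The Lorentzian form -/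

/-! The arclength density is first freed from frames. If F is any lift of the curve to the light
cone, the fourth power of the density is a rational function of the Lorentz products of F, F', F'',
F''' (`arclengthJet`, `IsDarbouxFrame.pSq_mul_pow`). Since Darboux frames exist locally
(`exists_darbouxFrame`), this determines the density (`arclengthDensity_eq`). The functional can
then be differentiated along any family of lifts, without frames along the varied curves. For a lift
that starts at e₀ of a Frenet frame, twice the derivative of the density is the derivative of its
fourth power, since the density is 1 there. The derivative of the density differs from the
Euler-Lagrange pairing by an exact derivative (`IsFrenetSystem.hasDerivAt_boundaryTerm`). Hence the
first variation formula `IsFrenetVariation.firstVariation`. Normal variations give the equations μ₁'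
= -3μ₂μ₂', μ₂'' = μ₂³ + μ₂μ₃² + 2μ₁μ₂ and (μ₂²μ₃)' = 0. These equations imply the Lax equation for
Θ, so eΘe⁻¹ is constant. They have the integrals C₁, C₂, C₃, and conservation of energy reads
(μ₂μ₂')² = P(μ₂²). As μ₂ is not constant and C₂ ≠ 0, P is positive at some positive number and
negative at 0, which yields the three real roots. The characteristic polynomial of Θ at t is P(-x) -
x with x = t², and its roots are separated by those of P. The explicit formula comes from
diagonalizing Θ from the left. A left eigenvector of Θ is determined by its entry 0, so a matrix E
with EΘ = NE, N the normal form, is determined by its column 0 (`explicitFrame`). With the explicit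
curve, normalized, as column 0, E is a Lorentz matrix (`explicitFrame_lorentz`), and its determinant
has the sign opposite to that of C₂ (`mul_det_explicitFrame_neg`). Differentiating EΘ = NE and using
the Lax equation shows that X = E' - Eφ also satisfies XΘ = NX. Its column 0 vanishes, so X = 0: E
solves the Frenet system (`IsSpectralSolution.isFrenetSystem`). For a geodesic with frame e, A =
Ee⁻¹ is therefore constant, which is the direct statement. For the converse, GE is itself a Frenet
frame along [Gε]. The Euler-Lagrange equations follow from the energy equation because μ₂ is not
constant (`deriv_deriv_of_energyEquation`), and the first variation formula gives criticality for
all admissible variations. -/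

lemma lorentz_eq (v w : V6) : lorentz v w =
    -(v 0 * w 5) - v 5 * w 0 + v 1 * w 1 + v 2 * w 2 + v 3 * w 3 + v 4 * w 4 := by
  simp [lorentz, lorentzS, Matrix.mulVec, dotProduct, Fin.sum_univ_six]; ring

lemma lorentz_comm (v w : V6) : lorentz v w = lorentz w v := by
  simp only [lorentz_eq]; ring

lemma lorentz_add_left (u v w : V6) : lorentz (u + v) w = lorentz u w + lorentz v w := by
  simp only [lorentz_eq, Pi.add_apply]; ring

lemma lorentz_add_right (u v w : V6) : lorentz u (v + w) = lorentz u v + lorentz u w := by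
  simp only [lorentz_eq, Pi.add_apply]; ring

lemma lorentz_sub_left (u v w : V6) : lorentz (u - v) w = lorentz u w - lorentz v w := by
  simp only [lorentz_eq, Pi.sub_apply]; ring

lemma lorentz_sub_right (u v w : V6) : lorentz u (v - w) = lorentz u v - lorentz u w := by
  simp only [lorentz_eq, Pi.sub_apply]; ring

lemma lorentz_neg_left (v w : V6) : lorentz (-v) w = -lorentz v w := by
  simp only [lorentz_eq, Pi.neg_apply]; ring

lemma lorentz_neg_right (v w : V6) : lorentz v (-w) = -lorentz v w := by
  simp only [lorentz_eq, Pi.neg_apply]; ring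

lemma lorentz_smul_left (c : ℝ) (v w : V6) : lorentz (c • v) w = c * lorentz v w := by
  simp only [lorentz_eq, Pi.smul_apply, smul_eq_mul]; ring

lemma lorentz_smul_right (c : ℝ) (v w : V6) : lorentz v (c • w) = c * lorentz v w := by
  simp only [lorentz_eq, Pi.smul_apply, smul_eq_mul]; ring

lemma lorentz_zero_left (w : V6) : lorentz 0 w = 0 := by simp [lorentz_eq]

lemma HasDerivAt.lorentz {F G : ℝ → V6} {F' G' : V6} {x : ℝ} (hF : HasDerivAt F F' x)
    (hG : HasDerivAt G G' x) :
    HasDerivAt (fun y => lorentz (F y) (G y)) (lorentz F' (G x) + lorentz (F x) G') x := by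
  rw [hasDerivAt_pi] at hF hG
  simp only [lorentz_eq]
  have h := (((((((hF 0).mul (hG 5)).neg).sub ((hF 5).mul (hG 0))).add ((hF 1).mul (hG 1))).add
    ((hF 2).mul (hG 2))).add ((hF 3).mul (hG 3))).add ((hF 4).mul (hG 4))
  refine h.congr_deriv ?_
  ring

lemma ContDiffOn.lorentz {E : Type*} [NormedAddCommGroup E] [NormedSpace ℝ E] {n : WithTop ℕ∞}
    {F G : E → V6} {U : Set E} (hF : ContDiffOn ℝ n F U) (hG : ContDiffOn ℝ n G U) :
    ContDiffOn ℝ n (fun y => lorentz (F y) (G y)) U := by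
  rw [contDiffOn_pi] at hF hG
  simp only [lorentz_eq]
  exact ((((((((hF 0).mul (hG 5)).neg).sub ((hF 5).mul (hG 0))).add ((hF 1).mul (hG 1))).add
    ((hF 2).mul (hG 2))).add ((hF 3).mul (hG 3))).add ((hF 4).mul (hG 4)))

/-! ### The light cone -/

lemma posCone_ne_zero {v : V6} (hv : v ∈ posCone) : v ≠ 0 := by
  rintro rfl
  simpa using hv.2

/-- On null vectors (v⁰ + v⁵)² is a positive definite form in the remaining five coordinates. The
Cauchy-Schwarz inequality there shows that the product of a vector of the cone with a null vector
satisfying v⁰ + v⁵ ≤ 0 is nonnegative. -/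
lemma mem_posCone_of_lorentz_neg {a b : V6} (ha : a ∈ posCone) (hb : lorentz b b = 0)
    (hab : lorentz a b < 0) : b ∈ posCone := by
  refine ⟨hb, ?_⟩
  have ha1 := ha.1
  have ha2 := ha.2
  by_contra hneg
  rw [not_lt] at hneg
  simp only [lorentz_eq] at ha1 hb hab
  set P := a 0 + a 5 with hP
  set Q := -(b 0 + b 5) with hQ
  have hQ0 : 0 ≤ Q := by linarith
  have hA : P ^ 2 = (a 0 - a 5) ^ 2 + 2 * (a 1 ^ 2 + a 2 ^ 2 + a 3 ^ 2 + a 4 ^ 2) := by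
    rw [hP]; linarith
  have hB : Q ^ 2 = (b 0 - b 5) ^ 2 + 2 * (b 1 ^ 2 + b 2 ^ 2 + b 3 ^ 2 + b 4 ^ 2) := by
    rw [hQ]; linarith
  have key : 0 ≤ P * Q + ((a 0 - a 5) * (b 0 - b 5) +
      2 * (a 1 * b 1 + a 2 * b 2 + a 3 * b 3 + a 4 * b 4)) := by
    by_contra hlt
    rw [not_le] at hlt
    have h1 : (P * Q) ^ 2 < ((a 0 - a 5) * (b 0 - b 5) +
      2 * (a 1 * b 1 + a 2 * b 2 + a 3 * b 3 + a 4 * b 4)) ^ 2 := by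
      have : 0 ≤ P * Q := by positivity
      nlinarith
    rw [mul_pow, hA, hB] at h1
    have := sq_nonneg ((a 0 - a 5) * b 1 - (b 0 - b 5) * a 1)
    have := sq_nonneg ((a 0 - a 5) * b 2 - (b 0 - b 5) * a 2)
    have := sq_nonneg ((a 0 - a 5) * b 3 - (b 0 - b 5) * a 3)
    have := sq_nonneg ((a 0 - a 5) * b 4 - (b 0 - b 5) * a 4)
    have := sq_nonneg (a 1 * b 2 - b 1 * a 2)
    have := sq_nonneg (a 1 * b 3 - b 1 * a 3)
    have := sq_nonneg (a 1 * b 4 - b 1 * a 4)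
    have := sq_nonneg (a 2 * b 3 - b 2 * a 3)
    have := sq_nonneg (a 2 * b 4 - b 2 * a 4)
    have := sq_nonneg (a 3 * b 4 - b 3 * a 4)
    linarith
  rw [hP, hQ] at key
  linarith

/-- A vector orthogonal to a vector of the light cone is spacelike or a multiple of it. -/
lemma exists_smul_of_orthogonal {a u : V6} (ha : a ∈ posCone) (h : lorentz a u = 0) :
    0 < lorentz u u ∨ ∃ c : ℝ, u = c • a := by
  have ha2 := ha.2
  -- This multiple of a is subtracted so that the rest z has z⁰ + z⁵ = 0, a hyperplane on which the
  -- metric is positive definite. The norm is unaffected, a being null and orthogonal to u.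
  set c := (u 0 + u 5) / (a 0 + a 5) with hc
  have hz5 : (u - c • a) 5 = -(u - c • a) 0 := by
    simp only [Pi.sub_apply, Pi.smul_apply, smul_eq_mul]
    have : c * (a 0 + a 5) = u 0 + u 5 := by rw [hc]; field_simp
    linarith
  have hzz : lorentz (u - c • a) (u - c • a) = lorentz u u := by
    simp only [lorentz_sub_left, lorentz_sub_right, lorentz_smul_left, lorentz_smul_right, ha.1,
      lorentz_comm u a, h]
    ring
  set z := u - c • a with hz
  rw [lorentz_eq z z, hz5] at hzz
  by_cases h0 : z = 0
  · exact Or.inr ⟨c, sub_eq_zero.1 h0⟩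
  · left
    rw [← hzz]
    by_contra hle
    rw [not_lt] at hle
    apply h0
    have hsq := fun i => sq_nonneg (z i)
    have e0 : z 0 = 0 := by nlinarith [hsq 0, hsq 1, hsq 2, hsq 3, hsq 4]
    have e1 : z 1 = 0 := by nlinarith [hsq 0, hsq 1, hsq 2, hsq 3, hsq 4]
    have e2 : z 2 = 0 := by nlinarith [hsq 0, hsq 1, hsq 2, hsq 3, hsq 4]
    have e3 : z 3 = 0 := by nlinarith [hsq 0, hsq 1, hsq 2, hsq 3, hsq 4]
    have e4 : z 4 = 0 := by nlinarith [hsq 0, hsq 1, hsq 2, hsq 3, hsq 4]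
    ext i
    fin_cases i
    · exact e0
    · exact e1
    · exact e2
    · exact e3
    · exact e4
    · simpa [e0] using hz5

/-- Applied to a lift and its derivative, this turns the immersion condition into an open
inequality, which is how immersions are handled throughout. -/
lemma linearIndependent_iff_lorentz_pos {a u : V6} (ha : a ∈ posCone) (h : lorentz a u = 0) :
    LinearIndependent ℝ ![a, u] ↔ 0 < lorentz u u := by
  constructor
  · intro hli
    rcases exists_smul_of_orthogonal ha h with h1 | ⟨c, rfl⟩
    · exact h1
    · rw [LinearIndependent.pair_iff] at hli
      have := hli c (-1) (by simp)
      norm_num at this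
  · intro hpos
    rw [LinearIndependent.pair_iff]
    intro s t hst
    have ht : t = 0 := by
      have h1 : lorentz (s • a + t • u) u = 0 := by rw [hst, lorentz_zero_left]
      rw [lorentz_add_left, lorentz_smul_left, lorentz_smul_left, h] at h1
      have : t * lorentz u u = 0 := by linarith
      exact (mul_eq_zero.1 this).resolve_right hpos.ne'
    refine ⟨?_, ht⟩
    rw [ht, zero_smul, add_zero] at hst
    exact (smul_eq_zero.1 hst).resolve_right (posCone_ne_zero ha)

/-! ### Homogeneous coordinates -/

lemma Represents.smul {w : V6} {p : ℙ ℝ V6} (h : Represents w p) {c : ℝ} (hc : c ≠ 0) :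
    Represents (c • w) p := by
  obtain ⟨hw, rfl⟩ := h
  refine ⟨smul_ne_zero hc hw, ?_⟩
  rw [Projectivization.mk_eq_mk_iff']
  exact ⟨c⁻¹, by rw [smul_smul, inv_mul_cancel₀ hc, one_smul]⟩

/-- The linear form v⁰ + v⁵, positive on the cone, computes the ratio of two representatives; hence
such ratios are smooth along smooth lifts. -/
lemma Represents.eq_smul {a b : V6} {p : ℙ ℝ V6} (ha : Represents a p) (hb : Represents b p)
    (hb' : b ∈ posCone) : a = ((a 0 + a 5) / (b 0 + b 5)) • b := by
  obtain ⟨ha0, rfl⟩ := ha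
  obtain ⟨hb0, h⟩ := hb
  rw [Projectivization.mk_eq_mk_iff'] at h
  obtain ⟨c, rfl⟩ := h
  have := hb'.2
  congr 1
  simp only [Pi.smul_apply, smul_eq_mul]
  field_simp

lemma mk_mem_Q4 {w : V6} (hw : w ≠ 0) (h : lorentz w w = 0) : Projectivization.mk ℝ w hw ∈ Q4 := by
  obtain ⟨a, ha⟩ := Projectivization.exists_smul_eq_mk_rep ℝ w hw
  change lorentz _ _ = 0
  rw [← ha, Units.smul_def, lorentz_smul_left, lorentz_smul_right, h]
  simp

/-! ### The Lorentz group and its Lie algebra -/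

lemma lorentzS_mul_self : lorentzS * lorentzS = 1 := by
  ext i j
  fin_cases i <;> fin_cases j <;> simp [lorentzS, Matrix.mul_apply, Fin.sum_univ_six]

lemma lorentzS_transpose : lorentzSᵀ = lorentzS := by
  ext i j
  fin_cases i <;> fin_cases j <;> simp [lorentzS]

lemma lorentz_eq_transpose_mul (G : M6) (i j : Fin 6) :
    (Gᵀ * lorentzS * G) i j = lorentz (fun k => G k i) (fun k => G k j) := by
  simp only [lorentz_eq, Matrix.mul_apply, Fin.sum_univ_six, lorentzS, Matrix.transpose_apply]
  simp
  ring

lemma lorentz_mulVec {G : M6} (h : Gᵀ * lorentzS * G = lorentzS) (v w : V6) :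
    lorentz (G *ᵥ v) (G *ᵥ w) = lorentz v w := by
  conv_rhs => rw [lorentz, ← h]
  rw [lorentz, Matrix.dotProduct_mulVec, Matrix.dotProduct_mulVec, ← Matrix.vecMul_transpose,
    Matrix.vecMul_vecMul, Matrix.dotProduct_mulVec, Matrix.vecMul_vecMul, mul_assoc]

lemma inv_eq_of_lorentz {G : M6} (h : Gᵀ * lorentzS * G = lorentzS) :
    G⁻¹ = lorentzS * Gᵀ * lorentzS := by
  refine Matrix.inv_eq_left_inv ?_
  rw [mul_assoc, mul_assoc, ← mul_assoc Gᵀ, h, lorentzS_mul_self]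

lemma isUnit_det_of_lorentz {G : M6} (h : Gᵀ * lorentzS * G = lorentzS) : IsUnit G.det := by
  refine Matrix.isUnit_det_of_left_inverse (B := lorentzS * Gᵀ * lorentzS) ?_
  rw [mul_assoc, mul_assoc, ← mul_assoc Gᵀ, h, lorentzS_mul_self]

lemma det_sq_of_lorentz {G : M6} (h : Gᵀ * lorentzS * G = lorentzS) : G.det ^ 2 = 1 := by
  have h1 := congrArg Matrix.det h
  rw [Matrix.det_mul, Matrix.det_mul, Matrix.det_transpose] at h1
  have h2 : lorentzS.det * lorentzS.det = 1 := by
    rw [← Matrix.det_mul, lorentzS_mul_self, Matrix.det_one]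
  have h3 : lorentzS.det ≠ 0 := fun h0 => by simp [h0] at h2
  apply mul_left_cancel₀ h3
  linarith

/-- A Lorentz matrix whose first column is on the positive light cone preserves that cone. -/
lemma isConformalMotion_of_col {G : M6} (h : Gᵀ * lorentzS * G = lorentzS)
    (h0 : (fun i => G i 0) ∈ posCone) : IsConformalMotion G := by
  refine ⟨h, fun v hv => ?_⟩
  have e0 : (fun i => G i 0) = G *ᵥ (Pi.single 0 1) := by ext i; simp
  have e5 : (fun i => G i 5) = G *ᵥ (Pi.single 5 1) := by ext i; simp
  have h5 : (fun i => G i 5) ∈ posCone := by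
    refine mem_posCone_of_lorentz_neg h0 ?_ ?_
    · rw [e5, lorentz_mulVec h]; simp [lorentz_eq]
    · rw [e5, e0, lorentz_mulVec h]; simp [lorentz_eq]
  have hn : lorentz (G *ᵥ v) (G *ᵥ v) = 0 := by rw [lorentz_mulVec h]; exact hv.1
  have a0 : lorentz (fun i => G i 0) (G *ᵥ v) = -v 5 := by
    rw [e0, lorentz_mulVec h]; simp [lorentz_eq]
  have a5 : lorentz (fun i => G i 5) (G *ᵥ v) = -v 0 := by
    rw [e5, lorentz_mulVec h]; simp [lorentz_eq]
  have := hv.2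
  -- As v⁰ + v⁵ > 0, at least one of v⁰, v⁵ is positive, so Gv has negative product with column 0 or
  -- with column 5 of G, and both columns lie in the cone.
  by_cases hv5 : 0 < v 5
  · exact mem_posCone_of_lorentz_neg h0 hn (by linarith)
  · exact mem_posCone_of_lorentz_neg h5 hn (by linarith)

lemma IsConformalMotion.col_mem {G : M6} (h : IsConformalMotion G) :
    (fun i => G i 0) ∈ posCone := by
  have e0 : (fun i => G i 0) = G *ᵥ (Pi.single 0 1) := by ext i; simp
  rw [e0]
  exact h.2 _ ⟨by simp [lorentz_eq], by simp⟩

lemma IsConformalMotion.mul {G H : M6} (hG : IsConformalMotion G) (hH : IsConformalMotion H) :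
    IsConformalMotion (G * H) := by
  refine ⟨?_, fun v hv => ?_⟩
  · have := hH.1
    rw [Matrix.transpose_mul]
    calc Hᵀ * Gᵀ * lorentzS * (G * H) = Hᵀ * (Gᵀ * lorentzS * G) * H := by
          simp only [mul_assoc]
      _ = lorentzS := by rw [hG.1, hH.1]
  · rw [← Matrix.mulVec_mulVec]
    exact hG.2 _ (hH.2 _ hv)

/-- The linear equations that define the Lie algebra, solved for the dependent entries. They let the
few conditions imposed on a frame determine its whole Maurer-Cartan matrix. -/
lemma moebAlg_entries {X : M6} (h : X ∈ moebAlg) :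
    (X 5 0 = 0 ∧ X 0 5 = 0 ∧ X 5 5 = -X 0 0) ∧
    (X 5 1 = X 1 0 ∧ X 5 2 = X 2 0 ∧ X 5 3 = X 3 0 ∧ X 5 4 = X 4 0) ∧
    (X 1 5 = X 0 1 ∧ X 2 5 = X 0 2 ∧ X 3 5 = X 0 3 ∧ X 4 5 = X 0 4) ∧
    (X 1 1 = 0 ∧ X 2 2 = 0 ∧ X 3 3 = 0 ∧ X 4 4 = 0) ∧
    (X 1 2 = -X 2 1 ∧ X 1 3 = -X 3 1 ∧ X 1 4 = -X 4 1 ∧ X 2 3 = -X 3 2 ∧ X 2 4 = -X 4 2 ∧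
      X 3 4 = -X 4 3) := by
  have hX : ∀ i j, (Xᵀ * lorentzS + lorentzS * X) i j = 0 := fun i j => by
    rw [show Xᵀ * lorentzS + lorentzS * X = 0 from h]; rfl
  simp only [Matrix.add_apply, Matrix.mul_apply, Fin.sum_univ_six, lorentzS,
    Matrix.transpose_apply] at hX
  have h00 := hX 0 0
  have h55 := hX 5 5
  have h05 := hX 0 5
  have h01 := hX 0 1
  have h02 := hX 0 2
  have h03 := hX 0 3
  have h04 := hX 0 4
  have h51 := hX 5 1
  have h52 := hX 5 2
  have h53 := hX 5 3
  have h54 := hX 5 4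
  have h11 := hX 1 1
  have h22 := hX 2 2
  have h33 := hX 3 3
  have h44 := hX 4 4
  have h12 := hX 1 2
  have h13 := hX 1 3
  have h14 := hX 1 4
  have h23 := hX 2 3
  have h24 := hX 2 4
  have h34 := hX 3 4
  simp at h00 h55 h05 h01 h02 h03 h04 h51 h52 h53 h54 h11 h22 h33 h44 h12 h13 h14 h23 h24 h34
  refine ⟨⟨?_, ?_, ?_⟩, ⟨?_, ?_, ?_, ?_⟩, ⟨?_, ?_, ?_, ?_⟩, ⟨?_, ?_, ?_, ?_⟩,
    ?_, ?_, ?_, ?_, ?_, ?_⟩ <;> linarith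

/-! ### Moving frames -/

/-- The columns of a moving frame. -/
def frameCol (e : ℝ → M6) (j : Fin 6) : ℝ → V6 := fun y i => e y i j

/-- Smooth curves in the Lorentz group. -/
structure IsLorentzFrame (e : ℝ → M6) (U : Set ℝ) : Prop where
  smooth : ∀ i j, ContDiffOn ℝ ∞ (fun y => e y i j) U
  lorentz : ∀ y ∈ U, (e y)ᵀ * lorentzS * e y = lorentzS

lemma IsFrame.isLorentzFrame {e : ℝ → M6} {f : ℝ → Q4} {U : Set ℝ} (h : IsFrame e f U) :
    IsLorentzFrame e U :=
  ⟨h.1, fun y hy => (h.2 y hy).1.1.1⟩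

lemma IsLorentzFrame.mono {e : ℝ → M6} {U V : Set ℝ} (h : IsLorentzFrame e U) (hV : V ⊆ U) :
    IsLorentzFrame e V :=
  ⟨fun i j => (h.smooth i j).mono hV, fun y hy => h.lorentz y (hV hy)⟩

lemma contDiffOn_deriv {E : Type*} [NormedAddCommGroup E] [NormedSpace ℝ E] {F : ℝ → E}
    {U : Set ℝ} (hF : ContDiffOn ℝ ∞ F U) (hU : IsOpen U) : ContDiffOn ℝ ∞ (deriv F) U :=
  hF.deriv_of_isOpen hU (by simp)

lemma hasDerivAt_of_contDiffOn {E : Type*} [NormedAddCommGroup E] [NormedSpace ℝ E] {F : ℝ → E}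
    {U : Set ℝ} (hF : ContDiffOn ℝ ∞ F U) (hU : IsOpen U) {x : ℝ} (hx : x ∈ U) :
    HasDerivAt F (deriv F x) x :=
  ((hF.contDiffAt (hU.mem_nhds hx)).differentiableAt (by simp)).hasDerivAt

lemma frameCol_eq_mulVec (e : ℝ → M6) (j : Fin 6) (y : ℝ) :
    frameCol e j y = e y *ᵥ Pi.single j 1 := by
  ext i; simp [frameCol]

section LorentzFrame

variable {e : ℝ → M6} {U : Set ℝ}

lemma IsLorentzFrame.contDiffOn_col (h : IsLorentzFrame e U) (j : Fin 6) :
    ContDiffOn ℝ ∞ (frameCol e j) U :=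
  contDiffOn_pi.2 fun i => h.smooth i j

lemma IsLorentzFrame.lorentz_col (h : IsLorentzFrame e U) (i j : Fin 6) {y : ℝ} (hy : y ∈ U) :
    ConformalGeodesics.lorentz (frameCol e i y) (frameCol e j y) = lorentzS i j := by
  rw [← h.lorentz y hy, lorentz_eq_transpose_mul]; rfl

/-- The matrix of derivatives of the entries. -/
def frameDeriv (e : ℝ → M6) (x : ℝ) : M6 := Matrix.of fun i j => deriv (fun y => e y i j) x

lemma IsLorentzFrame.frameDeriv_eq (h : IsLorentzFrame e U) {x : ℝ} (hx : x ∈ U) :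
    frameDeriv e x = e x * mcForm e x := by
  rw [mcForm, ← mul_assoc, Matrix.mul_nonsing_inv _ (isUnit_det_of_lorentz (h.lorentz x hx)),
    one_mul]
  rfl

lemma IsLorentzFrame.hasDerivAt_col (h : IsLorentzFrame e U) (hU : IsOpen U) {x : ℝ} (hx : x ∈ U)
    (j : Fin 6) : HasDerivAt (frameCol e j) (e x *ᵥ fun a => mcForm e x a j) x := by
  rw [hasDerivAt_pi]
  intro i
  have h1 := hasDerivAt_of_contDiffOn (h.smooth i j) hU hx
  refine h1.congr_deriv ?_
  have := congrFun (congrFun (h.frameDeriv_eq hx) i) j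
  simpa [frameDeriv, Matrix.mul_apply, Matrix.mulVec, dotProduct] using this

lemma IsLorentzFrame.deriv_col (h : IsLorentzFrame e U) (hU : IsOpen U) {x : ℝ} (hx : x ∈ U)
    (j : Fin 6) : deriv (frameCol e j) x = e x *ᵥ fun a => mcForm e x a j :=
  (h.hasDerivAt_col hU hx j).deriv

/-- Lorentz matrices preserve products, so coordinates in the frame are products with the dual frame
eS. Smoothness of φ follows without differentiating an inverse matrix. -/
lemma IsLorentzFrame.mcForm_apply (h : IsLorentzFrame e U) (hU : IsOpen U) {x : ℝ} (hx : x ∈ U)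
    (a b : Fin 6) : mcForm e x a b =
      ConformalGeodesics.lorentz (e x *ᵥ (fun i => lorentzS i a)) (deriv (frameCol e b) x) := by
  rw [h.deriv_col hU hx, lorentz_mulVec (h.lorentz x hx), lorentz_eq]
  fin_cases a <;> simp [lorentzS]

lemma IsLorentzFrame.mcForm_apply' (h : IsLorentzFrame e U) (hU : IsOpen U) {x : ℝ} (hx : x ∈ U)
    (b : Fin 6) :
    mcForm e x 0 b = -ConformalGeodesics.lorentz (frameCol e 5 x) (deriv (frameCol e b) x) ∧
    mcForm e x 1 b = ConformalGeodesics.lorentz (frameCol e 1 x) (deriv (frameCol e b) x) ∧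
    mcForm e x 2 b = ConformalGeodesics.lorentz (frameCol e 2 x) (deriv (frameCol e b) x) ∧
    mcForm e x 3 b = ConformalGeodesics.lorentz (frameCol e 3 x) (deriv (frameCol e b) x) ∧
    mcForm e x 4 b = ConformalGeodesics.lorentz (frameCol e 4 x) (deriv (frameCol e b) x) ∧
    mcForm e x 5 b = -ConformalGeodesics.lorentz (frameCol e 0 x) (deriv (frameCol e b) x) := by
  simp only [h.deriv_col hU hx, frameCol_eq_mulVec e _ x, lorentz_mulVec (h.lorentz x hx),
    lorentz_eq]
  simp

lemma IsLorentzFrame.contDiffOn_mcForm (h : IsLorentzFrame e U) (hU : IsOpen U) (a b : Fin 6) :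
    ContDiffOn ℝ ∞ (fun x => mcForm e x a b) U := by
  have h1 : ContDiffOn ℝ ∞ (fun x => ConformalGeodesics.lorentz (e x *ᵥ (fun i => lorentzS i a))
      (deriv (frameCol e b) x)) U := by
    refine ContDiffOn.lorentz ?_ (contDiffOn_deriv (h.contDiffOn_col b) hU)
    rw [contDiffOn_pi]
    intro i
    simp only [Matrix.mulVec, dotProduct]
    exact ContDiffOn.sum fun j _ => (h.smooth i j).mul contDiffOn_const
  exact h1.congr fun x hx => h.mcForm_apply hU hx a b

/-- Obtained by differentiating the relation ᵗe S e = S entry by entry. -/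
lemma IsLorentzFrame.mcForm_mem (h : IsLorentzFrame e U) (hU : IsOpen U) {x : ℝ} (hx : x ∈ U) :
    mcForm e x ∈ moebAlg := by
  have hL := h.lorentz x hx
  have h1 : (frameDeriv e x)ᵀ * lorentzS * e x + (e x)ᵀ * lorentzS * frameDeriv e x = 0 := by
    ext i j
    have hd := HasDerivAt.lorentz (hasDerivAt_of_contDiffOn (h.contDiffOn_col i) hU hx)
      (hasDerivAt_of_contDiffOn (h.contDiffOn_col j) hU hx)
    have hc : HasDerivAt (fun y => ConformalGeodesics.lorentz (frameCol e i y) (frameCol e j y))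
        0 x := by
      refine (hasDerivAt_const x (lorentzS i j)).congr_of_eventuallyEq ?_
      filter_upwards [hU.mem_nhds hx] with y hy using h.lorentz_col i j hy
    have h2 := hd.unique hc
    have hcol : ∀ j, deriv (frameCol e j) x = fun k => frameDeriv e x k j := by
      intro j
      rw [h.deriv_col hU hx, h.frameDeriv_eq hx]
      ext k
      simp [Matrix.mul_apply, Matrix.mulVec, dotProduct]
    rw [hcol, hcol, lorentz_eq, lorentz_eq] at h2
    simp only [frameCol] at h2
    simp only [Matrix.add_apply, Matrix.mul_apply, Fin.sum_univ_six, lorentzS,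
      Matrix.transpose_apply, Matrix.zero_apply]
    simp
    linarith
  rw [h.frameDeriv_eq hx, Matrix.transpose_mul] at h1
  calc (mcForm e x)ᵀ * lorentzS + lorentzS * mcForm e x
      = (mcForm e x)ᵀ * ((e x)ᵀ * lorentzS * e x) + ((e x)ᵀ * lorentzS * e x) * mcForm e x := by
        rw [hL]
    _ = 0 := by rw [← h1]; simp only [mul_assoc]

/-- Covariant differentiation of a vector field given by its coordinates in a moving frame. -/
lemma IsLorentzFrame.hasDerivAt_mulVec (h : IsLorentzFrame e U) (hU : IsOpen U) {x : ℝ}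
    (hx : x ∈ U) {c : ℝ → V6} {c' : V6} (hc : HasDerivAt c c' x) :
    HasDerivAt (fun y => e y *ᵥ c y) (e x *ᵥ (c' + mcForm e x *ᵥ c x)) x := by
  rw [hasDerivAt_pi] at hc ⊢
  intro i
  have h1 : ∀ j, HasDerivAt (fun y => e y i j * c y j)
      ((e x * mcForm e x) i j * c x j + e x i j * c' j) x := by
    intro j
    refine HasDerivAt.mul ?_ (hc j)
    rw [← h.frameDeriv_eq hx]
    exact hasDerivAt_of_contDiffOn (h.smooth i j) hU hx
  have h2 := HasDerivAt.fun_sum (u := Finset.univ) fun j _ => h1 j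
  refine h2.congr_deriv ?_
  rw [Finset.sum_add_distrib, Matrix.mulVec_add, Matrix.mulVec_mulVec]
  simp only [Matrix.mulVec, dotProduct, Pi.add_apply]
  ring

end LorentzFrame

/-! ### The density of the conformal arclength in terms of a lift -/

/-- The fourth power of the density of the conformal arclength, as a function of the 3-jet of a
lift to the light cone. The numerator is, up to sign, the Gram determinant of the jet. -/
def arclengthJet (v₀ v₁ v₂ v₃ : V6) : ℝ :=
  (lorentz v₀ v₂ ^ 2 * (lorentz v₁ v₁ * lorentz v₃ v₃ - lorentz v₁ v₃ ^ 2) +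
    lorentz v₀ v₃ ^ 2 * (lorentz v₁ v₁ * lorentz v₂ v₂ - lorentz v₁ v₂ ^ 2) -
    2 * lorentz v₀ v₂ * lorentz v₀ v₃ *
      (lorentz v₁ v₁ * lorentz v₂ v₃ - lorentz v₁ v₂ * lorentz v₁ v₃)) / lorentz v₁ v₁ ^ 4

/-- The 3-jet of a lift has this triangular shape in a Darboux frame, with r = φ¹₀ and nₐ = φ⁰ₐ. The
tangential coordinates and the scale q cancel, so only the invariant remains. -/
lemma arclengthJet_triangular {q a₁ b₁ a₂ b₂ d₂ a₃ b₃ d₃ n₂ n₃ n₄ r : ℝ} (hr : 0 < r) (hq : q ≠ 0)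
    (hb : b₁ = r * q) (hd : d₂ = r * b₁) :
    arclengthJet ![q, 0, 0, 0, 0, 0] ![a₁, b₁, 0, 0, 0, 0] ![a₂, b₂, 0, 0, 0, d₂]
      ![a₃, b₃, n₂ * d₂, n₃ * d₂, n₄ * d₂, d₃] =
    ((n₂ / r) ^ 2 + (n₃ / r) ^ 2 + (n₄ / r) ^ 2) * r ^ 4 := by
  subst hd hb
  simp only [arclengthJet, lorentz_eq]
  simp
  field_simp
  ring

lemma hasDerivAt_vec6 {a b c d f g : ℝ → ℝ} {a' b' c' d' f' g' x : ℝ} (ha : HasDerivAt a a' x)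
    (hb : HasDerivAt b b' x) (hc : HasDerivAt c c' x) (hd : HasDerivAt d d' x)
    (hf : HasDerivAt f f' x) (hg : HasDerivAt g g' x) :
    HasDerivAt (fun y => (![a y, b y, c y, d y, f y, g y] : V6)) ![a', b', c', d', f', g'] x := by
  rw [hasDerivAt_pi]
  intro i
  fin_cases i
  exacts [ha, hb, hc, hd, hf, hg]

/-- The left side depends on the frame alone and the right side on the lift alone, so each is
independent of its choice. The lift is written q e₀ and differentiated covariantly three times; the
Darboux conditions keep the first two derivatives in the span of e₀, e₁, e₅. -/
lemma IsDarbouxFrame.pSq_mul_pow {e : ℝ → M6} {f : ℝ → Q4} {U V : Set ℝ} (hU : IsOpen U)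
    (he : IsDarbouxFrame e f U) {x : ℝ} (hxU : x ∈ U) (hV : IsOpen V) (hxV : x ∈ V)
    {F : ℝ → V6} (hF : ContDiffOn ℝ ∞ F V)
    (hFf : ∀ y ∈ V, F y ∈ posCone ∧ Represents (F y) (f y)) :
    pSq e x * mcForm e x 1 0 ^ 4 =
      arclengthJet (F x) (deriv F x) (deriv (deriv F) x) (deriv (deriv (deriv F)) x) := by
  have hW : IsOpen (U ∩ V) := hU.inter hV
  have hxW : x ∈ U ∩ V := ⟨hxU, hxV⟩
  have hL : IsLorentzFrame e (U ∩ V) := he.1.1.isLorentzFrame.mono inter_subset_left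
  have hpos : ∀ y ∈ U ∩ V, frameCol e 0 y ∈ posCone := fun y hy =>
    ((he.1.1.2 y hy.1).1.1).col_mem
  set q : ℝ → ℝ := fun y => (F y 0 + F y 5) / (frameCol e 0 y 0 + frameCol e 0 y 5) with hq
  have hq0 : ∀ y ∈ U ∩ V, q y ≠ 0 := fun y hy =>
    (div_pos (hFf y hy.2).1.2 (hpos y hy).2).ne'
  have hqs : ContDiffOn ℝ ∞ q (U ∩ V) := by
    have h1 := contDiffOn_pi.1 (hF.mono (inter_subset_right (s := U)))
    have h2 := contDiffOn_pi.1 (hL.contDiffOn_col 0)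
    exact ((h1 0).add (h1 5)).div ((h2 0).add (h2 5)) fun y hy => (hpos y hy).2.ne'
  have hmc := fun i j => hL.contDiffOn_mcForm hW i j
  have hD := fun {g : ℝ → ℝ} (hg : ContDiffOn ℝ ∞ g (U ∩ V)) y (hy : y ∈ U ∩ V) =>
    hasDerivAt_of_contDiffOn hg hW hy
  have hF0 : ∀ y ∈ U ∩ V, F y = e y *ᵥ ![q y, 0, 0, 0, 0, 0] := by
    intro y hy
    rw [(hFf y hy.2).2.eq_smul (he.1.1.2 y hy.1).2 (hpos y hy)]
    ext i
    simp [Matrix.mulVec, dotProduct, Fin.sum_univ_six, hq, frameCol, mul_comm]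
  set a₁ : ℝ → ℝ := fun y => deriv q y + mcForm e y 0 0 * q y with ha₁
  set b₁ : ℝ → ℝ := fun y => mcForm e y 1 0 * q y with hb₁
  have ha₁s : ContDiffOn ℝ ∞ a₁ (U ∩ V) := (contDiffOn_deriv hqs hW).add ((hmc 0 0).mul hqs)
  have hb₁s : ContDiffOn ℝ ∞ b₁ (U ∩ V) := (hmc 1 0).mul hqs
  have hF1 : ∀ y ∈ U ∩ V, deriv F y = e y *ᵥ ![a₁ y, b₁ y, 0, 0, 0, 0] := by
    intro y hy
    have h1 := hL.hasDerivAt_mulVec hW hy (hasDerivAt_vec6 (hD hqs y hy) (hasDerivAt_const y 0)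
      (hasDerivAt_const y 0) (hasDerivAt_const y 0) (hasDerivAt_const y 0) (hasDerivAt_const y 0))
    have h2 : F =ᶠ[𝓝 y] fun y => e y *ᵥ ![q y, 0, 0, 0, 0, 0] := by
      filter_upwards [hW.mem_nhds hy] with z hz using hF0 z hz
    rw [h2.deriv_eq, h1.deriv]
    congr 1
    obtain ⟨⟨m1, m2, m3⟩, -⟩ := moebAlg_entries (hL.mcForm_mem hW hy)
    obtain ⟨-, d1, d2, d3⟩ := he.1.2 y hy.1
    ext i
    fin_cases i <;> simp [Matrix.mulVec, dotProduct, Fin.sum_univ_six, a₁, b₁, m1, d1, d2, d3]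
  set a₂ : ℝ → ℝ := fun y => deriv a₁ y + mcForm e y 0 0 * a₁ y + mcForm e y 0 1 * b₁ y with ha₂
  set b₂ : ℝ → ℝ := fun y => deriv b₁ y + mcForm e y 1 0 * a₁ y with hb₂
  set d₂ : ℝ → ℝ := fun y => mcForm e y 1 0 * b₁ y with hd₂
  have ha₂s : ContDiffOn ℝ ∞ a₂ (U ∩ V) :=
    ((contDiffOn_deriv ha₁s hW).add ((hmc 0 0).mul ha₁s)).add ((hmc 0 1).mul hb₁s)
  have hb₂s : ContDiffOn ℝ ∞ b₂ (U ∩ V) := (contDiffOn_deriv hb₁s hW).add ((hmc 1 0).mul ha₁s)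
  have hd₂s : ContDiffOn ℝ ∞ d₂ (U ∩ V) := (hmc 1 0).mul hb₁s
  have hF2 : ∀ y ∈ U ∩ V, deriv (deriv F) y = e y *ᵥ ![a₂ y, b₂ y, 0, 0, 0, d₂ y] := by
    intro y hy
    have h1 := hL.hasDerivAt_mulVec hW hy (hasDerivAt_vec6 (hD ha₁s y hy) (hD hb₁s y hy)
      (hasDerivAt_const y 0) (hasDerivAt_const y 0) (hasDerivAt_const y 0) (hasDerivAt_const y 0))
    have h2 : deriv F =ᶠ[𝓝 y] fun y => e y *ᵥ ![a₁ y, b₁ y, 0, 0, 0, 0] := by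
      filter_upwards [hW.mem_nhds hy] with z hz using hF1 z hz
    rw [h2.deriv_eq, h1.deriv]
    congr 1
    obtain ⟨⟨m1, m2, m3⟩, ⟨m4, m5, m6, m7⟩, -, ⟨m8, -⟩, -⟩ :=
      moebAlg_entries (hL.mcForm_mem hW hy)
    obtain ⟨-, d1, d2, d3⟩ := he.1.2 y hy.1
    obtain ⟨d4, d5, d6⟩ := he.2 y hy.1
    ext i
    fin_cases i <;> simp [Matrix.mulVec, dotProduct, Fin.sum_univ_six, a₂, b₂, d₂, m1, m4, m8,
      d1, d2, d3, d4, d5, d6]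
    ring
  have hF3 : deriv (deriv (deriv F)) x = e x *ᵥ
      ![deriv a₂ x + mcForm e x 0 0 * a₂ x + mcForm e x 0 1 * b₂ x,
        deriv b₂ x + mcForm e x 1 0 * a₂ x + mcForm e x 0 1 * d₂ x,
        mcForm e x 0 2 * d₂ x, mcForm e x 0 3 * d₂ x, mcForm e x 0 4 * d₂ x,
        deriv d₂ x + mcForm e x 1 0 * b₂ x - mcForm e x 0 0 * d₂ x] := by
    have h1 := hL.hasDerivAt_mulVec hW hxW (hasDerivAt_vec6 (hD ha₂s x hxW) (hD hb₂s x hxW)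
      (hasDerivAt_const x 0) (hasDerivAt_const x 0) (hasDerivAt_const x 0) (hD hd₂s x hxW))
    have h2 : deriv (deriv F) =ᶠ[𝓝 x] fun y => e y *ᵥ ![a₂ y, b₂ y, 0, 0, 0, d₂ y] := by
      filter_upwards [hW.mem_nhds hxW] with z hz using hF2 z hz
    rw [h2.deriv_eq, h1.deriv]
    congr 1
    obtain ⟨⟨m1, m2, m3⟩, ⟨m4, m5, m6, m7⟩, ⟨n1, n2, n3, n4⟩, ⟨m8, -⟩, -⟩ :=
      moebAlg_entries (hL.mcForm_mem hW hxW)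
    obtain ⟨-, d1, d2, d3⟩ := he.1.2 x hxU
    obtain ⟨d4, d5, d6⟩ := he.2 x hxU
    ext i
    fin_cases i <;> simp [Matrix.mulVec, dotProduct, Fin.sum_univ_six, m1, m2, m3, m4, m8,
      n1, n2, n3, n4, d1, d2, d3, d4, d5, d6] <;> ring
  have hjet : ∀ v₀ v₁ v₂ v₃ : V6, arclengthJet (e x *ᵥ v₀) (e x *ᵥ v₁) (e x *ᵥ v₂) (e x *ᵥ v₃) =
      arclengthJet v₀ v₁ v₂ v₃ := fun v₀ v₁ v₂ v₃ => by
    simp only [arclengthJet, lorentz_mulVec (hL.lorentz x hxW)]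
  rw [hF0 x hxW, hF1 x hxW, hF2 x hxW, hF3, hjet,
    arclengthJet_triangular (he.1.2 x hxU).1 (hq0 x hxW) rfl rfl, pSq]

/-! ### Existence of Darboux frames -/

/-- One step of the completion of a partial frame. At x a vector orthogonal to the n + 2 given ones
exists by dimension; its smooth orthogonal projection stays spacelike near x and can be normalized
there. -/
lemma exists_unit_normal {n : ℕ} (hn : n < 4) {e₀ e₅ : ℝ → V6} {v : Fin n → ℝ → V6} {U : Set ℝ}
    (hU : IsOpen U) {x : ℝ} (hx : x ∈ U) (h0 : ContDiffOn ℝ ∞ e₀ U) (h5 : ContDiffOn ℝ ∞ e₅ U)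
    (hv : ∀ i, ContDiffOn ℝ ∞ (v i) U) (h00 : ∀ y ∈ U, e₀ y ∈ posCone)
    (h55 : ∀ y ∈ U, lorentz (e₅ y) (e₅ y) = 0) (h05 : ∀ y ∈ U, lorentz (e₀ y) (e₅ y) = -1)
    (hv0 : ∀ y ∈ U, ∀ i, lorentz (e₀ y) (v i y) = 0)
    (hv5 : ∀ y ∈ U, ∀ i, lorentz (e₅ y) (v i y) = 0)
    (hvv : ∀ y ∈ U, ∀ i j, lorentz (v i y) (v j y) = if i = j then 1 else 0) :
    ∃ V ⊆ U, IsOpen V ∧ x ∈ V ∧ ∃ u : ℝ → V6, ContDiffOn ℝ ∞ u V ∧ ∀ y ∈ V,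
      lorentz (u y) (u y) = 1 ∧ lorentz (e₀ y) (u y) = 0 ∧ lorentz (e₅ y) (u y) = 0 ∧
      ∀ i, lorentz (v i y) (u y) = 0 := by
  let B : V6 → V6 →ₗ[ℝ] ℝ := fun v =>
    { toFun := fun w => lorentz v w
      map_add' := fun a b => lorentz_add_right v a b
      map_smul' := fun c a => lorentz_smul_right c v a }
  let T : V6 →ₗ[ℝ] (Option (Option (Fin n)) → ℝ) := LinearMap.pi fun o =>
    match o with
    | none => B (e₀ x)
    | some none => B (e₅ x)
    | some (some i) => B (v i x)
  obtain ⟨k, hk, hk0⟩ : ∃ k ∈ LinearMap.ker T, k ≠ 0 := by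
    have : LinearMap.ker T ≠ ⊥ := by
      apply LinearMap.ker_ne_bot_of_finrank_lt
      simp
      omega
    exact Submodule.exists_mem_ne_zero_of_ne_bot this
  rw [LinearMap.mem_ker] at hk
  have k0 : lorentz (e₀ x) k = 0 := congrFun hk none
  have k5 : lorentz (e₅ x) k = 0 := congrFun hk (some none)
  have kv : ∀ i, lorentz (v i x) k = 0 := fun i => congrFun hk (some (some i))
  -- A vector orthogonal to e₀ is spacelike or a multiple of e₀, and the pairing with e₅ excludes
  -- nonzero multiples.
  have kk : 0 < lorentz k k := by
    rcases exists_smul_of_orthogonal (h00 x hx) k0 with h | ⟨c, rfl⟩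
    · exact h
    · rw [lorentz_smul_right, lorentz_comm, h05 x hx] at k5
      have : c = 0 := by linarith
      simp [this] at hk0
  -- Orthogonal projection onto the complement of the given vectors. The null pair enters crosswise
  -- and with plus signs because ⟨e₀, e₅⟩ = -1.
  let z : ℝ → V6 := fun y => k + lorentz (e₅ y) k • e₀ y + lorentz (e₀ y) k • e₅ y -
    ∑ i, lorentz (v i y) k • v i y
  have hzs : ContDiffOn ℝ ∞ z U := by
    refine ContDiffOn.sub (ContDiffOn.add (ContDiffOn.add contDiffOn_const ?_) ?_) ?_
    · exact (ContDiffOn.lorentz h5 contDiffOn_const).smul h0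
    · exact (ContDiffOn.lorentz h0 contDiffOn_const).smul h5
    · exact ContDiffOn.sum fun i _ => (ContDiffOn.lorentz (hv i) contDiffOn_const).smul (hv i)
  have hsum : ∀ (w : V6) (g : Fin n → V6), lorentz w (∑ i, g i) = ∑ i, lorentz w (g i) :=
    fun w g => map_sum (B w) g _
  have hz0 : ∀ y ∈ U, lorentz (e₀ y) (z y) = 0 := by
    intro y hy
    simp only [z, lorentz_add_right, lorentz_sub_right, lorentz_smul_right, hsum, hv0 y hy,
      h05 y hy, (h00 y hy).1]
    simp
  have hz5 : ∀ y ∈ U, lorentz (e₅ y) (z y) = 0 := by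
    intro y hy
    simp only [z, lorentz_add_right, lorentz_sub_right, lorentz_smul_right, hsum, hv5 y hy,
      lorentz_comm (e₅ y) (e₀ y), h05 y hy, h55 y hy]
    simp
  have hzv : ∀ y ∈ U, ∀ i, lorentz (v i y) (z y) = 0 := by
    intro y hy i
    simp only [z, lorentz_add_right, lorentz_sub_right, lorentz_smul_right, hsum,
      lorentz_comm (v i y) (e₀ y), lorentz_comm (v i y) (e₅ y), hv0 y hy, hv5 y hy, hvv y hy]
    simp
  have hzx : z x = k := by simp [z, k0, k5, kv]
  have hzc : ContinuousOn (fun y => lorentz (z y) (z y)) U := (ContDiffOn.lorentz hzs hzs).continuousOn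
  refine ⟨U ∩ (fun y => lorentz (z y) (z y)) ⁻¹' Ioi 0, inter_subset_left,
    hzc.isOpen_inter_preimage hU isOpen_Ioi, ⟨hx, by simpa [hzx] using kk⟩,
    fun y => (√(lorentz (z y) (z y)))⁻¹ • z y, ?_, ?_⟩
  · refine ContDiffOn.smul (ContDiffOn.inv (ContDiffOn.sqrt ((ContDiffOn.lorentz hzs hzs).mono
      inter_subset_left) ?_) ?_) (hzs.mono inter_subset_left)
    · exact fun y hy => (show 0 < lorentz (z y) (z y) from hy.2).ne'
    · exact fun y hy => (Real.sqrt_pos.2 hy.2).ne'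
  · rintro y ⟨hy, hpos⟩
    have hpos : 0 < lorentz (z y) (z y) := hpos
    simp only [lorentz_smul_left, lorentz_smul_right, hz0 y hy, hz5 y hy, hzv y hy, mul_zero,
      implies_true, and_true]
    have := Real.sq_sqrt hpos.le
    have h2 := (Real.sqrt_pos.2 hpos).ne'
    field_simp
    linarith

/-- The moving frame with given columns. -/
def frameOfCols (c : Fin 6 → ℝ → V6) (y : ℝ) : M6 := Matrix.of fun i j => c j y i

lemma lorentz_frameOfCols {c : Fin 6 → ℝ → V6} {y : ℝ}
    (h : ∀ i j, i ≤ j → lorentz (c i y) (c j y) = lorentzS i j) :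
    (frameOfCols c y)ᵀ * lorentzS * frameOfCols c y = lorentzS := by
  ext i j
  rw [lorentz_eq_transpose_mul]
  rcases le_total i j with hij | hij
  · exact h i j hij
  · rw [lorentz_comm]
    exact (h j i hij).trans (congrFun (congrFun lorentzS_transpose i) j)

/-- Scaling the lift to unit speed gives e₀, its derivative is e₁, and the null vector in the span
of e₁' and e₀ is e₅. Then e₁' lies in the span of e₀ and e₅, so any normals that complete the frame
satisfy the Darboux conditions. -/
lemma exists_darbouxFrame {f : ℝ → Q4} {I : Set ℝ} (hI : IsOpen I) {F : ℝ → V6}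
    (hF : ContDiffOn ℝ ∞ F I) (hFf : ∀ y ∈ I, F y ∈ posCone ∧ Represents (F y) (f y))
    (hFi : ∀ y ∈ I, 0 < lorentz (deriv F y) (deriv F y)) {x : ℝ} (hx : x ∈ I) :
    ∃ U ⊆ I, IsOpen U ∧ x ∈ U ∧ ∃ e, IsDarbouxFrame e f U := by
  have hD := fun {g : ℝ → V6} (hg : ContDiffOn ℝ ∞ g I) y (hy : y ∈ I) =>
    hasDerivAt_of_contDiffOn hg hI hy
  have hconst : ∀ {g : ℝ → ℝ} {c g' : ℝ} {y : ℝ}, y ∈ I → (∀ z ∈ I, g z = c) →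
      HasDerivAt g g' y → g' = 0 := by
    intro g c g' y hy hg hg'
    refine hg'.unique ((hasDerivAt_const y c).congr_of_eventuallyEq ?_)
    filter_upwards [hI.mem_nhds hy] with z hz using hg z hz
  have hF1 := contDiffOn_deriv hF hI
  set r : ℝ → ℝ := fun y => (√(lorentz (deriv F y) (deriv F y)))⁻¹ with hr
  have hrs : ContDiffOn ℝ ∞ r I := ContDiffOn.inv (ContDiffOn.sqrt (ContDiffOn.lorentz hF1 hF1)
    fun y hy => (hFi y hy).ne') fun y hy => (Real.sqrt_pos.2 (hFi y hy)).ne'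
  have hr0 : ∀ y ∈ I, 0 < r y := fun y hy => inv_pos.2 (Real.sqrt_pos.2 (hFi y hy))
  have hFF' : ∀ y ∈ I, lorentz (F y) (deriv F y) = 0 := by
    intro y hy
    have := hconst hy (fun z hz => (hFf z hz).1.1) (HasDerivAt.lorentz (hD hF y hy) (hD hF y hy))
    rw [lorentz_comm (deriv F y)] at this
    linarith
  set E0 : ℝ → V6 := fun y => r y • F y with hE0
  have E0s : ContDiffOn ℝ ∞ E0 I := hrs.smul hF
  set E1 : ℝ → V6 := deriv E0 with hE1
  have E1s : ContDiffOn ℝ ∞ E1 I := contDiffOn_deriv E0s hI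
  have E2s : ContDiffOn ℝ ∞ (deriv E1) I := contDiffOn_deriv E1s hI
  -- The coefficient makes this vector null, because ⟨E0, E1'⟩ = -1.
  set E5 : ℝ → V6 := fun y => deriv E1 y + (1 / 2 * lorentz (deriv E1 y) (deriv E1 y)) • E0 y
    with hE5
  have E5s : ContDiffOn ℝ ∞ E5 I :=
    E2s.add ((contDiffOn_const.mul (ContDiffOn.lorentz E2s E2s)).smul E0s)
  have E0pos : ∀ y ∈ I, E0 y ∈ posCone := by
    intro y hy
    refine ⟨by simp only [E0, lorentz_smul_left, lorentz_smul_right, (hFf y hy).1.1, mul_zero], ?_⟩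
    have := mul_pos (hr0 y hy) (hFf y hy).1.2
    simpa [E0, mul_add] using this
  have l00 : ∀ y ∈ I, lorentz (E0 y) (E0 y) = 0 := fun y hy => (E0pos y hy).1
  have hE1eq : ∀ y ∈ I, E1 y = r y • deriv F y + deriv r y • F y := fun y hy =>
    ((hasDerivAt_of_contDiffOn hrs hI hy).smul (hD hF y hy)).deriv
  have l01 : ∀ y ∈ I, lorentz (E0 y) (E1 y) = 0 := by
    intro y hy
    have := hconst hy l00 (HasDerivAt.lorentz (hD E0s y hy) (hD E0s y hy))
    rw [lorentz_comm (deriv E0 y)] at this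
    change lorentz (E0 y) (deriv E0 y) = 0
    linarith
  have l11 : ∀ y ∈ I, lorentz (E1 y) (E1 y) = 1 := by
    intro y hy
    rw [hE1eq y hy]
    simp only [lorentz_add_left, lorentz_add_right, lorentz_smul_left, lorentz_smul_right,
      hFF' y hy, lorentz_comm (deriv F y) (F y), (hFf y hy).1.1]
    have h1 := Real.sq_sqrt (hFi y hy).le
    have h2 := (Real.sqrt_pos.2 (hFi y hy)).ne'
    simp only [hr]
    field_simp
    linarith
  have l12 : ∀ y ∈ I, lorentz (E1 y) (deriv E1 y) = 0 := by
    intro y hy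
    have := hconst hy l11 (HasDerivAt.lorentz (hD E1s y hy) (hD E1s y hy))
    rw [lorentz_comm (deriv E1 y)] at this
    linarith
  have l02 : ∀ y ∈ I, lorentz (E0 y) (deriv E1 y) = -1 := by
    intro y hy
    have := hconst hy l01 (HasDerivAt.lorentz (hD E0s y hy) (hD E1s y hy))
    have h1 : lorentz (deriv E0 y) (E1 y) = 1 := l11 y hy
    linarith
  have l05 : ∀ y ∈ I, lorentz (E0 y) (E5 y) = -1 := by
    intro y hy
    simp only [E5, lorentz_add_right, lorentz_smul_right, l00 y hy, l02 y hy]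
    ring
  have l15 : ∀ y ∈ I, lorentz (E1 y) (E5 y) = 0 := by
    intro y hy
    simp only [E5, lorentz_add_right, lorentz_smul_right, l12 y hy, lorentz_comm (E1 y) (E0 y),
      l01 y hy]
    ring
  have l55 : ∀ y ∈ I, lorentz (E5 y) (E5 y) = 0 := by
    intro y hy
    simp only [E5, lorentz_add_left, lorentz_add_right, lorentz_smul_left, lorentz_smul_right,
      l00 y hy, l02 y hy, lorentz_comm (deriv E1 y) (E0 y)]
    ring
  have l51 : ∀ y ∈ I, lorentz (E5 y) (E1 y) = 0 := fun y hy => by rw [lorentz_comm, l15 y hy]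
  obtain ⟨U2, hU2, oU2, xU2, u2, u2s, hu2⟩ := exists_unit_normal (v := ![E1]) (by norm_num) hI hx
    E0s E5s (by simpa using E1s) E0pos l55 l05 (by simpa using l01) (by simpa using l51)
    (by
      intro y hy i j
      fin_cases i; fin_cases j
      simpa using l11 y hy)
  have hu2' : ∀ y ∈ U2, lorentz (E1 y) (u2 y) = 0 := fun y hy => (hu2 y hy).2.2.2 0
  obtain ⟨U3, hU3, oU3, xU3, u3, u3s, hu3⟩ := exists_unit_normal (v := ![E1, u2]) (by norm_num)
    oU2 xU2 (E0s.mono hU2) (E5s.mono hU2)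
    (by
      intro i
      fin_cases i
      exacts [E1s.mono hU2, u2s])
    (fun y hy => E0pos y (hU2 hy)) (fun y hy => l55 y (hU2 hy)) (fun y hy => l05 y (hU2 hy))
    (by
      intro y hy i
      fin_cases i
      exacts [l01 y (hU2 hy), (hu2 y hy).2.1])
    (by
      intro y hy i
      fin_cases i
      exacts [l51 y (hU2 hy), (hu2 y hy).2.2.1])
    (by
      intro y hy i j
      fin_cases i <;> fin_cases j
      · simpa using l11 y (hU2 hy)
      · simpa using hu2' y hy
      · simpa [lorentz_comm (u2 y)] using hu2' y hy
      · simpa using (hu2 y hy).1)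
  have hu3' : ∀ y ∈ U3, lorentz (E1 y) (u3 y) = 0 := fun y hy => (hu3 y hy).2.2.2 0
  have hu23 : ∀ y ∈ U3, lorentz (u2 y) (u3 y) = 0 := fun y hy => (hu3 y hy).2.2.2 1
  have hU3I := hU3.trans hU2
  obtain ⟨U, hUU, oU, xU, u4, u4s, hu4⟩ := exists_unit_normal (v := ![E1, u2, u3]) (by norm_num)
    oU3 xU3 (E0s.mono hU3I) (E5s.mono hU3I)
    (by
      intro i
      fin_cases i
      exacts [E1s.mono hU3I, u2s.mono hU3, u3s])
    (fun y hy => E0pos y (hU3I hy)) (fun y hy => l55 y (hU3I hy)) (fun y hy => l05 y (hU3I hy))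
    (by
      intro y hy i
      fin_cases i
      exacts [l01 y (hU3I hy), (hu2 y (hU3 hy)).2.1, (hu3 y hy).2.1])
    (by
      intro y hy i
      fin_cases i
      exacts [l51 y (hU3I hy), (hu2 y (hU3 hy)).2.2.1, (hu3 y hy).2.2.1])
    (by
      intro y hy i j
      fin_cases i <;> fin_cases j
      · simpa using l11 y (hU3I hy)
      · simpa using hu2' y (hU3 hy)
      · simpa using hu3' y hy
      · simpa [lorentz_comm (u2 y)] using hu2' y (hU3 hy)
      · simpa using (hu2 y (hU3 hy)).1
      · simpa using hu23 y hy
      · simpa [lorentz_comm (u3 y)] using hu3' y hy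
      · simpa [lorentz_comm (u3 y)] using hu23 y hy
      · simpa using (hu3 y hy).1)
  have hu4' : ∀ y ∈ U, lorentz (E1 y) (u4 y) = 0 := fun y hy => (hu4 y hy).2.2.2 0
  have hu24 : ∀ y ∈ U, lorentz (u2 y) (u4 y) = 0 := fun y hy => (hu4 y hy).2.2.2 1
  have hu34 : ∀ y ∈ U, lorentz (u3 y) (u4 y) = 0 := fun y hy => (hu4 y hy).2.2.2 2
  have hUI := hUU.trans hU3I
  set c : Fin 6 → ℝ → V6 := ![E0, E1, u2, u3, u4, E5] with hc
  have hcs : ∀ j, ContDiffOn ℝ ∞ (c j) U := by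
    intro j
    fin_cases j
    exacts [E0s.mono hUI, E1s.mono hUI, u2s.mono (hUU.trans hU3), u3s.mono hUU, u4s,
      E5s.mono hUI]
  have hcL : ∀ y ∈ U, (frameOfCols c y)ᵀ * lorentzS * frameOfCols c y = lorentzS := by
    intro y hy
    have hy3 := hUU hy
    have hy2 := hU3 hy3
    have hyI := hU2 hy2
    refine lorentz_frameOfCols fun i j hij => ?_
    fin_cases i <;> fin_cases j <;> first | (exfalso; revert hij; decide) | skip
    all_goals simp only [c, lorentzS]
    · simpa using l00 y hyI
    · simpa using l01 y hyI
    · simpa using (hu2 y hy2).2.1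
    · simpa using (hu3 y hy3).2.1
    · simpa using (hu4 y hy).2.1
    · simpa using l05 y hyI
    · simpa using l11 y hyI
    · simpa using hu2' y hy2
    · simpa using hu3' y hy3
    · simpa using hu4' y hy
    · simpa using l15 y hyI
    · simpa using (hu2 y hy2).1
    · simpa using hu23 y hy3
    · simpa using hu24 y hy
    · simpa [lorentz_comm (u2 y)] using (hu2 y hy2).2.2.1
    · simpa using (hu3 y hy3).1
    · simpa using hu34 y hy
    · simpa [lorentz_comm (u3 y)] using (hu3 y hy3).2.2.1
    · simpa using (hu4 y hy).1
    · simpa [lorentz_comm (u4 y)] using (hu4 y hy).2.2.1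
    · simpa using l55 y hyI
  set d : ℝ → ℝ := fun y => (frameOfCols c y).det with hd
  have hds : ContDiffOn ℝ ∞ d U := by
    simp only [hd, Matrix.det_apply]
    refine ContDiffOn.sum fun σ _ => ContDiffOn.const_smul _ (contDiffOn_prod fun i _ => ?_)
    exact contDiffOn_pi.1 (hcs i) (σ i)
  -- The determinant d is smooth with values ±1; multiplying the last normal by d makes the
  -- determinant 1.
  set D : ℝ → M6 := fun y => Matrix.diagonal ![1, 1, 1, 1, d y, 1] with hDdef
  have hDD : ∀ y ∈ U, (D y)ᵀ * lorentzS * D y = lorentzS := by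
    intro y hy
    have h1 : d y ^ 2 = 1 := det_sq_of_lorentz (hcL y hy)
    ext i j
    simp only [D, Matrix.diagonal_transpose, Matrix.diagonal_mul, Matrix.mul_diagonal]
    fin_cases i <;> fin_cases j <;> simp [lorentzS]
    linarith
  have hcol : ∀ y i j, (frameOfCols c y * D y) i j = c j y i * ![1, 1, 1, 1, d y, 1] j := by
    intro y i j
    simp [D, Matrix.mul_diagonal, frameOfCols]
  refine ⟨U, hUI, oU, xU, fun y => frameOfCols c y * D y, ?_⟩
  set e : ℝ → M6 := fun y => frameOfCols c y * D y with he
  have heL : ∀ y ∈ U, (e y)ᵀ * lorentzS * e y = lorentzS := by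
    intro y hy
    rw [he, Matrix.transpose_mul]
    calc (D y)ᵀ * (frameOfCols c y)ᵀ * lorentzS * (frameOfCols c y * D y)
        = (D y)ᵀ * ((frameOfCols c y)ᵀ * lorentzS * frameOfCols c y) * D y := by
          simp only [mul_assoc]
      _ = lorentzS := by rw [hcL y hy, hDD y hy]
  have hes : ∀ i j, ContDiffOn ℝ ∞ (fun y => e y i j) U := by
    intro i j
    simp only [he, hcol]
    refine (contDiffOn_pi.1 (hcs j) i).mul ?_
    fin_cases j
    exacts [contDiffOn_const, contDiffOn_const, contDiffOn_const, contDiffOn_const, hds,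
      contDiffOn_const]
  have hcol0 : ∀ y, frameCol e 0 y = E0 y := fun y => by ext i; simp [frameCol, he, hcol, c]
  have hcol1 : ∀ y, frameCol e 1 y = E1 y := fun y => by ext i; simp [frameCol, he, hcol, c]
  have hcol2 : ∀ y, frameCol e 2 y = u2 y := fun y => by ext i; simp [frameCol, he, hcol, c]
  have hcol3 : ∀ y, frameCol e 3 y = u3 y := fun y => by ext i; simp [frameCol, he, hcol, c]
  have hcol4 : ∀ y, frameCol e 4 y = d y • u4 y := fun y => by
    ext i; simp [frameCol, he, hcol, c, mul_comm]
  have hfr : IsLorentzFrame e U := ⟨hes, heL⟩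
  have hderiv1 : ∀ y ∈ U, deriv E1 y =
      E5 y - (1 / 2 * lorentz (deriv E1 y) (deriv E1 y)) • E0 y := fun y _ => by simp [E5]
  refine ⟨⟨⟨hes, fun y hy => ⟨⟨isConformalMotion_of_col (heL y hy) ?_, ?_⟩, ?_⟩⟩, ?_⟩, ?_⟩
  · change frameCol e 0 y ∈ posCone
    rw [hcol0]
    exact E0pos y (hUI hy)
  · have h1 : d y ^ 2 = 1 := det_sq_of_lorentz (hcL y hy)
    have h2 : (D y).det = d y := by simp [D, Matrix.det_diagonal, Fin.prod_univ_six]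
    change (frameOfCols c y * D y).det = 1
    rw [Matrix.det_mul, h2, ← h1, sq]
  · change Represents (frameCol e 0 y) (f y)
    rw [hcol0]
    exact (hFf y (hUI hy)).2.smul (hr0 y (hUI hy)).ne'
  · intro y hy
    obtain ⟨-, h1, h2, h3, h4, -⟩ := hfr.mcForm_apply' oU hy 0
    rw [h1, h2, h3, h4, show frameCol e 0 = E0 from funext hcol0, ← hE1, hcol1, hcol2, hcol3,
      hcol4, l11 y (hUI hy), lorentz_comm, hu2' y (hU3 (hUU hy)), lorentz_comm, hu3' y (hUU hy),
      lorentz_smul_left, lorentz_comm, hu4' y hy]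
    simp
  · intro y hy
    obtain ⟨-, -, h2, h3, h4, -⟩ := hfr.mcForm_apply' oU hy 1
    have hn : ∀ u, lorentz (E0 y) u = 0 → lorentz (E5 y) u = 0 → lorentz u (deriv E1 y) = 0 := by
      intro u h0 h5
      rw [hderiv1 y hy, lorentz_comm, lorentz_sub_left, lorentz_smul_left, h0, h5]
      ring
    rw [h2, h3, h4, show frameCol e 1 = E1 from funext hcol1, hcol2, hcol3, hcol4,
      lorentz_smul_left, hn _ (hu4 y hy).2.1 (hu4 y hy).2.2.1,
      hn _ (hu3 y (hUU hy)).2.1 (hu3 y (hUU hy)).2.2.1,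
      hn _ (hu2 y (hU3 (hUU hy))).2.1 (hu2 y (hU3 (hUU hy))).2.2.1]
    simp

/-! ### The density of the conformal arclength -/

lemma lift_eq_smul {f : ℝ → Q4} {I : Set ℝ} {F G : ℝ → V6} (hF : ContDiffOn ℝ ∞ F I)
    (hFf : ∀ y ∈ I, F y ∈ posCone ∧ Represents (F y) (f y)) (hG : ContDiffOn ℝ ∞ G I)
    (hGf : ∀ y ∈ I, G y ∈ posCone ∧ Represents (G y) (f y)) :
    ∃ r : ℝ → ℝ, ContDiffOn ℝ ∞ r I ∧ ∀ y ∈ I, 0 < r y ∧ G y = r y • F y := by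
  refine ⟨fun y => (G y 0 + G y 5) / (F y 0 + F y 5), ?_, fun y hy => ⟨?_, ?_⟩⟩
  · rw [contDiffOn_pi] at hF hG
    exact ((hG 0).add (hG 5)).div ((hF 0).add (hF 5)) fun y hy => (hFf y hy).1.2.ne'
  · exact div_pos (hGf y hy).1.2 (hFf y hy).1.2
  · exact (hGf y hy).2.eq_smul (hFf y hy).2 (hFf y hy).1

lemma lorentz_self_deriv {I : Set ℝ} (hI : IsOpen I) {F : ℝ → V6} (hF : ContDiffOn ℝ ∞ F I)
    {c : ℝ} (hFc : ∀ y ∈ I, lorentz (F y) (F y) = c) {x : ℝ} (hx : x ∈ I) :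
    lorentz (F x) (deriv F x) = 0 := by
  have hd := hasDerivAt_of_contDiffOn hF hI hx
  have h1 : HasDerivAt (fun y => lorentz (F y) (F y)) 0 x := by
    refine (hasDerivAt_const x c).congr_of_eventuallyEq ?_
    filter_upwards [hI.mem_nhds hx] with z hz using hFc z hz
  have h2 := (HasDerivAt.lorentz hd hd).unique h1
  rw [lorentz_comm (deriv F x)] at h2
  linarith

/-- The immersion property does not depend on the lift: since F is null and orthogonal to F',
replacing F by rF multiplies ⟨F', F'⟩ by r². -/
lemma IsImmersedCurve.lorentz_deriv_pos {f : ℝ → Q4} {I : Set ℝ} (hI : IsOpen I)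
    (h : IsImmersedCurve f I) {G : ℝ → V6} (hG : ContDiffOn ℝ ∞ G I)
    (hGf : ∀ y ∈ I, G y ∈ posCone ∧ Represents (G y) (f y)) {x : ℝ} (hx : x ∈ I) :
    0 < lorentz (deriv G x) (deriv G x) := by
  obtain ⟨F, hF, hFf⟩ := h
  obtain ⟨r, hr, hrF⟩ := lift_eq_smul hF (fun y hy => ⟨(hFf y hy).1, (hFf y hy).2.1⟩) hG hGf
  have h0 := lorentz_self_deriv hI hF (fun y hy => (hFf y hy).1.1) hx
  have h1 := (linearIndependent_iff_lorentz_pos (hFf x hx).1 h0).1 (hFf x hx).2.2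
  have h2 : deriv G x = r x • deriv F x + deriv r x • F x := by
    have : G =ᶠ[𝓝 x] fun y => r y • F y := by
      filter_upwards [hI.mem_nhds hx] with y hy using (hrF y hy).2
    rw [this.deriv_eq]
    exact ((hasDerivAt_of_contDiffOn hr hI hx).smul (hasDerivAt_of_contDiffOn hF hI hx)).deriv
  rw [h2]
  simp only [lorentz_add_left, lorentz_add_right, lorentz_smul_left, lorentz_smul_right,
    lorentz_comm (deriv F x) (F x), h0, (hFf x hx).1.1]
  have := (hrF x hx).1
  have := mul_pos (mul_pos this this) h1
  linarith

lemma isImmersedCurve_of_lift {f : ℝ → Q4} {I : Set ℝ} (hI : IsOpen I) {F : ℝ → V6}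
    (hF : ContDiffOn ℝ ∞ F I) (hFf : ∀ y ∈ I, F y ∈ posCone ∧ Represents (F y) (f y))
    (hFi : ∀ y ∈ I, 0 < lorentz (deriv F y) (deriv F y)) : IsImmersedCurve f I :=
  ⟨F, hF, fun x hx => ⟨(hFf x hx).1, (hFf x hx).2, (linearIndependent_iff_lorentz_pos
    (hFf x hx).1 (lorentz_self_deriv hI hF (fun y hy => (hFf y hy).1.1) hx)).2 (hFi x hx)⟩⟩

/-- The fourth power of the density of the conformal arclength of the curve with lift `F`. -/
def arclengthDensityPow (F : ℝ → V6) (x : ℝ) : ℝ :=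
  arclengthJet (F x) (deriv F x) (deriv (deriv F) x) (deriv (deriv (deriv F)) x)

lemma pSq_nonneg (e : ℝ → M6) (x : ℝ) : 0 ≤ pSq e x := by unfold pSq; positivity

lemma IsDarbouxFrame.density_eq {e : ℝ → M6} {f : ℝ → Q4} {U V : Set ℝ} (hU : IsOpen U)
    (he : IsDarbouxFrame e f U) {x : ℝ} (hxU : x ∈ U) (hV : IsOpen V) (hxV : x ∈ V)
    {F : ℝ → V6} (hF : ContDiffOn ℝ ∞ F V)
    (hFf : ∀ y ∈ V, F y ∈ posCone ∧ Represents (F y) (f y)) :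
    pSq e x ^ (1 / 4 : ℝ) * mcForm e x 1 0 = arclengthDensityPow F x ^ (1 / 4 : ℝ) := by
  have hpos := (he.1.2 x hxU).1
  rw [arclengthDensityPow, ← he.pSq_mul_pow hU hxU hV hxV hF hFf,
    Real.mul_rpow (pSq_nonneg e x) (by positivity)]
  congr 1
  rw [← Real.rpow_natCast, ← Real.rpow_mul hpos.le]
  norm_num

/-- The choice operator picks the value of some Darboux frame: one exists, and all of them give the
value computed from the lift G. -/
lemma arclengthDensity_eq {f : ℝ → Q4} {I : Set ℝ} (hI : IsOpen I) (h : IsImmersedCurve f I)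
    {G : ℝ → V6} (hG : ContDiffOn ℝ ∞ G I)
    (hGf : ∀ y ∈ I, G y ∈ posCone ∧ Represents (G y) (f y)) {x : ℝ} (hx : x ∈ I) :
    arclengthDensity f x = arclengthDensityPow G x ^ (1 / 4 : ℝ) := by
  obtain ⟨U, -, hU, hxU, e, he⟩ := exists_darbouxFrame hI hG hGf
    (fun y hy => h.lorentz_deriv_pos hI hG hGf hy) hx
  have hex : ∃ ρ, HasArclengthDensity f x ρ := ⟨_, U, hU, hxU, e, he, rfl⟩
  obtain ⟨U', hU', hxU', e', he', heq⟩ := Classical.epsilon_spec hex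
  exact heq.trans (he'.density_eq hU' hxU' hI hx hG hGf)

/-! ### Partial derivatives -/

section Partial

variable {E : Type*} [NormedAddCommGroup E] [NormedSpace ℝ E]

/-- The partial derivative with respect to the first variable. -/
def pdx (F : ℝ × ℝ → E) (p : ℝ × ℝ) : E := fderiv ℝ F p (1, 0)

/-- The partial derivative with respect to the second variable. -/
def pdt (F : ℝ × ℝ → E) (p : ℝ × ℝ) : E := fderiv ℝ F p (0, 1)

variable {F : ℝ × ℝ → E} {Ω : Set (ℝ × ℝ)}

lemma contDiffOn_pdx (hF : ContDiffOn ℝ ∞ F Ω) (hΩ : IsOpen Ω) : ContDiffOn ℝ ∞ (pdx F) Ω :=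
  (hF.fderiv_of_isOpen hΩ (m := ∞) (by simp)).clm_apply contDiffOn_const

lemma contDiffOn_pdt (hF : ContDiffOn ℝ ∞ F Ω) (hΩ : IsOpen Ω) : ContDiffOn ℝ ∞ (pdt F) Ω :=
  (hF.fderiv_of_isOpen hΩ (m := ∞) (by simp)).clm_apply contDiffOn_const

lemma hasDerivAt_pdx (hF : ContDiffOn ℝ ∞ F Ω) (hΩ : IsOpen Ω) {x t : ℝ} (h : (x, t) ∈ Ω) :
    HasDerivAt (fun y => F (y, t)) (pdx F (x, t)) x := by
  have h1 := ((hF.contDiffAt (hΩ.mem_nhds h)).differentiableAt (by simp)).hasFDerivAt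
  exact h1.comp_hasDerivAt x ((hasDerivAt_id x).prodMk (hasDerivAt_const x t))

lemma hasDerivAt_pdt (hF : ContDiffOn ℝ ∞ F Ω) (hΩ : IsOpen Ω) {x t : ℝ} (h : (x, t) ∈ Ω) :
    HasDerivAt (fun u => F (x, u)) (pdt F (x, t)) t := by
  have h1 := ((hF.contDiffAt (hΩ.mem_nhds h)).differentiableAt (by simp)).hasFDerivAt
  exact h1.comp_hasDerivAt t ((hasDerivAt_const t x).prodMk (hasDerivAt_id t))

lemma pdt_pdx (hF : ContDiffOn ℝ ∞ F Ω) (hΩ : IsOpen Ω) {p : ℝ × ℝ} (h : p ∈ Ω) :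
    pdt (pdx F) p = pdx (pdt F) p := by
  have hF' := hF.contDiffAt (hΩ.mem_nhds h)
  have hd : DifferentiableAt ℝ (fderiv ℝ F) p :=
    (((hF.fderiv_of_isOpen hΩ (m := ∞) (by simp)).contDiffAt (hΩ.mem_nhds h))).differentiableAt
      (by simp)
  have hs : IsSymmSndFDerivAt ℝ F p := hF'.isSymmSndFDerivAt (by
    rw [minSmoothness_of_isRCLikeNormedField]; exact ENat.LEInfty.out)
  have h1 : ∀ v w : ℝ × ℝ, fderiv ℝ (fun q => fderiv ℝ F q v) p w =
      fderiv ℝ (fderiv ℝ F) p w v := by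
    intro v w
    rw [fderiv_clm_apply hd (differentiableAt_const v)]
    simp
  change fderiv ℝ (fun q => fderiv ℝ F q (1, 0)) p (0, 1) =
    fderiv ℝ (fun q => fderiv ℝ F q (0, 1)) p (1, 0)
  rw [h1, h1]
  exact hs _ _

lemma eventually_slice_mem (hΩ : IsOpen Ω) {x t : ℝ} (h : (x, t) ∈ Ω) :
    ∀ᶠ y in 𝓝 x, (y, t) ∈ Ω :=
  (Continuous.prodMk_left t).continuousAt.preimage_mem_nhds (hΩ.mem_nhds h)

end Partial

/-- Differentiation under the integral sign. -/
lemma hasDerivAt_integral_of_contDiffOn {ρ : ℝ × ℝ → ℝ} {Ω : Set (ℝ × ℝ)} (hΩ : IsOpen Ω)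
    (hρ : ContDiffOn ℝ ∞ ρ Ω) {a b : ℝ} (hab : a ≤ b) (h : ∀ x ∈ Icc a b, (x, (0 : ℝ)) ∈ Ω) :
    HasDerivAt (fun t => ∫ x in a..b, ρ (x, t)) (∫ x in a..b, pdt ρ (x, 0)) 0 := by
  -- The tube lemma provides a compact rectangle around [a, b] × {0} inside Ω; the maximum of the
  -- t-derivative on it is the dominating constant.
  obtain ⟨u, v, hu, hv, hau, h0v, huv⟩ := generalized_tube_lemma (isCompact_Icc (a := a) (b := b))
    (isCompact_singleton (x := (0 : ℝ))) hΩ (by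
      rintro ⟨x, t⟩ ⟨hx, ht⟩
      obtain rfl : t = 0 := ht
      exact h x hx)
  obtain ⟨δ, hδ, hball⟩ := Metric.isOpen_iff.1 hv 0 (h0v rfl)
  have hsub : Icc a b ×ˢ Icc (-(δ / 2)) (δ / 2) ⊆ Ω := by
    rintro ⟨x, t⟩ ⟨hx, ht⟩
    refine huv ⟨hau hx, hball ?_⟩
    rw [Metric.mem_ball, Real.dist_eq, sub_zero, abs_lt]
    exact ⟨by linarith [ht.1], by linarith [ht.2]⟩
  have hK : IsCompact (Icc a b ×ˢ Icc (-(δ / 2)) (δ / 2)) := isCompact_Icc.prod isCompact_Icc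
  have hpc : ContinuousOn (pdt ρ) Ω := (contDiffOn_pdt hρ hΩ).continuousOn
  obtain ⟨C, hC⟩ := hK.exists_bound_of_continuousOn (hpc.mono hsub)
  have hcont : ∀ {g : ℝ × ℝ → ℝ}, ContinuousOn g Ω → ∀ t ∈ Icc (-(δ / 2)) (δ / 2),
      ContinuousOn (fun x => g (x, t)) (Icc a b) := by
    intro g hg t ht
    exact hg.comp (Continuous.prodMk_left t).continuousOn fun x hx => hsub ⟨hx, ht⟩
  have h0 : (0 : ℝ) ∈ Icc (-(δ / 2)) (δ / 2) := ⟨by linarith, by linarith⟩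
  have hs : Icc (-(δ / 2)) (δ / 2) ∈ 𝓝 (0 : ℝ) := Icc_mem_nhds (by linarith) (by linarith)
  have huI : uIcc a b = Icc a b := uIcc_of_le hab
  refine (intervalIntegral.hasDerivAt_integral_of_dominated_loc_of_deriv_le
    (F := fun t x => ρ (x, t)) (F' := fun t x => pdt ρ (x, t)) (bound := fun _ => C) hs ?_ ?_ ?_ ?_
    ?_ ?_).2
  · filter_upwards [hs] with t ht
    refine (IntervalIntegrable.def' (ContinuousOn.intervalIntegrable ?_)).aestronglyMeasurable
    rw [huI]
    exact hcont hρ.continuousOn t ht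
  · refine ContinuousOn.intervalIntegrable ?_
    rw [huI]
    exact hcont hρ.continuousOn 0 h0
  · refine (IntervalIntegrable.def' (ContinuousOn.intervalIntegrable ?_)).aestronglyMeasurable
    rw [huI]
    exact hcont hpc 0 h0
  · refine Eventually.of_forall fun x hx t ht => ?_
    rw [uIoc_of_le hab] at hx
    exact hC (x, t) ⟨Ioc_subset_Icc_self hx, ht⟩
  · exact intervalIntegrable_const
  · refine Eventually.of_forall fun x hx t ht => ?_
    rw [uIoc_of_le hab] at hx
    exact hasDerivAt_pdt hρ hΩ (hsub ⟨Ioc_subset_Icc_self hx, ht⟩)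

/-! ### The Frenet system -/

/-- The Maurer-Cartan form of a Frenet frame in the arclength parameter. -/
def frenetMatrix (m₁ m₂ m₃ : ℝ) : M6 :=
  !![0, m₁, 1, 0, 0, 0;
     1, 0, 0, 0, 0, m₁;
     0, 0, 0, -m₂, 0, 1;
     0, 0, m₂, 0, -m₃, 0;
     0, 0, 0, m₃, 0, 0;
     0, 1, 0, 0, 0, 0]

/-- Solutions of the Frenet system with smooth curvatures. -/
structure IsFrenetSystem (e : ℝ → M6) (I : Set ℝ) (μ₁ μ₂ μ₃ : ℝ → ℝ) : Prop where
  frame : IsLorentzFrame e I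
  mc : ∀ s ∈ I, mcForm e s = frenetMatrix (μ₁ s) (μ₂ s) (μ₃ s)
  smooth₁ : ContDiffOn ℝ ∞ μ₁ I
  smooth₂ : ContDiffOn ℝ ∞ μ₂ I
  smooth₃ : ContDiffOn ℝ ∞ μ₃ I

section FrenetSystem

variable {e : ℝ → M6} {I : Set ℝ} {μ₁ μ₂ μ₃ : ℝ → ℝ}

lemma IsFrenetSystem.hasDerivAt_cols (h : IsFrenetSystem e I μ₁ μ₂ μ₃) (hI : IsOpen I) {s : ℝ}
    (hs : s ∈ I) :
    HasDerivAt (frameCol e 0) (frameCol e 1 s) s ∧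
    HasDerivAt (frameCol e 1) (μ₁ s • frameCol e 0 s + frameCol e 5 s) s ∧
    HasDerivAt (frameCol e 2) (frameCol e 0 s + μ₂ s • frameCol e 3 s) s ∧
    HasDerivAt (frameCol e 3) (-μ₂ s • frameCol e 2 s + μ₃ s • frameCol e 4 s) s ∧
    HasDerivAt (frameCol e 4) (-μ₃ s • frameCol e 3 s) s ∧
    HasDerivAt (frameCol e 5) (μ₁ s • frameCol e 1 s + frameCol e 2 s) s := by
  have hd := fun j => h.frame.hasDerivAt_col hI hs j
  simp only [h.mc s hs] at hd
  refine ⟨(hd 0).congr_deriv ?_, (hd 1).congr_deriv ?_, (hd 2).congr_deriv ?_,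
    (hd 3).congr_deriv ?_, (hd 4).congr_deriv ?_, (hd 5).congr_deriv ?_⟩ <;>
  · ext i
    simp [Matrix.mulVec, dotProduct, Fin.sum_univ_six, frenetMatrix, frameCol]
    try ring

/-- The Euler-Lagrange expression of the conformal arclength, paired with a vector. -/
def eulerLagrange (e : ℝ → M6) (μ₁ μ₂ μ₃ : ℝ → ℝ) (s : ℝ) (w : V6) : ℝ :=
  (deriv μ₁ s + 3 * μ₂ s * deriv μ₂ s) * lorentz w (frameCol e 2 s) +
  (-deriv (deriv μ₂) s + μ₂ s ^ 3 + μ₂ s * μ₃ s ^ 2 + 2 * μ₁ s * μ₂ s) *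
    lorentz w (frameCol e 3 s) -
  (2 * deriv μ₂ s * μ₃ s + μ₂ s * deriv μ₃ s) * lorentz w (frameCol e 4 s)

/-- The first variation of the density of the conformal arclength, multiplied by two. -/
def densityVariation (e : ℝ → M6) (μ₁ : ℝ → ℝ) (W : ℝ → V6) (s : ℝ) : ℝ :=
  lorentz (deriv (deriv (deriv W)) s) (frameCol e 2 s) -
    lorentz (deriv (deriv W) s) (frameCol e 0 s) - 3 * lorentz (deriv W s) (frameCol e 1 s) -
    2 * μ₁ s * lorentz (deriv W s) (frameCol e 2 s) - lorentz (W s) (frameCol e 5 s) -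
    deriv μ₁ s * lorentz (W s) (frameCol e 2 s)

/-- The boundary term of the first variation. -/
def boundaryTerm (e : ℝ → M6) (μ₁ μ₂ μ₃ : ℝ → ℝ) (W : ℝ → V6) (s : ℝ) : ℝ :=
  lorentz (deriv (deriv W) s) (frameCol e 2 s) -
    lorentz (deriv W s) (frameCol e 0 s + μ₂ s • frameCol e 3 s) +
    lorentz (W s) (frameCol e 1 s + deriv μ₂ s • frameCol e 3 s +
      μ₂ s • (-μ₂ s • frameCol e 2 s + μ₃ s • frameCol e 4 s)) -
    lorentz (deriv W s) (frameCol e 0 s) + lorentz (W s) (frameCol e 1 s) -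
    3 * lorentz (W s) (frameCol e 1 s) - 2 * μ₁ s * lorentz (W s) (frameCol e 2 s)

/-- Integration by parts in pointwise form: the Frenet equations move all derivatives from W to the
frame. The multiples of ⟨W, e₀⟩ that appear vanish, since variations through null vectors are
orthogonal to e₀. -/
lemma IsFrenetSystem.hasDerivAt_boundaryTerm (h : IsFrenetSystem e I μ₁ μ₂ μ₃) (hI : IsOpen I)
    {W : ℝ → V6} (hW : ContDiffOn ℝ ∞ W I) (hW0 : ∀ s ∈ I, lorentz (W s) (frameCol e 0 s) = 0)
    {s : ℝ} (hs : s ∈ I) :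
    HasDerivAt (boundaryTerm e μ₁ μ₂ μ₃ W)
      (densityVariation e μ₁ W s - eulerLagrange e μ₁ μ₂ μ₃ s (W s)) s := by
  obtain ⟨d0, d1, d2, d3, d4, d5⟩ := h.hasDerivAt_cols hI hs
  have w0 := hasDerivAt_of_contDiffOn hW hI hs
  have w1 := hasDerivAt_of_contDiffOn (contDiffOn_deriv hW hI) hI hs
  have w2 := hasDerivAt_of_contDiffOn (contDiffOn_deriv (contDiffOn_deriv hW hI) hI) hI hs
  have m1 := hasDerivAt_of_contDiffOn h.smooth₁ hI hs
  have m2 := hasDerivAt_of_contDiffOn h.smooth₂ hI hs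
  have m2' := hasDerivAt_of_contDiffOn (contDiffOn_deriv h.smooth₂ hI) hI hs
  have m3 := hasDerivAt_of_contDiffOn h.smooth₃ hI hs
  have hd := ((((((HasDerivAt.lorentz w2 d2).fun_sub
    (HasDerivAt.lorentz w1 (d0.fun_add (m2.fun_smul d3)))).fun_add
    (HasDerivAt.lorentz w0 ((d1.fun_add (m2'.fun_smul d3)).fun_add
      (m2.fun_smul ((m2.fun_neg.fun_smul d2).fun_add (m3.fun_smul d4)))))).fun_sub
    (HasDerivAt.lorentz w1 d0)).fun_add (HasDerivAt.lorentz w0 d1)).fun_sub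
    ((HasDerivAt.lorentz w0 d1).const_mul 3)).fun_sub
    ((m1.const_mul 2).fun_mul (HasDerivAt.lorentz w0 d2))
  refine hd.congr_deriv ?_
  have h0 := hW0 s hs
  simp only [densityVariation, eulerLagrange, lorentz_add_right, lorentz_smul_right, h0]
  ring

/-- Where the curve is kept fixed its lift may still be rescaled, so the variation field is only a
multiple of e₀ there. The boundary term does not see such fields. -/
lemma boundaryTerm_eq_zero (h : IsFrenetSystem e I μ₁ μ₂ μ₃) (hI : IsOpen I) {W : ℝ → V6}
    {V : Set ℝ} (hV : IsOpen V) (hVI : V ⊆ I) (hW : ContDiffOn ℝ ∞ W I)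
    (hWV : ∀ s ∈ V, ∃ c : ℝ, W s = c • frameCol e 0 s) {s : ℝ} (hs : s ∈ V) :
    boundaryTerm e μ₁ μ₂ μ₃ W s = 0 := by
  have hL := fun (i j : Fin 6) (y : ℝ) (hy : y ∈ V) => h.frame.lorentz_col i j (hVI hy)
  set c : ℝ → ℝ := fun y => -lorentz (W y) (frameCol e 5 y) with hc
  have hWc : ∀ y ∈ V, W y = c y • frameCol e 0 y := by
    intro y hy
    obtain ⟨k, hk⟩ := hWV y hy
    simp only [hc]
    rw [hk, lorentz_smul_left, hL 0 5 y hy]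
    simp [lorentzS]
  have hcs : ContDiffOn ℝ ∞ c V :=
    (ContDiffOn.lorentz (hW.mono hVI) ((h.frame.contDiffOn_col 5).mono hVI)).neg
  have h1 : ∀ y ∈ V, deriv W y = c y • frameCol e 1 y + deriv c y • frameCol e 0 y := by
    intro y hy
    have : W =ᶠ[𝓝 y] fun y => c y • frameCol e 0 y := by
      filter_upwards [hV.mem_nhds hy] with z hz using hWc z hz
    rw [this.deriv_eq]
    exact ((hasDerivAt_of_contDiffOn hcs hV hy).fun_smul (h.hasDerivAt_cols hI (hVI hy)).1).deriv
  have h2 : deriv (deriv W) s = c s • (μ₁ s • frameCol e 0 s + frameCol e 5 s) +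
      deriv c s • frameCol e 1 s + (deriv c s • frameCol e 1 s +
      deriv (deriv c) s • frameCol e 0 s) := by
    have : deriv W =ᶠ[𝓝 s] fun y => c y • frameCol e 1 y + deriv c y • frameCol e 0 y := by
      filter_upwards [hV.mem_nhds hs] with z hz using h1 z hz
    rw [this.deriv_eq]
    obtain ⟨d0, d1, -⟩ := h.hasDerivAt_cols hI (hVI hs)
    exact (((hasDerivAt_of_contDiffOn hcs hV hs).fun_smul d1).fun_add
      ((hasDerivAt_of_contDiffOn (contDiffOn_deriv hcs hV) hV hs).fun_smul d0)).deriv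
  simp only [boundaryTerm, h2, h1 s hs, hWc s hs, lorentz_add_left, lorentz_add_right,
    lorentz_smul_left, lorentz_smul_right, hL _ _ s hs]
  simp [lorentzS]

lemma boundaryTerm_continuousOn (h : IsFrenetSystem e I μ₁ μ₂ μ₃) (hI : IsOpen I) {W : ℝ → V6}
    (hW : ContDiffOn ℝ ∞ W I) (hW0 : ∀ s ∈ I, lorentz (W s) (frameCol e 0 s) = 0) :
    ContinuousOn (boundaryTerm e μ₁ μ₂ μ₃ W) I := fun _ hs =>
  (h.hasDerivAt_boundaryTerm hI hW hW0 hs).continuousAt.continuousWithinAt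

/-- The boundary term vanishes at the end points of the support of a variation. -/
lemma boundaryTerm_eq_zero_of_support (h : IsFrenetSystem e I μ₁ μ₂ μ₃) (hI : IsOpen I)
    {W : ℝ → V6} (hW : ContDiffOn ℝ ∞ W I)
    (hW0 : ∀ s ∈ I, lorentz (W s) (frameCol e 0 s) = 0) {a b : ℝ} (hab : a ≤ b)
    (habI : Icc a b ⊆ I)
    (hWs : ∀ s ∈ I \ Icc a b, ∃ c : ℝ, W s = c • frameCol e 0 s) :
    boundaryTerm e μ₁ μ₂ μ₃ W a = 0 ∧ boundaryTerm e μ₁ μ₂ μ₃ W b = 0 := by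
  have hV : IsOpen (I \ Icc a b) := hI.sdiff isClosed_Icc
  have hz : ∀ s ∈ I \ Icc a b, boundaryTerm e μ₁ μ₂ μ₃ W s = 0 := fun s hs =>
    boundaryTerm_eq_zero h hI hV sdiff_subset hW hWs hs
  have hc := boundaryTerm_continuousOn h hI hW hW0
  -- By continuity the vanishing extends to limits of points outside [a, b]; both end points are
  -- such limits because I is open.
  have key : ∀ x ∈ I, (∃ᶠ s in 𝓝 x, s ∈ I \ Icc a b) → boundaryTerm e μ₁ μ₂ μ₃ W x = 0 := by
    intro x hx hf
    by_contra hne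
    have h1 := (hc.continuousAt (hI.mem_nhds hx)).eventually_ne hne
    obtain ⟨s, hs1, hs2⟩ := (hf.and_eventually h1).exists
    exact hs2 (hz s hs1)
  have ha := habI (left_mem_Icc.2 hab)
  have hb := habI (right_mem_Icc.2 hab)
  refine ⟨key a ha ?_, key b hb ?_⟩
  · have h1 : ∃ᶠ s in 𝓝 a, s < a := (frequently_lt_nhds a)
    refine (h1.and_eventually (hI.mem_nhds ha)).mono ?_
    rintro s ⟨hs, hsI⟩
    exact ⟨hsI, fun h => absurd h.1 (not_le.2 hs)⟩
  · have h1 : ∃ᶠ s in 𝓝 b, b < s := (frequently_gt_nhds b)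
    refine (h1.and_eventually (hI.mem_nhds hb)).mono ?_
    rintro s ⟨hs, hsI⟩
    exact ⟨hsI, fun h => absurd h.2 (not_le.2 hs)⟩

lemma IsFrenetSystem.contDiffOn_eulerLagrange (h : IsFrenetSystem e I μ₁ μ₂ μ₃) (hI : IsOpen I)
    {W : ℝ → V6} (hW : ContDiffOn ℝ ∞ W I) :
    ContDiffOn ℝ ∞ (fun s => eulerLagrange e μ₁ μ₂ μ₃ s (W s)) I := by
  have hl := fun j => ContDiffOn.lorentz hW (h.frame.contDiffOn_col j)
  have m1 := h.smooth₁
  have m2 := h.smooth₂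
  have m3 := h.smooth₃
  have m1' := contDiffOn_deriv m1 hI
  have m2' := contDiffOn_deriv m2 hI
  have m3' := contDiffOn_deriv m3 hI
  have m2'' := contDiffOn_deriv m2' hI
  exact (((m1'.add ((contDiffOn_const.mul m2).mul m2')).mul (hl 2)).add
    ((((m2''.neg.add (m2.pow 3)).add (m2.mul (m3.pow 2))).add
      ((contDiffOn_const.mul m1).mul m2)).mul (hl 3))).sub
    ((((contDiffOn_const.mul m2').mul m3).add (m2.mul m3')).mul (hl 4))

lemma IsFrenetSystem.contDiffOn_densityVariation (h : IsFrenetSystem e I μ₁ μ₂ μ₃)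
    (hI : IsOpen I) {W : ℝ → V6} (hW : ContDiffOn ℝ ∞ W I) :
    ContDiffOn ℝ ∞ (densityVariation e μ₁ W) I := by
  have hc := fun j => h.frame.contDiffOn_col j
  have w1 := contDiffOn_deriv hW hI
  have w2 := contDiffOn_deriv w1 hI
  have w3 := contDiffOn_deriv w2 hI
  have m1 := h.smooth₁
  have m1' := contDiffOn_deriv m1 hI
  exact (((((ContDiffOn.lorentz w3 (hc 2)).sub (ContDiffOn.lorentz w2 (hc 0))).sub
    (contDiffOn_const.mul (ContDiffOn.lorentz w1 (hc 1)))).sub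
    ((contDiffOn_const.mul m1).mul (ContDiffOn.lorentz w1 (hc 2)))).sub
    (ContDiffOn.lorentz hW (hc 5))).sub (m1'.mul (ContDiffOn.lorentz hW (hc 2)))

lemma IsFrenetSystem.integral_densityVariation (h : IsFrenetSystem e I μ₁ μ₂ μ₃) (hI : IsOpen I)
    {W : ℝ → V6} (hW : ContDiffOn ℝ ∞ W I)
    (hW0 : ∀ s ∈ I, lorentz (W s) (frameCol e 0 s) = 0) {a b : ℝ} (hab : a ≤ b)
    (habI : Icc a b ⊆ I)
    (hWs : ∀ s ∈ I \ Icc a b, ∃ c : ℝ, W s = c • frameCol e 0 s) :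
    ∫ s in a..b, densityVariation e μ₁ W s = ∫ s in a..b, eulerLagrange e μ₁ μ₂ μ₃ s (W s) := by
  have huI : uIcc a b = Icc a b := uIcc_of_le hab
  have i1 : IntervalIntegrable (densityVariation e μ₁ W) MeasureTheory.volume a b := by
    refine ContinuousOn.intervalIntegrable ?_
    rw [huI]
    exact (h.contDiffOn_densityVariation hI hW).continuousOn.mono habI
  have i2 : IntervalIntegrable (fun s => eulerLagrange e μ₁ μ₂ μ₃ s (W s))
      MeasureTheory.volume a b := by
    refine ContinuousOn.intervalIntegrable ?_
    rw [huI]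
    exact (h.contDiffOn_eulerLagrange hI hW).continuousOn.mono habI
  obtain ⟨hBa, hBb⟩ := boundaryTerm_eq_zero_of_support h hI hW hW0 hab habI hWs
  have hft := intervalIntegral.integral_eq_sub_of_hasDerivAt
    (f := boundaryTerm e μ₁ μ₂ μ₃ W) (a := a) (b := b)
    (fun s hs => h.hasDerivAt_boundaryTerm hI hW hW0 (habI (huI ▸ hs))) (i1.sub i2)
  rw [hBa, hBb, intervalIntegral.integral_sub i1 i2] at hft
  linarith

end FrenetSystem

/-! ### The first variation of the conformal arclength -/

lemma pdx_congr {E : Type*} [NormedAddCommGroup E] [NormedSpace ℝ E] {F G : ℝ × ℝ → E}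
    {Ω : Set (ℝ × ℝ)} (hΩ : IsOpen Ω) (h : EqOn F G Ω) {p : ℝ × ℝ} (hp : p ∈ Ω) :
    pdx F p = pdx G p := by
  have : F =ᶠ[𝓝 p] G := by filter_upwards [hΩ.mem_nhds hp] with q hq using h hq
  rw [pdx, pdx, this.fderiv_eq]

lemma deriv_slice {E : Type*} [NormedAddCommGroup E] [NormedSpace ℝ E] {F : ℝ × ℝ → E}
    {Ω : Set (ℝ × ℝ)} (hF : ContDiffOn ℝ ∞ F Ω) (hΩ : IsOpen Ω) {g : ℝ → E} {t : ℝ}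
    (hg : ∀ y, (y, t) ∈ Ω → g y = F (y, t)) {x : ℝ} (h : (x, t) ∈ Ω) :
    deriv g x = pdx F (x, t) := by
  have : g =ᶠ[𝓝 x] fun y => F (y, t) := by
    filter_upwards [eventually_slice_mem hΩ h] with y hy using hg y hy
  rw [this.deriv_eq]
  exact (hasDerivAt_pdx hF hΩ h).deriv

/-- The fourth power of the density of the conformal arclength of a family of lifts. -/
def familyDensityPow (F : ℝ × ℝ → V6) (p : ℝ × ℝ) : ℝ :=
  arclengthJet (F p) (pdx F p) (pdx (pdx F) p) (pdx (pdx (pdx F)) p)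

lemma arclengthDensityPow_slice {F : ℝ × ℝ → V6} {Ω : Set (ℝ × ℝ)} (hF : ContDiffOn ℝ ∞ F Ω)
    (hΩ : IsOpen Ω) {x t : ℝ} (h : (x, t) ∈ Ω) :
    arclengthDensityPow (fun y => F (y, t)) x = familyDensityPow F (x, t) := by
  have hF1 := contDiffOn_pdx hF hΩ
  have hF2 := contDiffOn_pdx hF1 hΩ
  have h1 : ∀ y, (y, t) ∈ Ω → deriv (fun y => F (y, t)) y = pdx F (y, t) := fun y hy =>
    deriv_slice hF hΩ (fun _ _ => rfl) hy
  have h2 : ∀ y, (y, t) ∈ Ω → deriv (deriv fun y => F (y, t)) y = pdx (pdx F) (y, t) :=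
    fun y hy => deriv_slice hF1 hΩ h1 hy
  have h3 := deriv_slice hF2 hΩ h2 h
  rw [arclengthDensityPow, familyDensityPow, h1 x h, h2 x h, h3]

lemma contDiffOn_arclengthJet {E : Type*} [NormedAddCommGroup E] [NormedSpace ℝ E]
    {v₀ v₁ v₂ v₃ : E → V6} {U : Set E} (h0 : ContDiffOn ℝ ∞ v₀ U) (h1 : ContDiffOn ℝ ∞ v₁ U)
    (h2 : ContDiffOn ℝ ∞ v₂ U) (h3 : ContDiffOn ℝ ∞ v₃ U)
    (hne : ∀ y ∈ U, lorentz (v₁ y) (v₁ y) ≠ 0) :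
    ContDiffOn ℝ ∞ (fun y => arclengthJet (v₀ y) (v₁ y) (v₂ y) (v₃ y)) U := by
  have p := ContDiffOn.lorentz h0 h2
  have m := ContDiffOn.lorentz h0 h3
  have g := ContDiffOn.lorentz h1 h1
  have a := ContDiffOn.lorentz h1 h2
  have b := ContDiffOn.lorentz h1 h3
  have h := ContDiffOn.lorentz h2 h2
  have c := ContDiffOn.lorentz h2 h3
  have k := ContDiffOn.lorentz h3 h3
  exact ((((p.pow 2).mul ((g.mul k).sub (b.pow 2))).add
    ((m.pow 2).mul ((g.mul h).sub (a.pow 2)))).sub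
    (((contDiffOn_const.mul p).mul m).mul ((g.mul c).sub (a.mul b)))).div (g.pow 4)
    fun y hy => pow_ne_zero 4 (hne y hy)

/-- The hypotheses are the products of the jet (e₀, e₁, μ₁e₀ + e₅, μ₁'e₀ + 2μ₁e₁ + e₂) of the
normalized lift, with M = μ₁ and M' = μ₁'. The norm of v₂ is not needed, as it is multiplied by
squares of ⟨v₀, v₃⟩ = 0. -/
lemma hasDerivAt_arclengthJet {v₀ v₁ v₂ v₃ : ℝ → V6} {w₀ w₁ w₂ w₃ : V6} {t M M' : ℝ}
    (h0 : HasDerivAt v₀ w₀ t) (h1 : HasDerivAt v₁ w₁ t) (h2 : HasDerivAt v₂ w₂ t)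
    (h3 : HasDerivAt v₃ w₃ t) (hp : lorentz (v₀ t) (v₂ t) = -1) (hm : lorentz (v₀ t) (v₃ t) = 0)
    (hg : lorentz (v₁ t) (v₁ t) = 1) (ha : lorentz (v₁ t) (v₂ t) = 0)
    (hb : lorentz (v₁ t) (v₃ t) = 2 * M) (hc : lorentz (v₂ t) (v₃ t) = -M')
    (hk : lorentz (v₃ t) (v₃ t) = 4 * M ^ 2 + 1) :
    HasDerivAt (fun u => arclengthJet (v₀ u) (v₁ u) (v₂ u) (v₃ u))
      (-2 * (lorentz w₀ (v₂ t) + lorentz (v₀ t) w₂) + (4 * M ^ 2 - 3) * (2 * lorentz (v₁ t) w₁) +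
        2 * lorentz (v₃ t) w₃ - 4 * M * (lorentz w₁ (v₃ t) + lorentz (v₁ t) w₃) -
        2 * M' * (lorentz w₀ (v₃ t) + lorentz (v₀ t) w₃)) t := by
  have p := HasDerivAt.lorentz h0 h2
  have m := HasDerivAt.lorentz h0 h3
  have g := HasDerivAt.lorentz h1 h1
  have a := HasDerivAt.lorentz h1 h2
  have b := HasDerivAt.lorentz h1 h3
  have h := HasDerivAt.lorentz h2 h2
  have c := HasDerivAt.lorentz h2 h3
  have k := HasDerivAt.lorentz h3 h3
  have hd := ((((p.fun_pow 2).fun_mul ((g.fun_mul k).fun_sub (b.fun_pow 2))).fun_add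
    ((m.fun_pow 2).fun_mul ((g.fun_mul h).fun_sub (a.fun_pow 2)))).fun_sub
    (((p.const_mul 2).fun_mul m).fun_mul ((g.fun_mul c).fun_sub (a.fun_mul b)))).fun_div
    (g.fun_pow 4) (by rw [hg]; norm_num)
  refine hd.congr_deriv ?_
  rw [hp, hm, hg, ha, hb, hc, hk, lorentz_comm w₁ (v₁ t), lorentz_comm w₃ (v₃ t)]
  push_cast
  ring

section FirstVariation

variable {e : ℝ → M6} {I : Set ℝ} {μ₁ μ₂ μ₃ : ℝ → ℝ} {F : ℝ × ℝ → V6} {Ω : Set (ℝ × ℝ)}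

/-- Families of lifts that start with the normalized lift of a solution of the Frenet system. -/
structure IsFrenetVariation (e : ℝ → M6) (I : Set ℝ) (F : ℝ × ℝ → V6) (Ω : Set (ℝ × ℝ)) :
    Prop where
  isOpen : IsOpen Ω
  mem : ∀ s ∈ I, (s, (0 : ℝ)) ∈ Ω
  smooth : ContDiffOn ℝ ∞ F Ω
  null : ∀ p ∈ Ω, lorentz (F p) (F p) = 0
  initial : ∀ s ∈ I, F (s, 0) = frameCol e 0 s

/-- The variation vector field. -/
def variationField (F : ℝ × ℝ → V6) (s : ℝ) : V6 := pdt F (s, 0)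

lemma IsFrenetVariation.contDiffOn_field (hF : IsFrenetVariation e I F Ω) :
    ContDiffOn ℝ ∞ (variationField F) I :=
  (contDiffOn_pdt hF.smooth hF.isOpen).comp (by fun_prop) fun s hs => hF.mem s hs

lemma IsFrenetVariation.lorentz_field (hF : IsFrenetVariation e I F Ω) {s : ℝ} (hs : s ∈ I) :
    lorentz (variationField F s) (frameCol e 0 s) = 0 := by
  have hd := hasDerivAt_pdt hF.smooth hF.isOpen (hF.mem s hs)
  have h1 : HasDerivAt (fun t => lorentz (F (s, t)) (F (s, t))) 0 0 := by
    refine (hasDerivAt_const (0 : ℝ) (0 : ℝ)).congr_of_eventuallyEq ?_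
    have : ∀ᶠ t in 𝓝 (0 : ℝ), (s, t) ∈ Ω :=
      (Continuous.prodMk_right s).continuousAt.preimage_mem_nhds
        (hF.isOpen.mem_nhds (hF.mem s hs))
    filter_upwards [this] with t ht using hF.null _ ht
  have h2 := (HasDerivAt.lorentz hd hd).unique h1
  rw [lorentz_comm (F (s, 0)), hF.initial s hs] at h2
  rw [variationField]
  linarith

lemma IsFrenetVariation.lorentz_deriv_field (hF : IsFrenetVariation e I F Ω)
    (h : IsFrenetSystem e I μ₁ μ₂ μ₃) (hI : IsOpen I) {s : ℝ} (hs : s ∈ I) :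
    lorentz (deriv (variationField F) s) (frameCol e 0 s) =
      -lorentz (variationField F s) (frameCol e 1 s) := by
  have h1 : HasDerivAt (fun y => lorentz (variationField F y) (frameCol e 0 y)) 0 s := by
    refine (hasDerivAt_const s (0 : ℝ)).congr_of_eventuallyEq ?_
    filter_upwards [hI.mem_nhds hs] with y hy using hF.lorentz_field hy
  have h2 := (HasDerivAt.lorentz (hasDerivAt_of_contDiffOn hF.contDiffOn_field hI hs)
    (h.hasDerivAt_cols hI hs).1).unique h1
  linarith

lemma IsFrenetVariation.jet_initial (hF : IsFrenetVariation e I F Ω)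
    (h : IsFrenetSystem e I μ₁ μ₂ μ₃) (hI : IsOpen I) :
    (∀ s ∈ I, pdx F (s, 0) = frameCol e 1 s) ∧
    (∀ s ∈ I, pdx (pdx F) (s, 0) = μ₁ s • frameCol e 0 s + frameCol e 5 s) ∧
    ∀ s ∈ I, pdx (pdx (pdx F)) (s, 0) = deriv μ₁ s • frameCol e 0 s +
      (2 * μ₁ s) • frameCol e 1 s + frameCol e 2 s := by
  have hΩ := hF.isOpen
  have hF0 := hF.smooth
  have hF1 := contDiffOn_pdx hF0 hΩ
  have hF2 := contDiffOn_pdx hF1 hΩ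
  have key : ∀ {G : ℝ × ℝ → V6} {g : ℝ → V6} {g' : V6} {s : ℝ}, ContDiffOn ℝ ∞ G Ω → s ∈ I →
      (∀ y ∈ I, G (y, 0) = g y) → HasDerivAt g g' s → pdx G (s, 0) = g' := by
    intro G g g' s hG hs hg hg'
    refine (hasDerivAt_pdx hG hΩ (hF.mem s hs)).unique (hg'.congr_of_eventuallyEq ?_)
    filter_upwards [hI.mem_nhds hs] with y hy using hg y hy
  have j1 : ∀ s ∈ I, pdx F (s, 0) = frameCol e 1 s := fun s hs =>
    key hF0 hs hF.initial (h.hasDerivAt_cols hI hs).1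
  have j2 : ∀ s ∈ I, pdx (pdx F) (s, 0) = μ₁ s • frameCol e 0 s + frameCol e 5 s := fun s hs =>
    key hF1 hs j1 (h.hasDerivAt_cols hI hs).2.1
  refine ⟨j1, j2, fun s hs => ?_⟩
  obtain ⟨d0, -, -, -, -, d5⟩ := h.hasDerivAt_cols hI hs
  rw [key hF2 hs j2 (((hasDerivAt_of_contDiffOn h.smooth₁ hI hs).fun_smul d0).fun_add d5)]
  module

lemma IsFrenetVariation.familyDensityPow_initial (hF : IsFrenetVariation e I F Ω)
    (h : IsFrenetSystem e I μ₁ μ₂ μ₃) (hI : IsOpen I) {s : ℝ} (hs : s ∈ I) :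
    familyDensityPow F (s, 0) = 1 := by
  obtain ⟨j1, j2, j3⟩ := hF.jet_initial h hI
  have hL := fun (i j : Fin 6) => h.frame.lorentz_col i j hs
  rw [familyDensityPow, hF.initial s hs, j1 s hs, j2 s hs, j3 s hs]
  simp only [arclengthJet, lorentz_add_left, lorentz_add_right, lorentz_smul_left,
    lorentz_smul_right, hL]
  simp [lorentzS]
  ring

/-- Mixed partial derivatives commute, so the t-derivative of the jet of the lifts is the jet of the
variation field. -/
lemma IsFrenetVariation.hasDerivAt_familyDensityPow (hF : IsFrenetVariation e I F Ω)
    (h : IsFrenetSystem e I μ₁ μ₂ μ₃) (hI : IsOpen I) {s : ℝ} (hs : s ∈ I) :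
    HasDerivAt (fun t => familyDensityPow F (s, t))
      (2 * densityVariation e μ₁ (variationField F) s) 0 := by
  have hΩ := hF.isOpen
  have hF0 := hF.smooth
  have hF1 := contDiffOn_pdx hF0 hΩ
  have hF2 := contDiffOn_pdx hF1 hΩ
  have hF3 := contDiffOn_pdx hF2 hΩ
  have hT := contDiffOn_pdt hF0 hΩ
  have hT1 := contDiffOn_pdx hT hΩ
  have hT2 := contDiffOn_pdx hT1 hΩ
  have s1 : EqOn (pdt (pdx F)) (pdx (pdt F)) Ω := fun p hp => pdt_pdx hF0 hΩ hp
  have s2 : EqOn (pdt (pdx (pdx F))) (pdx (pdx (pdt F))) Ω := fun p hp => by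
    rw [pdt_pdx hF1 hΩ hp, pdx_congr hΩ s1 hp]
  have s3 : EqOn (pdt (pdx (pdx (pdx F)))) (pdx (pdx (pdx (pdt F)))) Ω := fun p hp => by
    rw [pdt_pdx hF2 hΩ hp, pdx_congr hΩ s2 hp]
  have w1 : ∀ y ∈ I, pdx (pdt F) (y, 0) = deriv (variationField F) y := fun y hy =>
    (deriv_slice hT hΩ (fun _ _ => rfl) (hF.mem y hy)).symm
  have key : ∀ {G : ℝ × ℝ → V6} {g : ℝ → V6} {y : ℝ}, ContDiffOn ℝ ∞ G Ω → y ∈ I →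
      (∀ y ∈ I, G (y, 0) = g y) → pdx G (y, 0) = deriv g y := by
    intro G g y hG hy hg
    have : g =ᶠ[𝓝 y] fun z => G (z, 0) := by
      filter_upwards [hI.mem_nhds hy] with z hz using (hg z hz).symm
    rw [this.deriv_eq, (hasDerivAt_pdx hG hΩ (hF.mem y hy)).deriv]
  have w2 : ∀ y ∈ I, pdx (pdx (pdt F)) (y, 0) = deriv (deriv (variationField F)) y :=
    fun y hy => key hT1 hy w1
  have w3 : ∀ y ∈ I, pdx (pdx (pdx (pdt F))) (y, 0) =
      deriv (deriv (deriv (variationField F))) y := fun y hy => key hT2 hy w2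
  have hm := hF.mem s hs
  have d0 := hasDerivAt_pdt hF0 hΩ hm
  have d1 := hasDerivAt_pdt hF1 hΩ hm
  have d2 := hasDerivAt_pdt hF2 hΩ hm
  have d3 := hasDerivAt_pdt hF3 hΩ hm
  rw [s1 hm, w1 s hs] at d1
  rw [s2 hm, w2 s hs] at d2
  rw [s3 hm, w3 s hs] at d3
  change HasDerivAt (fun u => F (s, u)) (variationField F s) 0 at d0
  obtain ⟨j1, j2, j3⟩ := hF.jet_initial h hI
  have hL := fun (i j : Fin 6) => h.frame.lorentz_col i j hs
  have hw0 := hF.lorentz_field hs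
  have hw1 := hF.lorentz_deriv_field h hI hs
  refine (hasDerivAt_arclengthJet (M := μ₁ s) (M' := deriv μ₁ s) d0 d1 d2 d3
    ?_ ?_ ?_ ?_ ?_ ?_ ?_).congr_deriv ?_
  all_goals simp only [hF.initial s hs, j1 s hs, j2 s hs, j3 s hs]
  -- The eighth goal identifies the derivative; the other seven are the products of the initial jet.
  on_goal 8 =>
    simp only [densityVariation, lorentz_add_left, lorentz_add_right, lorentz_smul_left,
      lorentz_smul_right, lorentz_comm (frameCol e 0 s) (deriv _ s),
      lorentz_comm (frameCol e 1 s) (deriv _ s), lorentz_comm (frameCol e 2 s) (deriv _ s), hw0,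
      hw1]
    ring
  all_goals
    simp only [lorentz_add_left, lorentz_add_right, lorentz_smul_left, lorentz_smul_right, hL]
    simp [lorentzS]
  ring

/-- The first variation formula for the conformal arclength. -/
theorem IsFrenetVariation.firstVariation (hF : IsFrenetVariation e I F Ω)
    (h : IsFrenetSystem e I μ₁ μ₂ μ₃) (hI : IsOpen I) {a b : ℝ} (hab : a ≤ b)
    (habI : Icc a b ⊆ I)
    (hWs : ∀ s ∈ I \ Icc a b, ∃ c : ℝ, variationField F s = c • frameCol e 0 s) :
    HasDerivAt (fun t => ∫ x in a..b, familyDensityPow F (x, t) ^ (1 / 4 : ℝ))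
      (1 / 2 * ∫ s in a..b, eulerLagrange e μ₁ μ₂ μ₃ s (variationField F s)) 0 := by
  have hΩ := hF.isOpen
  have hF0 := hF.smooth
  have hF1 := contDiffOn_pdx hF0 hΩ
  have hF2 := contDiffOn_pdx hF1 hΩ
  have hF3 := contDiffOn_pdx hF2 hΩ
  -- The parameters are restricted to the open sets where the lift is immersed and then where the
  -- fourth power of the density is positive, so that its fourth root is smooth.
  set Ω₁ := Ω ∩ (fun p => lorentz (pdx F p) (pdx F p)) ⁻¹' Ioi 0 with hΩ₁
  have o1 : IsOpen Ω₁ :=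
    (ContDiffOn.lorentz hF1 hF1).continuousOn.isOpen_inter_preimage hΩ isOpen_Ioi
  have hR : ContDiffOn ℝ ∞ (familyDensityPow F) Ω₁ :=
    contDiffOn_arclengthJet (hF0.mono inter_subset_left) (hF1.mono inter_subset_left)
      (hF2.mono inter_subset_left) (hF3.mono inter_subset_left)
      fun p hp => (show 0 < lorentz (pdx F p) (pdx F p) from hp.2).ne'
  set Ω₂ := Ω₁ ∩ familyDensityPow F ⁻¹' Ioi 0 with hΩ₂
  have o2 : IsOpen Ω₂ := hR.continuousOn.isOpen_inter_preimage o1 isOpen_Ioi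
  have hρ : ContDiffOn ℝ ∞ (fun p => familyDensityPow F p ^ (1 / 4 : ℝ)) Ω₂ :=
    (hR.mono inter_subset_left).rpow_const_of_ne
      fun p hp => (show 0 < familyDensityPow F p from hp.2).ne'
  have hmem : ∀ s ∈ I, (s, (0 : ℝ)) ∈ Ω₂ := by
    intro s hs
    refine ⟨⟨hF.mem s hs, ?_⟩, ?_⟩
    · change 0 < lorentz (pdx F (s, 0)) (pdx F (s, 0))
      rw [(hF.jet_initial h hI).1 s hs, h.frame.lorentz_col 1 1 hs]
      simp [lorentzS]
    · change 0 < familyDensityPow F (s, 0)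
      rw [hF.familyDensityPow_initial h hI hs]
      exact one_pos
  have hint := hasDerivAt_integral_of_contDiffOn o2 hρ hab fun x hx => hmem x (habI hx)
  refine hint.congr_deriv ?_
  rw [← h.integral_densityVariation hI hF.contDiffOn_field (fun s hs => hF.lorentz_field hs) hab
    habI hWs, ← intervalIntegral.integral_const_mul]
  refine intervalIntegral.integral_congr fun s hs => ?_
  rw [uIcc_of_le hab] at hs
  have h1 := hasDerivAt_pdt hρ o2 (hmem s (habI hs))
  have h2 := (hF.hasDerivAt_familyDensityPow h hI (habI hs)).rpow_const (p := (1 / 4 : ℝ))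
    (Or.inl (by rw [hF.familyDensityPow_initial h hI (habI hs)]; exact one_ne_zero))
  -- The fourth power of the density equals 1 at t = 0, so the fourth root contributes 1/4; with the
  -- factor 2 of the preceding derivative this is the 1/2 of the formula.
  rw [h1.unique h2, hF.familyDensityPow_initial h hI (habI hs), Real.one_rpow]
  ring

end FirstVariation

/-! ### Frenet frames -/

lemma IsFrame.mono {e : ℝ → M6} {f : ℝ → Q4} {U V : Set ℝ} (h : IsFrame e f U) (hV : V ⊆ U) :
    IsFrame e f V :=
  ⟨fun i j => (h.1 i j).mono hV, fun y hy => h.2 y (hV hy)⟩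

lemma IsFrenetFrame.mono {e : ℝ → M6} {f : ℝ → Q4} {U V : Set ℝ} (h : IsFrenetFrame e f U)
    (hV : V ⊆ U) : IsFrenetFrame e f V :=
  ⟨⟨⟨⟨⟨h.1.1.1.1.1.mono hV, fun y hy => h.1.1.1.1.2 y (hV hy)⟩,
    fun y hy => h.1.1.1.2 y (hV hy)⟩, fun y hy => h.1.1.2 y (hV hy)⟩,
    fun y hy => h.1.2 y (hV hy)⟩, fun y hy => h.2 y (hV hy)⟩

lemma IsFrenetFrame.isFrame {e : ℝ → M6} {f : ℝ → Q4} {U : Set ℝ} (h : IsFrenetFrame e f U) :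
    IsFrame e f U := h.1.1.1.1.1

/-- Frenet frames may be glued. -/
lemma isFrenetFrame_of_local {e : ℝ → M6} {f : ℝ → Q4} {U : Set ℝ}
    (h : ∀ x ∈ U, ∃ V, IsOpen V ∧ x ∈ V ∧ ∃ e', IsFrenetFrame e' f V ∧ EqOn e e' V) :
    IsFrenetFrame e f U := by
  have hmc : ∀ x ∈ U, ∃ V, IsOpen V ∧ x ∈ V ∧ ∃ e', IsFrenetFrame e' f V ∧ EqOn e e' V ∧
      mcForm e x = mcForm e' x := by
    intro x hx
    obtain ⟨V, hV, hxV, e', he', heq⟩ := h x hx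
    refine ⟨V, hV, hxV, e', he', heq, ?_⟩
    rw [mcForm, mcForm, heq hxV]
    congr 1
    ext i j
    simp only [Matrix.of_apply]
    refine Filter.EventuallyEq.deriv_eq ?_
    filter_upwards [hV.mem_nhds hxV] with y hy
    rw [heq hy]
  refine ⟨⟨⟨⟨⟨⟨?_, ?_⟩, ?_⟩, ?_⟩, ?_⟩, ?_⟩, ?_⟩
  · intro i j x hx
    obtain ⟨V, hV, hxV, e', he', heq⟩ := h x hx
    have h1 := (he'.isFrame.1 i j).contDiffAt (hV.mem_nhds hxV)
    refine (h1.congr_of_eventuallyEq ?_).contDiffWithinAt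
    filter_upwards [hV.mem_nhds hxV] with y hy
    rw [heq hy]
  all_goals
    intro x hx
    obtain ⟨V, hV, hxV, e', he', heq, hm⟩ := hmc x hx
  · rw [heq hxV]
    exact he'.isFrame.2 x hxV
  all_goals rw [hm]
  · exact he'.1.1.1.1.2 x hxV
  · exact he'.1.1.1.2 x hxV
  · exact he'.1.1.2 x hxV
  · exact he'.1.2 x hxV
  · exact he'.2 x hxV

lemma IsFrenetFrame.isFrenetSystem {e : ℝ → M6} {f : ℝ → Q4} {I : Set ℝ} {μ₁ μ₂ μ₃ : ℝ → ℝ}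
    (hI : IsOpen I) (he : IsFrenetFrame e f I) (h1 : ∀ x ∈ I, mcForm e x 1 0 = 1)
    (hc : HasCurvatures e I μ₁ μ₂ μ₃) : IsFrenetSystem e I μ₁ μ₂ μ₃ := by
  have hL := he.isFrame.isLorentzFrame
  refine ⟨hL, fun s hs => ?_, ?_, ?_, ?_⟩
  · obtain ⟨⟨a1, a2, a3⟩, ⟨b1, b2, b3, b4⟩, ⟨c1, c2, c3, c4⟩, ⟨d1, d2, d3, d4⟩,
      ⟨g1, g2, g3, g4, g5, g6⟩⟩ := moebAlg_entries (hL.mcForm_mem hI hs)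
    obtain ⟨⟨⟨⟨⟨_, p1⟩, p2⟩, p3⟩, p4⟩, p5⟩ := he
    obtain ⟨-, k1, k2, k3⟩ := p1 s hs
    obtain ⟨k4, k5, k6⟩ := p2 s hs
    obtain ⟨k7, k8, k9⟩ := p3 s hs
    have k10 := p4 s hs
    have k11 := (p5 s hs).2
    obtain ⟨m1, m2, m3⟩ := hc s hs
    have k0 := h1 s hs
    rw [k0, mul_one] at m1 m2 m3
    rw [k0] at k7
    ext i j
    fin_cases i <;> fin_cases j <;> simp [frenetMatrix, *]
  · exact (hL.contDiffOn_mcForm hI 0 1).congr fun s hs => by rw [(hc s hs).1, h1 s hs, mul_one]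
  · exact (hL.contDiffOn_mcForm hI 3 2).congr fun s hs => by rw [(hc s hs).2.1, h1 s hs, mul_one]
  · exact (hL.contDiffOn_mcForm hI 4 3).congr fun s hs => by rw [(hc s hs).2.2, h1 s hs, mul_one]

lemma hasCurvatures_mcForm {e : ℝ → M6} {I : Set ℝ} (h1 : ∀ x ∈ I, mcForm e x 1 0 = 1) :
    HasCurvatures e I (fun x => mcForm e x 0 1) (fun x => mcForm e x 3 2)
      (fun x => mcForm e x 4 3) := fun x hx => by simp [h1 x hx]

/-- In the arclength parameter third order frames satisfy `φ¹₀ = ds`. -/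
lemma IsThirdOrderFrame.mcForm_one_zero {e : ℝ → M6} {f : ℝ → Q4} {U I : Set ℝ} (hU : IsOpen U)
    (he : IsThirdOrderFrame e f U) (hI : IsOpen I) (hf : IsImmersedCurve f I)
    (hs : IsConformalArclength f I fun s => s) {x : ℝ} (hxU : x ∈ U) (hxI : x ∈ I) :
    mcForm e x 1 0 = 1 := by
  obtain ⟨F, hF, hFf⟩ := id hf
  have hFf' : ∀ y ∈ I, F y ∈ posCone ∧ Represents (F y) (f y) := fun y hy =>
    ⟨(hFf y hy).1, (hFf y hy).2.1⟩
  have h1 := he.1.density_eq hU hxU hI hxI hF hFf'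
  rw [← arclengthDensity_eq hI hf hF hFf' hxI, (hs x hxI).unique (hasDerivAt_id x)] at h1
  have hpos := (he.1.1.2 x hxU).1
  obtain ⟨k1, k2, k3⟩ := he.2 x hxU
  have hp : pSq e x = 1 := by
    rw [pSq, k1, k2, k3, div_self hpos.ne']
    norm_num
  simpa [hp] using h1

/-- Five columns of a Lorentz matrix determine the remaining spacelike one up to sign, and the
determinant fixes the sign k. -/
lemma lorentz_matrix_unique {G H : M6} (hG : Gᵀ * lorentzS * G = lorentzS)
    (hH : Hᵀ * lorentzS * H = lorentzS) (dG : G.det = 1) (dH : H.det = 1)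
    (h : ∀ j, j ≠ 4 → ∀ i, G i j = H i j) : G = H := by
  set k := lorentz (fun i => G i 4) (fun i => H i 4) with hk
  have hK : Gᵀ * lorentzS * H = lorentzS * Matrix.diagonal ![1, 1, 1, 1, k, 1] := by
    ext i j
    rw [Matrix.mul_diagonal]
    have h1 : (Gᵀ * lorentzS * H) i j = lorentz (fun a => G a i) (fun a => H a j) := by
      simp only [lorentz_eq, Matrix.mul_apply, Fin.sum_univ_six, lorentzS, Matrix.transpose_apply]
      simp
      ring
    rw [h1]
    by_cases hj : j = 4
    · by_cases hi : i = 4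
      · subst hi hj
        rw [← hk]
        simp [lorentzS]
      · have : (fun a => G a i) = fun a => H a i := funext fun a => h i hi a
        rw [this, ← lorentz_eq_transpose_mul, hH]
        subst hj
        fin_cases i <;> simp [lorentzS] at hi ⊢
    · have : (fun a => H a j) = fun a => G a j := funext fun a => (h j hj a).symm
      rw [this, ← lorentz_eq_transpose_mul, hG]
      fin_cases j <;> simp at hj ⊢
  have hdS : lorentzS.det ≠ 0 := by
    intro h0
    have := congrArg Matrix.det lorentzS_mul_self
    simp [h0] at this
  have hk1 : k = 1 := by
    have := congrArg Matrix.det hK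
    rw [Matrix.det_mul, Matrix.det_mul, Matrix.det_mul, Matrix.det_transpose, dG, dH,
      Matrix.det_diagonal] at this
    exact mul_left_cancel₀ hdS (by simpa [Fin.prod_univ_six] using this.symm)
  have hD : Matrix.diagonal ![1, 1, 1, 1, k, 1] = (1 : M6) := by
    rw [hk1]
    ext i j
    fin_cases i <;> fin_cases j <;> simp [Matrix.diagonal]
  rw [hD, mul_one] at hK
  have hu : lorentzS * Gᵀ * lorentzS * G = 1 := by
    rw [← inv_eq_of_lorentz hG]
    exact Matrix.nonsing_inv_mul _ (isUnit_det_of_lorentz hG)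
  have hu' : G * (lorentzS * Gᵀ * lorentzS) = 1 := by
    rw [← inv_eq_of_lorentz hG]
    exact Matrix.mul_nonsing_inv _ (isUnit_det_of_lorentz hG)
  calc G = G * (lorentzS * lorentzS) := by rw [lorentzS_mul_self, mul_one]
    _ = G * (lorentzS * (Gᵀ * lorentzS * H)) := by rw [hK]
    _ = G * (lorentzS * Gᵀ * lorentzS) * H := by simp only [mul_assoc]
    _ = H := by rw [hu', one_mul]

/-- Uniqueness of the Frenet frame. -/
lemma IsFrenetFrame.unique {e e' : ℝ → M6} {f : ℝ → Q4} {V : Set ℝ} (hV : IsOpen V)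
    (he : IsFrenetFrame e f V) (he' : IsFrenetFrame e' f V)
    (h1 : ∀ x ∈ V, mcForm e x 1 0 = 1) (h1' : ∀ x ∈ V, mcForm e' x 1 0 = 1) : EqOn e e' V := by
  have S := he.isFrenetSystem hV h1 (hasCurvatures_mcForm h1)
  have S' := he'.isFrenetSystem hV h1' (hasCurvatures_mcForm h1')
  have L := fun (i j : Fin 6) (y : ℝ) (hy : y ∈ V) => S.frame.lorentz_col i j hy
  have L' := fun (i j : Fin 6) (y : ℝ) (hy : y ∈ V) => S'.frame.lorentz_col i j hy
  have key : ∀ {g g' : ℝ → V6} {d d' : V6} {y : ℝ}, y ∈ V → EqOn g g' V → HasDerivAt g d y →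
      HasDerivAt g' d' y → d = d' := by
    intro g g' d d' y hy hg hd hd'
    refine hd.unique (hd'.congr_of_eventuallyEq ?_)
    filter_upwards [hV.mem_nhds hy] with z hz using hg hz
  have pos := fun y (hy : y ∈ V) => ((he.isFrame.2 y hy).1.1).col_mem
  have pos' := fun y (hy : y ∈ V) => ((he'.isFrame.2 y hy).1.1).col_mem
  obtain ⟨r, hr, hre⟩ := lift_eq_smul (S.frame.contDiffOn_col 0)
    (fun y hy => ⟨pos y hy, (he.isFrame.2 y hy).2⟩) (S'.frame.contDiffOn_col 0)
    (fun y hy => ⟨pos' y hy, (he'.isFrame.2 y hy).2⟩)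
  -- If e'₀ = r e₀ then e'₁ = r e₁ + r'e₀ has norm r², so r = 1. Each further column is then read
  -- off from the derivative of an earlier one.
  have c0 : EqOn (frameCol e 0) (frameCol e' 0) V := by
    intro y hy
    have h2 := key hy (fun z hz => (hre z hz).2) (S'.hasDerivAt_cols hV hy).1
      ((hasDerivAt_of_contDiffOn hr hV hy).fun_smul (S.hasDerivAt_cols hV hy).1)
    have h3 := L' 1 1 y hy
    rw [h2] at h3
    simp only [lorentz_add_left, lorentz_add_right, lorentz_smul_left, lorentz_smul_right,
      L _ _ y hy] at h3
    simp [lorentzS] at h3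
    have h4 := (hre y hy).1
    have h5 : r y = 1 := by nlinarith
    rw [(hre y hy).2, h5, one_smul]
  have c1 : EqOn (frameCol e 1) (frameCol e' 1) V := fun y hy =>
    key hy c0 (S.hasDerivAt_cols hV hy).1 (S'.hasDerivAt_cols hV hy).1
  have c5' : ∀ y ∈ V, mcForm e y 0 1 = mcForm e' y 0 1 ∧ frameCol e 5 y = frameCol e' 5 y := by
    intro y hy
    have h2 := key hy c1 (S.hasDerivAt_cols hV hy).2.1 (S'.hasDerivAt_cols hV hy).2.1
    rw [c0 hy] at h2
    -- The derivative of e₁ determines e₅ up to a multiple of e₀; since e₅ is null the multiple is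
    -- zero, so the first curvatures agree as well.
    have h3 : frameCol e 5 y = frameCol e' 5 y +
        (mcForm e' y 0 1 - mcForm e y 0 1) • frameCol e' 0 y := by
      rw [sub_smul, ← add_sub_assoc, eq_sub_iff_add_eq, add_comm, h2, add_comm]
    have h4 := L 5 5 y hy
    rw [h3] at h4
    simp only [lorentz_add_left, lorentz_add_right, lorentz_smul_left, lorentz_smul_right,
      L' _ _ y hy] at h4
    simp [lorentzS] at h4
    have h5 : mcForm e y 0 1 = mcForm e' y 0 1 := by linarith
    refine ⟨h5, ?_⟩
    rw [h3, h5, sub_self, zero_smul, add_zero]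
  have c5 : EqOn (frameCol e 5) (frameCol e' 5) V := fun y hy => (c5' y hy).2
  have c2 : EqOn (frameCol e 2) (frameCol e' 2) V := by
    intro y hy
    have h2 := key hy c5 (S.hasDerivAt_cols hV hy).2.2.2.2.2 (S'.hasDerivAt_cols hV hy).2.2.2.2.2
    rw [c1 hy, (c5' y hy).1] at h2
    exact add_left_cancel h2
  have c3 : EqOn (frameCol e 3) (frameCol e' 3) V := by
    intro y hy
    have h2 := key hy c2 (S.hasDerivAt_cols hV hy).2.2.1 (S'.hasDerivAt_cols hV hy).2.2.1
    rw [c0 hy] at h2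
    have h3 := add_left_cancel h2
    have h4 : lorentz (mcForm e y 3 2 • frameCol e 3 y) (mcForm e y 3 2 • frameCol e 3 y) =
      lorentz (mcForm e' y 3 2 • frameCol e' 3 y) (mcForm e' y 3 2 • frameCol e' 3 y) := by rw [h3]
    simp only [lorentz_smul_left, lorentz_smul_right, L _ _ y hy, L' _ _ y hy] at h4
    simp [lorentzS] at h4
    have p1 := (he.2 y hy).1
    have p2 := (he'.2 y hy).1
    have h5 : mcForm e y 3 2 = mcForm e' y 3 2 := by nlinarith
    rw [h5] at h3
    exact smul_right_injective _ p2.ne' h3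
  intro y hy
  refine lorentz_matrix_unique (S.frame.lorentz y hy) (S'.frame.lorentz y hy)
    (he.isFrame.2 y hy).1.2 (he'.isFrame.2 y hy).1.2 fun j hj i => ?_
  fin_cases j
  · exact congrFun (c0 hy) i
  · exact congrFun (c1 hy) i
  · exact congrFun (c2 hy) i
  · exact congrFun (c3 hy) i
  · exact absurd rfl hj
  · exact congrFun (c5 hy) i

/-- Two Frenet frames of a curve that is parametrized by arclength agree. -/
lemma IsFrenetFrame.eq_of_arclength {e e' : ℝ → M6} {f : ℝ → Q4} {I U U' : Set ℝ} (hI : IsOpen I)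
    (hf : IsImmersedCurve f I) (hs : IsConformalArclength f I fun s => s) (hU : IsOpen U)
    (hU' : IsOpen U') (he : IsFrenetFrame e f U) (he' : IsFrenetFrame e' f U') :
    EqOn e e' (U ∩ U' ∩ I) := by
  have hV : IsOpen (U ∩ U' ∩ I) := (hU.inter hU').inter hI
  exact (he.mono fun y hy => hy.1.1).unique hV (he'.mono fun y hy => hy.1.2)
    (fun y hy => he.1.1.mcForm_one_zero hU hI hf hs hy.1.1 hy.2)
    (fun y hy => he'.1.1.mcForm_one_zero hU' hI hf hs hy.1.2 hy.2)

/-- Local Frenet frames exist by 3-genericity and agree on overlaps by uniqueness, so the frame that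
takes at s the value of the local frame chosen for s is locally one of them. -/
lemma exists_isFrenetFrame {f : ℝ → Q4} {I : Set ℝ} (hI : IsOpen I) (hf : IsImmersedCurve f I)
    (hs : IsConformalArclength f I fun s => s) (h3 : ∀ s ∈ I, Is3Generic f s) :
    ∃ e, IsFrenetFrame e f I := by
  have h : ∀ s : ℝ, ∃ (U : Set ℝ) (e : ℝ → M6), s ∈ I → IsOpen U ∧ s ∈ U ∧ IsFrenetFrame e f U := by
    intro s
    by_cases hs : s ∈ I
    · obtain ⟨-, U, hU, hsU, e, he, -⟩ := h3 s hs
      exact ⟨U, e, fun _ => ⟨hU, hsU, he⟩⟩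
    · exact ⟨∅, fun _ => 0, fun h => absurd h hs⟩
  choose U E hUE using h
  refine ⟨fun s => E s s, isFrenetFrame_of_local fun x hx => ?_⟩
  obtain ⟨hU, hxU, hE⟩ := hUE x hx
  refine ⟨U x ∩ I, hU.inter hI, ⟨hxU, hx⟩, E x, hE.mono inter_subset_left, ?_⟩
  rintro y ⟨hyU, hy⟩
  obtain ⟨hU', hyU', hE'⟩ := hUE y hy
  exact hE'.eq_of_arclength hI hf hs hU' hU hE ⟨⟨hyU', hyU⟩, hy⟩

lemma IsFrenetFrame.mcForm_four_three_ne_zero {e : ℝ → M6} {f : ℝ → Q4} {I : Set ℝ}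
    (hI : IsOpen I) (hf : IsImmersedCurve f I) (hs : IsConformalArclength f I fun s => s)
    (h3 : ∀ s ∈ I, Is3Generic f s) (he : IsFrenetFrame e f I) {s : ℝ} (hsI : s ∈ I) :
    mcForm e s 4 3 ≠ 0 := by
  obtain ⟨-, U, hU, hsU, e', he', hne⟩ := h3 s hsI
  have heq := he.eq_of_arclength hI hf hs hI hU he'
  have hV : IsOpen (I ∩ U ∩ I) := (hI.inter hU).inter hI
  have hsV : s ∈ I ∩ U ∩ I := ⟨⟨hsI, hsU⟩, hsI⟩
  have : mcForm e s = mcForm e' s := by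
    rw [mcForm, mcForm, heq hsV]
    congr 1
    ext i j
    simp only [Matrix.of_apply]
    refine Filter.EventuallyEq.deriv_eq ?_
    filter_upwards [hV.mem_nhds hsV] with y hy
    rw [heq hy]
  rwa [this]

/-! ### The Euler-Lagrange equations -/

lemma IsConformalMotion.col_five_mem {G : M6} (h : IsConformalMotion G) :
    (fun i => G i 5) ∈ posCone := by
  have e5 : (fun i => G i 5) = G *ᵥ (Pi.single 5 1) := by ext i; simp
  rw [e5]
  exact h.2 _ ⟨by simp [lorentz_eq], by simp⟩

/-- The normal variation of the normalized lift in the direction `g e_α`. -/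
def normalVariation (e : ℝ → M6) (α : Fin 6) (g : ℝ → ℝ) (p : ℝ × ℝ) : V6 :=
  frameCol e 0 p.1 + (p.2 * g p.1) • frameCol e α p.1 +
    (p.2 ^ 2 * g p.1 ^ 2 / 2) • frameCol e 5 p.1

section NormalVariation

variable {e : ℝ → M6} {I : Set ℝ} {μ₁ μ₂ μ₃ : ℝ → ℝ} {f : ℝ → Q4} {α : Fin 6} {g : ℝ → ℝ}

lemma contDiffOn_normalVariation (h : IsLorentzFrame e I) (hg : ContDiff ℝ ∞ g) :
    ContDiffOn ℝ ∞ (normalVariation e α g) (I ×ˢ univ) := by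
  have hc : ∀ j, ContDiffOn ℝ ∞ (fun p : ℝ × ℝ => frameCol e j p.1) (I ×ˢ univ) := fun j =>
    (h.contDiffOn_col j).comp contDiffOn_fst fun p hp => hp.1
  have hg' : ContDiffOn ℝ ∞ (fun p : ℝ × ℝ => g p.1) (I ×ˢ univ) :=
    (hg.comp contDiff_fst).contDiffOn
  exact ((hc 0).add ((contDiffOn_snd.mul hg').smul (hc α))).add
    ((((contDiffOn_snd.pow 2).mul (hg'.pow 2)).div_const 2).smul (hc 5))

/-- The quadratic multiple of e₅ is the correction that keeps the varied lift null. Its product with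
e₅ is constantly -1, which keeps it in the positive cone. -/
lemma normalVariation_mem (h : IsFrame e f I) (hα : α = 2 ∨ α = 3 ∨ α = 4) {p : ℝ × ℝ}
    (hp : p.1 ∈ I) : normalVariation e α g p ∈ posCone := by
  have L := fun (i j : Fin 6) => h.isLorentzFrame.lorentz_col i j hp
  refine mem_posCone_of_lorentz_neg (h.2 p.1 hp).1.1.col_five_mem ?_ ?_
  · simp only [normalVariation, lorentz_add_left, lorentz_add_right, lorentz_smul_left,
      lorentz_smul_right, L]
    rcases hα with rfl | rfl | rfl <;> simp [lorentzS] <;> ring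
  · change lorentz (frameCol e 5 p.1) _ < 0
    simp only [normalVariation, lorentz_add_right, lorentz_smul_right, L]
    rcases hα with rfl | rfl | rfl <;> simp [lorentzS]

lemma isFrenetVariation_normalVariation (h : IsFrame e f I) (hI : IsOpen I)
    (hα : α = 2 ∨ α = 3 ∨ α = 4) (hg : ContDiff ℝ ∞ g) :
    IsFrenetVariation e I (normalVariation e α g) (I ×ˢ univ) where
  isOpen := hI.prod isOpen_univ
  mem s hs := ⟨hs, mem_univ _⟩
  smooth := contDiffOn_normalVariation h.isLorentzFrame hg
  null p hp := (normalVariation_mem h hα hp.1).1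
  initial s _ := by simp [normalVariation]

lemma variationField_normalVariation (h : IsLorentzFrame e I) (hI : IsOpen I)
    (hg : ContDiff ℝ ∞ g) {s : ℝ} (hs : s ∈ I) :
    variationField (normalVariation e α g) s = g s • frameCol e α s := by
  have h1 := hasDerivAt_pdt (contDiffOn_normalVariation (α := α) h hg) (hI.prod isOpen_univ)
    (show (s, (0 : ℝ)) ∈ I ×ˢ univ from ⟨hs, mem_univ _⟩)
  have h2 : HasDerivAt (fun t : ℝ => normalVariation e α g (s, t))
      (((1 * g s) • frameCol e α s) +
        ((2 * (0 : ℝ) ^ 1 * 1) * g s ^ 2 / 2) • frameCol e 5 s) 0 := by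
    have k1 := (((hasDerivAt_id (0 : ℝ)).mul_const (g s)).smul_const
      (frameCol e α s)).const_add (frameCol e 0 s)
    have k2 := (((((hasDerivAt_id (0 : ℝ)).pow 2).mul_const (g s ^ 2)).div_const 2).smul_const
      (frameCol e 5 s))
    exact (k1.fun_add k2).congr_deriv (by simp)
  rw [variationField, h1.unique h2]
  simp

/-- Criticality for normal variations. -/
lemma integral_eulerLagrange_eq_zero (hI : IsOpen I) (hf : IsConformalGeodesic f I)
    (he : IsFrame e f I) (S : IsFrenetSystem e I μ₁ μ₂ μ₃) (hα : α = 2 ∨ α = 3 ∨ α = 4)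
    (hg : ContDiff ℝ ∞ g) {a b : ℝ} (hab : a ≤ b) (habI : Icc a b ⊆ I)
    (hgs : ∀ x, x ∉ Icc a b → g x = 0) :
    ∫ s in a..b, g s * eulerLagrange e μ₁ μ₂ μ₃ s (frameCol e α s) = 0 := by
  set F := normalVariation e α g with hFdef
  have hFV : IsFrenetVariation e I F (I ×ˢ univ) := isFrenetVariation_normalVariation he hI hα hg
  have hΩ := hFV.isOpen
  have hF := hFV.smooth
  have hF1 := contDiffOn_pdx hF hΩ
  have o1 : IsOpen ((I ×ˢ univ) ∩ (fun p => lorentz (pdx F p) (pdx F p)) ⁻¹' Ioi 0) :=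
    (ContDiffOn.lorentz hF1 hF1).continuousOn.isOpen_inter_preimage hΩ isOpen_Ioi
  -- Compactness of [a, b] gives one ε for which all varied curves are immersed over [a, b];
  -- elsewhere the lift is not changed.
  obtain ⟨u, v, hu, hv, hau, h0v, huv⟩ := generalized_tube_lemma (isCompact_Icc (a := a) (b := b))
    (isCompact_singleton (x := (0 : ℝ))) o1 (by
      rintro ⟨x, t⟩ ⟨hx, ht⟩
      obtain rfl : t = 0 := ht
      refine ⟨⟨habI hx, mem_univ _⟩, ?_⟩
      change 0 < lorentz (pdx F (x, 0)) (pdx F (x, 0))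
      rw [(hFV.jet_initial S hI).1 x (habI hx), S.frame.lorentz_col 1 1 (habI hx)]
      simp [lorentzS])
  obtain ⟨ε, hε, hball⟩ := Metric.isOpen_iff.1 hv 0 (h0v rfl)
  have hεv : Ioo (-ε) ε ⊆ v := by
    intro t ht
    refine hball ?_
    rw [Metric.mem_ball, Real.dist_eq, sub_zero, abs_lt]
    exact ht
  have hmem : ∀ x ∈ I, ∀ t, F (x, t) ∈ posCone := fun x hx t => normalVariation_mem he hα hx
  classical
  let w : ℝ → ℝ → Q4 := fun x t => if hx : x ∈ I then
    ⟨Projectivization.mk ℝ (F (x, t)) (posCone_ne_zero (hmem x hx t)),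
      mk_mem_Q4 _ (hmem x hx t).1⟩ else f x
  have hw : ∀ x ∈ I, ∀ t, Represents (F (x, t)) (w x t) := by
    intro x hx t
    refine ⟨posCone_ne_zero (hmem x hx t), ?_⟩
    simp only [w, dif_pos hx]
  have hout : ∀ x ∈ I \ Icc a b, ∀ t, F (x, t) = frameCol e 0 x := by
    intro x hx t
    simp [F, normalVariation, hgs x hx.2]
  have heq : ∀ x ∈ I, ∀ t, F (x, t) = frameCol e 0 x → w x t = f x := by
    intro x hx t hxt
    obtain ⟨h1, h2⟩ := hw x hx t
    obtain ⟨h3, h4⟩ := (he.2 x hx).2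
    apply Subtype.ext
    rw [h2, h4]
    congr 1
  have hslice : ∀ t, ContDiffOn ℝ ∞ (fun x => F (x, t)) I := fun t =>
    hF.comp (by fun_prop) fun x hx => ⟨hx, mem_univ _⟩
  have himm : ∀ t ∈ Ioo (-ε) ε, IsImmersedCurve (fun x => w x t) I := by
    intro t ht
    refine isImmersedCurve_of_lift hI (hslice t) (fun x hx => ⟨hmem x hx t, hw x hx t⟩) ?_
    intro x hx
    by_cases hxab : x ∈ Icc a b
    · rw [deriv_slice hF hΩ (fun _ _ => rfl) (show (x, t) ∈ I ×ˢ univ from ⟨hx, mem_univ _⟩)]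
      exact (huv (show (x, t) ∈ u ×ˢ v from ⟨hau hxab, hεv ht⟩)).2
    · have hV : IsOpen (I \ Icc a b) := hI.sdiff isClosed_Icc
      have : (fun y => F (y, t)) =ᶠ[𝓝 x] frameCol e 0 := by
        filter_upwards [hV.mem_nhds ⟨hx, hxab⟩] with y hy using hout y hy t
      rw [this.deriv_eq, (S.hasDerivAt_cols hI hx).1.deriv, S.frame.lorentz_col 1 1 hx]
      simp [lorentzS]
  have hadm : IsAdmissibleVariation w f I ε a b := by
    refine ⟨⟨F, hF.mono (prod_mono_right (subset_univ _)), fun x hx t _ =>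
      ⟨hmem x hx t, hw x hx t⟩⟩, himm, ?_, ?_⟩
    · intro x hx
      exact heq x hx 0 (hFV.initial x hx)
    · intro x hx t _
      exact heq x hx.1 t (hout x hx t)
  have hcrit := hf.2.2 ε a b w hε hab habI hadm
  have hfv := hFV.firstVariation S hI hab habI (by
    intro s hs
    refine ⟨0, ?_⟩
    rw [variationField_normalVariation S.frame hI hg hs.1, hgs s hs.2]
    simp)
  have hev : (fun t => ∫ x in a..b, arclengthDensity (fun y => w y t) x) =ᶠ[𝓝 0]
      fun t => ∫ x in a..b, familyDensityPow F (x, t) ^ (1 / 4 : ℝ) := by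
    filter_upwards [Ioo_mem_nhds (neg_lt_zero.2 hε) hε] with t ht
    refine intervalIntegral.integral_congr fun x hx => ?_
    rw [uIcc_of_le hab] at hx
    have hxI := habI hx
    rw [arclengthDensity_eq hI (himm t ht) (hslice t) (fun x hx => ⟨hmem x hx t, hw x hx t⟩) hxI,
      arclengthDensityPow_slice hF hΩ ⟨hxI, mem_univ _⟩]
  have hzero := hcrit.unique (hfv.congr_of_eventuallyEq hev)
  have hint : ∫ s in a..b, eulerLagrange e μ₁ μ₂ μ₃ s (variationField F s) =
      ∫ s in a..b, g s * eulerLagrange e μ₁ μ₂ μ₃ s (frameCol e α s) := by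
    refine intervalIntegral.integral_congr fun s hs => ?_
    rw [uIcc_of_le hab] at hs
    rw [variationField_normalVariation S.frame hI hg (habI hs)]
    simp only [eulerLagrange, lorentz_smul_left]
    ring
  linarith

/-- The fundamental lemma of the calculus of variations: orthogonality to all test functions gives
vanishing almost everywhere, hence everywhere by continuity. -/
lemma eulerLagrange_eq_zero (hI : IsOpen I) (hIc : I.OrdConnected) (hf : IsConformalGeodesic f I)
    (he : IsFrame e f I) (S : IsFrenetSystem e I μ₁ μ₂ μ₃) (hα : α = 2 ∨ α = 3 ∨ α = 4) {s : ℝ}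
    (hs : s ∈ I) : eulerLagrange e μ₁ μ₂ μ₃ s (frameCol e α s) = 0 := by
  have hc : ContinuousOn (fun s => eulerLagrange e μ₁ μ₂ μ₃ s (frameCol e α s)) I :=
    (S.contDiffOn_eulerLagrange hI (S.frame.contDiffOn_col α)).continuousOn
  have hae := hI.ae_eq_zero_of_integral_contDiff_smul_eq_zero
    (hc.locallyIntegrableOn (μ := MeasureTheory.volume) hI.measurableSet) (by
      intro g hg hgc hgI
      by_cases hne : (tsupport g).Nonempty
      -- The support of g may be disconnected; the interval from its least to its greatest point
      -- lies in I because I is an interval.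
      · obtain ⟨a, ha⟩ := hgc.isCompact.exists_isLeast hne
        obtain ⟨b, hb⟩ := hgc.isCompact.exists_isGreatest hne
        have hab : a ≤ b := ha.2 hb.1
        have habI : Icc a b ⊆ I := hIc.out (hgI ha.1) (hgI hb.1)
        have hgs : ∀ x, x ∉ Icc a b → g x = 0 := by
          intro x hx
          by_contra hgx
          have : x ∈ tsupport g := subset_tsupport g hgx
          exact hx ⟨ha.2 this, hb.2 this⟩
        have := integral_eulerLagrange_eq_zero hI hf he S hα hg hab habI hgs
        rw [intervalIntegral.integral_of_le hab, ← MeasureTheory.integral_Icc_eq_integral_Ioc,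
          MeasureTheory.setIntegral_eq_integral_of_forall_compl_eq_zero] at this
        · exact this
        · intro x hx
          rw [hgs x hx, zero_mul]
      · have : g = 0 := by
          rw [not_nonempty_iff_eq_empty, tsupport_eq_empty_iff] at hne
          exact hne
        simp [this])
  have h0 : EqOn (fun s => eulerLagrange e μ₁ μ₂ μ₃ s (frameCol e α s)) (fun _ => 0) I :=
    MeasureTheory.Measure.eqOn_open_of_ae_eq
      ((MeasureTheory.ae_restrict_iff' hI.measurableSet).2 hae) hI hc continuousOn_const
  exact h0 hs

/-- The Euler-Lagrange equations of the conformal arclength functional. -/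
theorem IsConformalGeodesic.eulerLagrange_equations (hI : IsOpen I) (hIc : I.OrdConnected)
    (hf : IsConformalGeodesic f I) (he : IsFrame e f I) (S : IsFrenetSystem e I μ₁ μ₂ μ₃) {s : ℝ}
    (hs : s ∈ I) :
    deriv μ₁ s = -3 * μ₂ s * deriv μ₂ s ∧
    deriv (deriv μ₂) s = μ₂ s ^ 3 + μ₂ s * μ₃ s ^ 2 + 2 * μ₁ s * μ₂ s ∧
    2 * deriv μ₂ s * μ₃ s + μ₂ s * deriv μ₃ s = 0 := by
  have L := fun (i j : Fin 6) => S.frame.lorentz_col i j hs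
  have h2 := eulerLagrange_eq_zero hI hIc hf he S (α := 2) (by simp) hs
  have h3 := eulerLagrange_eq_zero hI hIc hf he S (α := 3) (by simp) hs
  have h4 := eulerLagrange_eq_zero hI hIc hf he S (α := 4) (by simp) hs
  simp only [eulerLagrange, L] at h2 h3 h4
  simp [lorentzS] at h2 h3 h4
  refine ⟨by linarith, by linarith, by linarith⟩

end NormalVariation

/-! ### Cubic polynomials -/

/-- Vieta's formulas by divided differences. -/
lemma cubic_coeffs_of_roots {A B C a b c : ℝ} (hab : a ≠ b) (hbc : b ≠ c) (hac : a ≠ c)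
    (ha : a ^ 3 + A * a ^ 2 + B * a + C = 0) (hb : b ^ 3 + A * b ^ 2 + B * b + C = 0)
    (hc : c ^ 3 + A * c ^ 2 + B * c + C = 0) :
    A = -(a + b + c) ∧ B = a * b + b * c + c * a ∧ C = -(a * b * c) := by
  have h1 : a ^ 2 + a * b + b ^ 2 + A * (a + b) + B = 0 :=
    mul_left_cancel₀ (sub_ne_zero.2 hab) (by linear_combination ha - hb)
  have h2 : a ^ 2 + a * c + c ^ 2 + A * (a + c) + B = 0 :=
    mul_left_cancel₀ (sub_ne_zero.2 hac) (by linear_combination ha - hc)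
  have h3 : a + b + c + A = 0 :=
    mul_left_cancel₀ (sub_ne_zero.2 hbc) (by linear_combination h1 - h2)
  have hA : A = -(a + b + c) := by linear_combination h3
  have hB : B = a * b + b * c + c * a := by subst hA; linear_combination h1
  refine ⟨hA, hB, ?_⟩
  subst hA hB
  linear_combination ha

lemma cubic_pos_of_large {A B C M : ℝ} (hM : 1 + |A| + |B| + |C| ≤ M) :
    0 < M ^ 3 + A * M ^ 2 + B * M + C := by
  have hA := abs_nonneg A
  have hB := abs_nonneg B
  have hC := abs_nonneg C
  have h1 : 1 ≤ M := by linarith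
  have hA' := neg_abs_le A
  have hB' := neg_abs_le B
  have hC' := neg_abs_le C
  have h2 : M ≤ M ^ 2 := by nlinarith
  have h3 : (1 + |A| + |B| + |C|) * M ^ 2 ≤ M ^ 3 := by nlinarith [sq_nonneg M]
  have h4 : -|A| * M ^ 2 ≤ A * M ^ 2 := by nlinarith
  have h5 : -|B| * M ^ 2 ≤ B * M := by nlinarith
  have h6 : -|C| * M ^ 2 ≤ C := by nlinarith
  nlinarith

lemma exists_cubic_root_between {A B C x y : ℝ} (hxy : x < y)
    (h : (x ^ 3 + A * x ^ 2 + B * x + C) * (y ^ 3 + A * y ^ 2 + B * y + C) < 0) :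
    ∃ z, x < z ∧ z < y ∧ z ^ 3 + A * z ^ 2 + B * z + C = 0 := by
  set q : ℝ → ℝ := fun t => t ^ 3 + A * t ^ 2 + B * t + C with hq
  have hc : ContinuousOn q (Icc x y) := by fun_prop
  rcases mul_neg_iff.1 h with ⟨h1, h2⟩ | ⟨h1, h2⟩
  · obtain ⟨z, hz, hz0⟩ := intermediate_value_Ioo' hxy.le hc (show (0 : ℝ) ∈ Ioo (q y) (q x) from ⟨h2, h1⟩)
    exact ⟨z, hz.1, hz.2, hz0⟩
  · obtain ⟨z, hz, hz0⟩ := intermediate_value_Ioo hxy.le hc (show (0 : ℝ) ∈ Ioo (q x) (q y) from ⟨h1, h2⟩)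
    exact ⟨z, hz.1, hz.2, hz0⟩

lemma exists_cubic_root_gt {A B C x : ℝ} (h : x ^ 3 + A * x ^ 2 + B * x + C < 0) :
    ∃ z, x < z ∧ z ^ 3 + A * z ^ 2 + B * z + C = 0 := by
  set M := 1 + |A| + |B| + |C| + |x| with hM
  have h1 := cubic_pos_of_large (A := A) (B := B) (C := C) (M := M)
    (by have := abs_nonneg x; linarith)
  have h2 : x < M := by
    have := le_abs_self x
    have := abs_nonneg A
    have := abs_nonneg B
    have := abs_nonneg C
    linarith
  obtain ⟨z, hz, -, hz0⟩ := exists_cubic_root_between h2 (mul_neg_of_neg_of_pos h h1)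
  exact ⟨z, hz, hz0⟩

lemma exists_cubic_root_lt {A B C x : ℝ} (h : 0 < x ^ 3 + A * x ^ 2 + B * x + C) :
    ∃ z, z < x ∧ z ^ 3 + A * z ^ 2 + B * z + C = 0 := by
  obtain ⟨z, hz, hz0⟩ := exists_cubic_root_gt (A := -A) (B := B) (C := -C) (x := -x) (by linarith)
  exact ⟨-z, by linarith, by linarith⟩

/-! ### Admissible triples and the spectrum -/

section Spectrum

variable {C₁ C₂ C₃ ξ₀ ξ₁ ξ₂ lam τ₁ τ₂ : ℝ}

lemma IsAdmissibleTriple.cubicP_eq (h : IsAdmissibleTriple C₁ C₂ C₃ ξ₀ ξ₁ ξ₂) (t : ℝ) :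
    cubicP C₁ C₂ C₃ t = -((t - ξ₀) * (t - ξ₁) * (t - ξ₂)) := by
  obtain ⟨h0, h1, h2, p0, p1, p2⟩ := h
  simp only [cubicP] at *
  obtain ⟨hA, hB, hC⟩ := cubic_coeffs_of_roots (A := -(2 * C₁)) (B := -C₃) (C := C₂ ^ 2) (a := ξ₀)
    (b := ξ₁) (c := ξ₂) (by linarith) h2.ne (by linarith) (by linarith) (by linarith)
    (by linarith)
  linear_combination (-t ^ 2) * hA - t * hB - hC

lemma IsAdmissibleTriple.ne_zero (h : IsAdmissibleTriple C₁ C₂ C₃ ξ₀ ξ₁ ξ₂) : C₂ ≠ 0 := by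
  intro hC
  have h1 := h.cubicP_eq 0
  obtain ⟨h0, h1', h2, -⟩ := h
  simp only [cubicP, hC] at h1
  have : ξ₀ * ξ₁ * ξ₂ < 0 := mul_neg_of_neg_of_pos (mul_neg_of_neg_of_pos h0 h1') (by linarith)
  nlinarith

/-- P is positive near -∞, equal to -C₂² < 0 at 0, positive at t and negative near +∞; the sign
changes give the roots. -/
lemma exists_isAdmissibleTriple {t : ℝ} (hC : C₂ ≠ 0) (ht : 0 < t) (hP : 0 < cubicP C₁ C₂ C₃ t) :
    ∃ ξ₀ ξ₁ ξ₂, IsAdmissibleTriple C₁ C₂ C₃ ξ₀ ξ₁ ξ₂ := by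
  simp only [cubicP] at hP
  have hC2 : 0 < C₂ ^ 2 := by positivity
  obtain ⟨ξ₀, h0, p0⟩ := exists_cubic_root_lt (A := -(2 * C₁)) (B := -C₃) (C := C₂ ^ 2) (x := 0)
    (by linarith)
  obtain ⟨ξ₁, h1, h1', p1⟩ := exists_cubic_root_between (A := -(2 * C₁)) (B := -C₃) (C := C₂ ^ 2) ht
    (mul_neg_of_pos_of_neg (by linarith) (by linarith))
  obtain ⟨ξ₂, h2, p2⟩ := exists_cubic_root_gt (A := -(2 * C₁)) (B := -C₃) (C := C₂ ^ 2) (x := t)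
    (by linarith)
  refine ⟨ξ₀, ξ₁, ξ₂, h0, h1, h1'.trans h2, ?_, ?_, ?_⟩ <;> simp only [cubicP] <;> linarith

lemma IsAdmissibleTriple.mem_Icc (h : IsAdmissibleTriple C₁ C₂ C₃ ξ₀ ξ₁ ξ₂) {t : ℝ} (ht : 0 < t)
    (hP : 0 ≤ cubicP C₁ C₂ C₃ t) : ξ₁ ≤ t ∧ t ≤ ξ₂ := by
  rw [h.cubicP_eq] at hP
  obtain ⟨h0, h1, h2, -⟩ := h
  have h3 : (t - ξ₁) * (t - ξ₂) ≤ 0 := by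
    by_contra hlt
    rw [not_le] at hlt
    have := mul_pos (show 0 < t - ξ₀ by linarith) hlt
    linarith
  constructor <;> nlinarith

/-- If ξ is a root of P, then P(-x) - x takes the value ξ at x = -ξ. It is thus negative at -ξ₀,
positive at -ξ₁ and -ξ₂, and equal to -C₂² at 0, which locates its three roots. -/
lemma exists_isSpectralTriple (h : IsAdmissibleTriple C₁ C₂ C₃ ξ₀ ξ₁ ξ₂) :
    ∃ lam τ₁ τ₂, IsSpectralTriple C₁ C₂ C₃ lam τ₁ τ₂ ∧ -ξ₀ < lam ^ 2 ∧ τ₁ ^ 2 < ξ₁ ∧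
      ξ₂ < τ₂ ^ 2 := by
  have hC := h.ne_zero
  obtain ⟨h0, h1, h2, p0, p1, p2⟩ := h
  simp only [cubicP] at p0 p1 p2
  have hC2 : 0 < C₂ ^ 2 := by positivity
  obtain ⟨a, ha, qa⟩ := exists_cubic_root_gt (A := 2 * C₁) (B := -(1 + C₃)) (C := -C₂ ^ 2)
    (x := -ξ₀) (by linarith)
  obtain ⟨b, hb, hb', qb⟩ := exists_cubic_root_between (A := 2 * C₁) (B := -(1 + C₃))
    (C := -C₂ ^ 2) (x := -ξ₁) (y := 0) (by linarith)
    (mul_neg_of_pos_of_neg (by linarith) (by linarith))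
  obtain ⟨c, hc, qc⟩ := exists_cubic_root_lt (A := 2 * C₁) (B := -(1 + C₃)) (C := -C₂ ^ 2)
    (x := -ξ₂) (by linarith)
  have sa : √a ^ 2 = a := Real.sq_sqrt (by linarith)
  have sb : √(-b) ^ 2 = -b := Real.sq_sqrt (by linarith)
  have sc : √(-c) ^ 2 = -c := Real.sq_sqrt (by linarith)
  refine ⟨√a, √(-b), √(-c), ⟨Real.sqrt_pos.2 (by linarith), Real.sqrt_pos.2 (by linarith),
    Real.sqrt_lt_sqrt (by linarith) (by linarith), fun x => ?_⟩, by rw [sa]; exact ha,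
    by rw [sb]; linarith, by rw [sc]; linarith⟩
  rw [sa, sb, sc]
  obtain ⟨eA, eB, eC⟩ := cubic_coeffs_of_roots (a := a) (b := b) (c := c) (by linarith)
    (by linarith) (by linarith) qa qb qc
  simp only [cubicP]
  linear_combination x ^ 2 * eA + x * eB + eC

/-- At x = -ξ for a positive root ξ of P, the factored polynomial has the positive value ξ while its
factor x - λ² is negative. So the other two factors have opposite signs. -/
lemma IsSpectralTriple.bounds (hs : IsSpectralTriple C₁ C₂ C₃ lam τ₁ τ₂)
    (h : IsAdmissibleTriple C₁ C₂ C₃ ξ₀ ξ₁ ξ₂) : τ₁ ^ 2 < ξ₁ ∧ ξ₂ < τ₂ ^ 2 := by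
  obtain ⟨h0, h1, h2, p0, p1, p2⟩ := h
  obtain ⟨hl, ht1, ht2, hP⟩ := hs
  have ht : τ₁ ^ 2 < τ₂ ^ 2 := by nlinarith
  have key : ∀ ξ, 0 < ξ → cubicP C₁ C₂ C₃ ξ = 0 → τ₁ ^ 2 < ξ ∧ ξ < τ₂ ^ 2 := by
    intro ξ hξ hp
    have h3 := hP (-ξ)
    rw [neg_neg, hp] at h3
    have h4 : (-ξ + τ₁ ^ 2) * (-ξ + τ₂ ^ 2) < 0 := by
      by_contra hlt
      rw [not_lt] at hlt
      have := mul_nonneg (show 0 ≤ ξ + lam ^ 2 by positivity) hlt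
      linarith
    constructor <;> nlinarith
  exact ⟨(key ξ₁ h1 p1).1, (key ξ₂ (h1.trans h2) p2).2⟩

end Spectrum

/-! ### First integrals -/

lemma eq_of_hasDerivAt_zero {I : Set ℝ} (hI : IsOpen I) (hIc : I.OrdConnected) {g : ℝ → ℝ}
    (hg : ∀ s ∈ I, HasDerivAt g 0 s) {s t : ℝ} (hs : s ∈ I) (ht : t ∈ I) : g s = g t :=
  hI.is_const_of_deriv_eq_zero hIc.isPreconnected
    (fun x hx => (hg x hx).differentiableAt.differentiableWithinAt)
    (fun x hx => (hg x hx).deriv) hs ht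

lemma hasDerivAt_matrix_mul {A B : ℝ → M6} {A' B' : M6} {s : ℝ}
    (hA : ∀ i j, HasDerivAt (fun u => A u i j) (A' i j) s)
    (hB : ∀ i j, HasDerivAt (fun u => B u i j) (B' i j) s) (i j : Fin 6) :
    HasDerivAt (fun u => (A u * B u) i j) ((A' * B s + A s * B') i j) s := by
  simp only [Matrix.mul_apply, Matrix.add_apply]
  rw [← Finset.sum_add_distrib]
  exact HasDerivAt.fun_sum fun k _ => (hA i k).mul (hB k j)

/-- The Euler-Lagrange equations for the curvatures. -/
structure IsEulerLagrange (I : Set ℝ) (μ₁ μ₂ μ₃ : ℝ → ℝ) : Prop where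
  smooth₁ : ContDiffOn ℝ ∞ μ₁ I
  smooth₂ : ContDiffOn ℝ ∞ μ₂ I
  smooth₃ : ContDiffOn ℝ ∞ μ₃ I
  eq₁ : ∀ s ∈ I, deriv μ₁ s = -3 * μ₂ s * deriv μ₂ s
  eq₂ : ∀ s ∈ I, deriv (deriv μ₂) s = μ₂ s ^ 3 + μ₂ s * μ₃ s ^ 2 + 2 * μ₁ s * μ₂ s
  eq₃ : ∀ s ∈ I, 2 * deriv μ₂ s * μ₃ s + μ₂ s * deriv μ₃ s = 0

section FirstIntegrals

variable {I : Set ℝ} {μ₁ μ₂ μ₃ : ℝ → ℝ}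

/-- The Lax equation. -/
lemma IsEulerLagrange.lax (h : IsEulerLagrange I μ₁ μ₂ μ₃) (hI : IsOpen I) {s : ℝ} (hs : s ∈ I)
    (i j : Fin 6) : HasDerivAt (fun u => thetaMatrix μ₁ μ₂ μ₃ u i j)
      (⁅thetaMatrix μ₁ μ₂ μ₃ s, frenetMatrix (μ₁ s) (μ₂ s) (μ₃ s)⁆ i j) s := by
  have m1 := hasDerivAt_of_contDiffOn h.smooth₁ hI hs
  have m2 := hasDerivAt_of_contDiffOn h.smooth₂ hI hs
  have m2' := hasDerivAt_of_contDiffOn (contDiffOn_deriv h.smooth₂ hI) hI hs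
  have m3 := hasDerivAt_of_contDiffOn h.smooth₃ hI hs
  have hA : HasDerivAt (fun u => -μ₁ u - μ₂ u ^ 2) (μ₂ s * deriv μ₂ s) s :=
    (m1.fun_neg.fun_sub (m2.fun_pow 2)).congr_deriv (by rw [h.eq₁ s hs]; ring)
  have hB : HasDerivAt (fun u => μ₂ u * μ₃ u) (-(deriv μ₂ s * μ₃ s)) s :=
    (m2.fun_mul m3).congr_deriv (by linear_combination h.eq₃ s hs)
  rw [h.eq₂ s hs] at m2'
  have hΘ : ∀ i j, HasDerivAt (fun u => thetaMatrix μ₁ μ₂ μ₃ u i j)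
      ((!![0, 0, μ₂ s * deriv μ₂ s,
          μ₂ s ^ 3 + μ₂ s * μ₃ s ^ 2 + 2 * μ₁ s * μ₂ s, -(deriv μ₂ s * μ₃ s), 0;
        0, 0, 0, -deriv μ₂ s, 0, 0;
        0, 0, 0, 0, 0, μ₂ s * deriv μ₂ s;
        0, deriv μ₂ s, 0, 0, 0, μ₂ s ^ 3 + μ₂ s * μ₃ s ^ 2 + 2 * μ₁ s * μ₂ s;
        0, 0, 0, 0, 0, -(deriv μ₂ s * μ₃ s);
        0, 0, 0, 0, 0, 0] : M6) i j) s := by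
    intro i j
    fin_cases i <;> fin_cases j <;>
      first
        | exact hasDerivAt_const _ _
        | exact hA
        | exact hB
        | exact m2'
        | exact m2
        | exact m2.fun_neg
  refine (hΘ i j).congr_deriv ?_
  refine congrFun (congrFun ?_ i) j
  rw [Ring.lie_def]
  ext i j
  rw [Matrix.sub_apply, Matrix.mul_apply, Matrix.mul_apply, Fin.sum_univ_six, Fin.sum_univ_six]
  fin_cases i <;> fin_cases j <;> simp [thetaMatrix, frenetMatrix] <;> ring

lemma lorentzS_mul_transpose_of_mem {X : M6} (h : X ∈ moebAlg) :
    lorentzS * Xᵀ = -(X * lorentzS) := by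
  have hX : Xᵀ * lorentzS = -(lorentzS * X) := eq_neg_of_add_eq_zero_left h
  calc lorentzS * Xᵀ = lorentzS * (Xᵀ * lorentzS) * lorentzS := by
        simp only [mul_assoc, lorentzS_mul_self, mul_one]
    _ = -(X * lorentzS) := by
        rw [hX, mul_neg, neg_mul, ← mul_assoc lorentzS lorentzS, lorentzS_mul_self, one_mul]

/-- The matrix `e Θ e⁻¹` is constant. -/
lemma IsEulerLagrange.conj_theta_eq (h : IsEulerLagrange I μ₁ μ₂ μ₃) (hI : IsOpen I)
    (hIc : I.OrdConnected) {e : ℝ → M6} (S : IsFrenetSystem e I μ₁ μ₂ μ₃) {s t : ℝ} (hs : s ∈ I)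
    (ht : t ∈ I) : e s * thetaMatrix μ₁ μ₂ μ₃ s * (e s)⁻¹ =
      e t * thetaMatrix μ₁ μ₂ μ₃ t * (e t)⁻¹ := by
  -- The inverse of a Lorentz matrix is S ᵗe S, which is linear in e and easy to differentiate.
  rw [inv_eq_of_lorentz (S.frame.lorentz s hs), inv_eq_of_lorentz (S.frame.lorentz t ht)]
  ext i j
  refine eq_of_hasDerivAt_zero hI hIc
    (g := fun u => (e u * thetaMatrix μ₁ μ₂ μ₃ u * (lorentzS * (e u)ᵀ * lorentzS)) i j) ?_ hs ht
  intro u hu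
  have he : ∀ i j, HasDerivAt (fun v => e v i j) ((e u * mcForm e u) i j) u := by
    intro i j
    rw [← S.frame.frameDeriv_eq hu]
    exact hasDerivAt_of_contDiffOn (S.frame.smooth i j) hI hu
  have hc : ∀ i j, HasDerivAt (fun _ : ℝ => lorentzS i j) ((0 : M6) i j) u := fun i j =>
    hasDerivAt_const u _
  have hΘ := h.lax hI hu
  rw [← S.mc u hu] at hΘ
  have het : ∀ i j, HasDerivAt (fun v => (e v)ᵀ i j) ((e u * mcForm e u)ᵀ i j) u := fun i j =>
    he j i
  have hd := hasDerivAt_matrix_mul (hasDerivAt_matrix_mul he hΘ)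
    (hasDerivAt_matrix_mul (hasDerivAt_matrix_mul hc het) hc) i j
  refine hd.congr_deriv ?_
  have hφ' := lorentzS_mul_transpose_of_mem (S.frame.mcForm_mem hI hu)
  change _ = (0 : M6) i j
  refine congrFun (congrFun ?_ i) j
  rw [Matrix.transpose_mul, Ring.lie_def, zero_mul, zero_add, mul_zero, add_zero,
    ← mul_assoc lorentzS (mcForm e u)ᵀ, hφ']
  noncomm_ring

/-- The conserved quantities of the Euler-Lagrange equations. -/
lemma IsEulerLagrange.firstIntegrals (h : IsEulerLagrange I μ₁ μ₂ μ₃) (hI : IsOpen I)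
    (hIc : I.OrdConnected) (hne : I.Nonempty) (hpos : ∀ s ∈ I, 0 < μ₂ s) :
    ∃ C₁ C₂ C₃, ∀ s ∈ I, μ₁ s = -(3 / 2) * μ₂ s ^ 2 + C₁ ∧ μ₃ s = C₂ / μ₂ s ^ 2 ∧
      EnergyEquation C₁ C₂ C₃ μ₂ s := by
  obtain ⟨s₀, hs₀⟩ := hne
  set C₁ := μ₁ s₀ + 3 / 2 * μ₂ s₀ ^ 2 with hC₁
  set C₂ := μ₂ s₀ ^ 2 * μ₃ s₀ with hC₂
  have h1 : ∀ s ∈ I, μ₁ s + 3 / 2 * μ₂ s ^ 2 = C₁ := by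
    intro s hs
    refine eq_of_hasDerivAt_zero hI hIc (g := fun u => μ₁ u + 3 / 2 * μ₂ u ^ 2) ?_ hs hs₀
    intro u hu
    have m1 := hasDerivAt_of_contDiffOn h.smooth₁ hI hu
    have m2 := hasDerivAt_of_contDiffOn h.smooth₂ hI hu
    refine (m1.fun_add ((m2.fun_pow 2).const_mul (3 / 2 : ℝ))).congr_deriv ?_
    rw [h.eq₁ u hu]
    ring
  have h2 : ∀ s ∈ I, μ₂ s ^ 2 * μ₃ s = C₂ := by
    intro s hs
    refine eq_of_hasDerivAt_zero hI hIc (g := fun u => μ₂ u ^ 2 * μ₃ u) ?_ hs hs₀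
    intro u hu
    have m2 := hasDerivAt_of_contDiffOn h.smooth₂ hI hu
    have m3 := hasDerivAt_of_contDiffOn h.smooth₃ hI hu
    refine ((m2.fun_pow 2).fun_mul m3).congr_deriv ?_
    linear_combination μ₂ u * h.eq₃ u hu
  have h3 : ∀ s ∈ I, μ₃ s = C₂ / μ₂ s ^ 2 := by
    intro s hs
    have := (hpos s hs).ne'
    rw [← h2 s hs]
    field_simp
  set E : ℝ → ℝ := fun u => 1 / 2 * deriv μ₂ u ^ 2 + 1 / 2 * μ₂ u ^ 4 - C₁ * μ₂ u ^ 2 +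
    C₂ ^ 2 / (2 * μ₂ u ^ 2) with hE
  refine ⟨C₁, C₂, 2 * E s₀, fun s hs => ⟨by linarith [h1 s hs], h3 s hs, ?_⟩⟩
  have h4 : E s = E s₀ := by
    refine eq_of_hasDerivAt_zero hI hIc ?_ hs hs₀
    intro u hu
    have hu0 := (hpos u hu).ne'
    have m2 := hasDerivAt_of_contDiffOn h.smooth₂ hI hu
    have m2' := hasDerivAt_of_contDiffOn (contDiffOn_deriv h.smooth₂ hI) hI hu
    have hd := ((((m2'.fun_pow 2).const_mul (1 / 2 : ℝ)).fun_add
      ((m2.fun_pow 4).const_mul (1 / 2 : ℝ))).fun_sub ((m2.fun_pow 2).const_mul C₁)).fun_add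
      ((hasDerivAt_const u (C₂ ^ 2)).fun_div ((m2.fun_pow 2).const_mul 2) (by positivity))
    refine hd.congr_deriv ?_
    rw [h.eq₂ u hu, h3 u hu, show μ₁ u = C₁ - 3 / 2 * μ₂ u ^ 2 by linarith [h1 u hu]]
    field_simp
    ring
  change E s = 2 * E s₀ / 2
  rw [h4]
  ring

end FirstIntegrals

/-- The energy equation multiplied by 2μ₂². It confines μ₂² to the set where P is nonnegative. -/
lemma EnergyEquation.cubicP_eq {C₁ C₂ C₃ : ℝ} {μ₂ : ℝ → ℝ} {s : ℝ}
    (h : EnergyEquation C₁ C₂ C₃ μ₂ s) (hpos : 0 < μ₂ s) :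
    cubicP C₁ C₂ C₃ (μ₂ s ^ 2) = (μ₂ s * deriv μ₂ s) ^ 2 := by
  have h0 := hpos.ne'
  simp only [EnergyEquation] at h
  field_simp at h
  simp only [cubicP]
  linear_combination -h

/-- Here a, b, c, d stand for μ₁, μ₂, μ₃ and the derivative of μ₂. -/
lemma det_sub_theta (x a d b c : ℝ) :
    (!![x, -1, a + b ^ 2, -d, -(b * c), 0;
        0, x, 0, b, 0, -1;
        -1, 0, x, 0, 0, a + b ^ 2;
        0, -b, 0, x, 0, -d;
        0, 0, 0, 0, x, -(b * c);
        0, 0, -1, 0, 0, x] : M6).det =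
      x ^ 6 + (2 * a + 3 * b ^ 2) * x ^ 4 -
        (1 + d ^ 2 - 2 * b ^ 4 - 2 * a * b ^ 2 + b ^ 2 * c ^ 2) * x ^ 2 - b ^ 4 * c ^ 2 := by
  simp [Matrix.det_succ_row_zero, Fin.sum_univ_succ, Fin.succAbove]
  ring

lemma charpoly_conj_theta {e : M6} (he : eᵀ * lorentzS * e = lorentzS) {μ₁ μ₂ μ₃ : ℝ → ℝ}
    {s C₁ C₂ C₃ : ℝ} (hpos : 0 < μ₂ s) (h1 : μ₁ s = -(3 / 2) * μ₂ s ^ 2 + C₁)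
    (h2 : μ₃ s = C₂ / μ₂ s ^ 2) (h3 : EnergyEquation C₁ C₂ C₃ μ₂ s) (x : ℝ) :
    (e * thetaMatrix μ₁ μ₂ μ₃ s * e⁻¹).charpoly.eval x =
      x ^ 6 + 2 * C₁ * x ^ 4 - (1 + C₃) * x ^ 2 - C₂ ^ 2 := by
  rw [Matrix.charpoly_mul_comm, ← mul_assoc, Matrix.nonsing_inv_mul _ (isUnit_det_of_lorentz he),
    one_mul, Matrix.eval_charpoly]
  have hM : Matrix.scalar (Fin 6) x - thetaMatrix μ₁ μ₂ μ₃ s =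
      !![x, -1, μ₁ s + μ₂ s ^ 2, -deriv μ₂ s, -(μ₂ s * μ₃ s), 0;
        0, x, 0, μ₂ s, 0, -1;
        -1, 0, x, 0, 0, μ₁ s + μ₂ s ^ 2;
        0, -μ₂ s, 0, x, 0, -deriv μ₂ s;
        0, 0, 0, 0, x, -(μ₂ s * μ₃ s);
        0, 0, -1, 0, 0, x] := by
    ext i j
    fin_cases i <;> fin_cases j <;> simp [thetaMatrix] <;> ring
  rw [hM, det_sub_theta]
  have h0 := hpos.ne'
  simp only [EnergyEquation] at h3
  rw [h1, h2]
  field_simp at h3 ⊢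
  linear_combination (-x ^ 2) * h3

/-! ### The explicit frame -/

/-- The value of the matrix `Θ` in terms of the curvatures and of the derivative of `μ₂`. -/
def thetaValue (a m d c : ℝ) : M6 :=
  !![0, 1, -a - m ^ 2, d, m * c, 0;
     0, 0, 0, -m, 0, 1;
     1, 0, 0, 0, 0, -a - m ^ 2;
     0, m, 0, 0, 0, d;
     0, 0, 0, 0, 0, m * c;
     0, 0, 1, 0, 0, 0]

/-- The characteristic polynomial of `thetaValue` in terms of the square of the variable. -/
def thetaChi (a m d c x : ℝ) : ℝ :=
  x ^ 3 + (2 * a + 3 * m ^ 2) * x ^ 2 -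
    (1 + d ^ 2 - 2 * m ^ 4 - 2 * a * m ^ 2 + m ^ 2 * c ^ 2) * x - m ^ 4 * c ^ 2

/-- The frame with first column `v` whose rows are left eigenvectors of `Θ`. -/
def explicitFrame (lam τ₁ τ₂ a m d c : ℝ) (v : V6) : M6 :=
  !![v 0, (lam * v 0 + m * d * v 0) / (m ^ 2 + lam ^ 2), lam * v 0,
      (lam * d * v 0 - m * v 0) / (m ^ 2 + lam ^ 2), m * c * v 0 / lam,
      (lam ^ 2 + a + m ^ 2) * v 0;
     v 1, (-(τ₁ * v 2) + m * d * v 1) / (m ^ 2 - τ₁ ^ 2), -(τ₁ * v 2),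
      (-(τ₁ * d * v 2) - m * v 1) / (m ^ 2 - τ₁ ^ 2), m * c * v 2 / τ₁,
      (-τ₁ ^ 2 + a + m ^ 2) * v 1;
     v 2, (τ₁ * v 1 + m * d * v 2) / (m ^ 2 - τ₁ ^ 2), τ₁ * v 1,
      (τ₁ * d * v 1 - m * v 2) / (m ^ 2 - τ₁ ^ 2), -(m * c * v 1 / τ₁),
      (-τ₁ ^ 2 + a + m ^ 2) * v 2;
     v 3, (-(τ₂ * v 4) + m * d * v 3) / (m ^ 2 - τ₂ ^ 2), -(τ₂ * v 4),
      (-(τ₂ * d * v 4) - m * v 3) / (m ^ 2 - τ₂ ^ 2), m * c * v 4 / τ₂,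
      (-τ₂ ^ 2 + a + m ^ 2) * v 3;
     v 4, (τ₂ * v 3 + m * d * v 4) / (m ^ 2 - τ₂ ^ 2), τ₂ * v 3,
      (τ₂ * d * v 3 - m * v 4) / (m ^ 2 - τ₂ ^ 2), -(m * c * v 3 / τ₂),
      (-τ₂ ^ 2 + a + m ^ 2) * v 4;
     v 5, (-(lam * v 5) + m * d * v 5) / (m ^ 2 + lam ^ 2), -(lam * v 5),
      (-(lam * d * v 5) - m * v 5) / (m ^ 2 + lam ^ 2), -(m * c * v 5 / lam),
      (lam ^ 2 + a + m ^ 2) * v 5]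

section Algebra

variable {lam τ₁ τ₂ a m d c : ℝ}

/-- A left eigenvector x of Θ for the eigenvalue ν is computed from x₀: column 0 gives x₂, column 2
gives x₅, column 4 gives x₄, and columns 1 and 3 form a linear system for x₁, x₃ with determinant m²
+ ν² up to sign. Column 5 is then the characteristic equation. Rows 1, 2 and rows 3, 4 are real
forms of the pairs ±iτ₁ and ±iτ₂. -/
lemma explicitFrame_mul_theta (hl : lam ≠ 0) (h1 : τ₁ ≠ 0) (h2 : τ₂ ≠ 0)
    (hD : m ^ 2 + lam ^ 2 ≠ 0) (hD1 : m ^ 2 - τ₁ ^ 2 ≠ 0) (hD2 : m ^ 2 - τ₂ ^ 2 ≠ 0)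
    (cl : thetaChi a m d c (lam ^ 2) = 0) (c1 : thetaChi a m d c (-τ₁ ^ 2) = 0)
    (c2 : thetaChi a m d c (-τ₂ ^ 2) = 0) (v : V6) :
    explicitFrame lam τ₁ τ₂ a m d c v * thetaValue a m d c =
      normalForm lam τ₁ τ₂ * explicitFrame lam τ₁ τ₂ a m d c v := by
  simp only [thetaChi] at cl c1 c2
  ext i j
  rw [Matrix.mul_apply, Matrix.mul_apply, Fin.sum_univ_six, Fin.sum_univ_six]
  fin_cases j
  pick_goal 6
  · fin_cases i <;> simp [explicitFrame, normalForm, thetaValue]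
    · linear_combination (norm := (field_simp; ring)) (-(v 0) / (lam * (m ^ 2 + lam ^ 2))) * cl
    · linear_combination (norm := (field_simp; ring)) (-(v 2) / (τ₁ * (m ^ 2 - τ₁ ^ 2))) * c1
    · linear_combination (norm := (field_simp; ring)) (v 1 / (τ₁ * (m ^ 2 - τ₁ ^ 2))) * c1
    · linear_combination (norm := (field_simp; ring)) (-(v 4) / (τ₂ * (m ^ 2 - τ₂ ^ 2))) * c2
    · linear_combination (norm := (field_simp; ring)) (v 3 / (τ₂ * (m ^ 2 - τ₂ ^ 2))) * c2
    · linear_combination (norm := (field_simp; ring)) (v 5 / (lam * (m ^ 2 + lam ^ 2))) * cl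
  all_goals
    fin_cases i <;> simp [explicitFrame, normalForm, thetaValue] <;> field_simp <;> ring

/-- A matrix `X` with `X Θ = N X` whose first column vanishes is zero. -/
lemma eq_zero_of_mul_theta (hl : lam ≠ 0) (h1 : τ₁ ≠ 0) (h2 : τ₂ ≠ 0) (hm : m ≠ 0)
    (hD : m ^ 2 + lam ^ 2 ≠ 0) (hD1 : m ^ 2 - τ₁ ^ 2 ≠ 0) (hD2 : m ^ 2 - τ₂ ^ 2 ≠ 0)
    {X : M6} (hX : X * thetaValue a m d c = normalForm lam τ₁ τ₂ * X)
    (h0 : ∀ i, X i 0 = 0) : X = 0 := by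
  have hX' : ∀ i j, (X * thetaValue a m d c) i j = (normalForm lam τ₁ τ₂ * X) i j := fun i j => by
    rw [hX]
  simp only [Matrix.mul_apply, Fin.sum_univ_six] at hX'
  have c2 : ∀ i, X i 2 = 0 := by
    intro i
    have := hX' i 0
    simpa [thetaValue, h0] using this
  have c5 : ∀ i, X i 5 = 0 := by
    intro i
    have := hX' i 2
    simpa [thetaValue, h0, c2] using this
  have c1 : ∀ i, m * X i 3 = ∑ k, normalForm lam τ₁ τ₂ i k * X k 1 := by
    intro i
    have := hX' i 1
    rw [Fin.sum_univ_six, ← this]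
    simp [thetaValue, h0]
    ring
  have c3 : ∀ i, -m * X i 1 = ∑ k, normalForm lam τ₁ τ₂ i k * X k 3 := by
    intro i
    have := hX' i 3
    rw [Fin.sum_univ_six, ← this]
    simp [thetaValue, h0]
    ring
  have c4 : ∀ i, ∑ k, normalForm lam τ₁ τ₂ i k * X k 4 = 0 := by
    intro i
    have := hX' i 4
    rw [Fin.sum_univ_six, ← this]
    simp [thetaValue, h0]
  simp only [Fin.sum_univ_six] at c1 c3 c4
  have a0 := c1 0
  have a1 := c1 1
  have a2 := c1 2
  have a3 := c1 3
  have a4 := c1 4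
  have a5 := c1 5
  have b0 := c3 0
  have b1 := c3 1
  have b2 := c3 2
  have b3 := c3 3
  have b4 := c3 4
  have b5 := c3 5
  have g0 := c4 0
  have g1 := c4 1
  have g2 := c4 2
  have g3 := c4 3
  have g4 := c4 4
  have g5 := c4 5
  simp [normalForm] at a0 a1 a2 a3 a4 a5 b0 b1 b2 b3 b4 b5 g0 g1 g2 g3 g4 g5
  have x0 : X 0 1 = 0 := mul_left_cancel₀ hD (by linear_combination -lam * a0 - m * b0)
  have x5 : X 5 1 = 0 := mul_left_cancel₀ hD (by linear_combination lam * a5 + m * b5)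
  have x1 : X 1 1 = 0 := mul_left_cancel₀ hD1 (by linear_combination τ₁ * a2 + m * b1)
  have x2 : X 2 1 = 0 := mul_left_cancel₀ hD1 (by linear_combination -τ₁ * a1 - m * b2)
  have x3 : X 3 1 = 0 := mul_left_cancel₀ hD2 (by linear_combination τ₂ * a4 + m * b3)
  have x4 : X 4 1 = 0 := mul_left_cancel₀ hD2 (by linear_combination -τ₂ * a3 - m * b4)
  simp [x0, x1, x2, x3, x4, x5, hm] at a0 a1 a2 a3 a4 a5
  simp [hl, h1, h2] at g0 g1 g2 g3 g4 g5
  ext i j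
  fin_cases j
  · exact h0 i
  · fin_cases i
    exacts [x0, x1, x2, x3, x4, x5]
  · exact c2 i
  · fin_cases i
    exacts [a0, a1, a2, a3, a4, a5]
  · fin_cases i
    exacts [g0, g2, g1, g4, g3, g5]
  · exact c5 i

end Algebra

/-! ### Orthogonality and orientation of the explicit frame -/

section Gram

variable {lam τ₁ τ₂ a m d c : ℝ}

/-- This says that Θ belongs to the Lie algebra, in the form used to multiply from the right by S.
-/
lemma thetaValue_mul_lorentzS :
    thetaValue a m d c * lorentzS = -(lorentzS * (thetaValue a m d c)ᵀ) := by
  ext i j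
  rw [Matrix.neg_apply, Matrix.mul_apply, Matrix.mul_apply, Fin.sum_univ_six, Fin.sum_univ_six]
  fin_cases i <;> fin_cases j <;> simp [thetaValue, lorentzS]
  ring

/-- Symmetric matrices that anticommute with the normal form. -/
lemma eq_of_normalForm_mul (hl : 0 < lam) (h1 : 0 < τ₁) (h12 : τ₁ < τ₂) {K : M6} (hK : Kᵀ = K)
    (hN : normalForm lam τ₁ τ₂ * K + K * (normalForm lam τ₁ τ₂)ᵀ = 0) (k05 : K 0 5 = -1)
    (k12 : K 1 1 + K 2 2 = 2) (k34 : K 3 3 + K 4 4 = 2) : K = lorentzS := by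
  have hs : ∀ i j, K j i = K i j := fun i j => congrFun (congrFun hK i) j
  have h2 : 0 < τ₂ := h1.trans h12
  have hq : τ₂ ^ 2 - τ₁ ^ 2 ≠ 0 := by nlinarith
  have hp : lam ^ 2 + τ₁ ^ 2 ≠ 0 := by positivity
  have hp' : lam ^ 2 + τ₂ ^ 2 ≠ 0 := by positivity
  have hE : ∀ i j, ∑ k, normalForm lam τ₁ τ₂ i k * K k j +
      ∑ k, K i k * normalForm lam τ₁ τ₂ j k = 0 := fun i j => by
    have := congrFun (congrFun hN i) j
    simpa [Matrix.mul_apply] using this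
  simp only [Fin.sum_univ_six] at hE
  have e00 := hE 0 0
  have e01 := hE 0 1
  have e02 := hE 0 2
  have e03 := hE 0 3
  have e04 := hE 0 4
  have e11 := hE 1 1
  have e12 := hE 1 2
  have e13 := hE 1 3
  have e14 := hE 1 4
  have e15 := hE 1 5
  have e23 := hE 2 3
  have e24 := hE 2 4
  have e25 := hE 2 5
  have e33 := hE 3 3
  have e34 := hE 3 4
  have e35 := hE 3 5
  have e45 := hE 4 5
  have e55 := hE 5 5
  simp [normalForm] at e00 e01 e02 e03 e04 e11 e12 e13 e14 e15 e23 e24 e25 e33 e34 e35 e45 e55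
  rw [hs 1 2] at e11
  rw [hs 3 4] at e33
  have z00 : K 0 0 = 0 := mul_left_cancel₀ hl.ne' (by linarith)
  have z55 : K 5 5 = 0 := mul_left_cancel₀ hl.ne' (by linarith)
  -- The entries of K that join two different blocks satisfy homogeneous linear systems. Eliminating
  -- leaves the factors λ² + τᵢ² or τ₂² - τ₁², which are not zero.
  have z01 : K 0 1 = 0 := mul_left_cancel₀ hp (by linear_combination lam * e01 + τ₁ * e02)
  have z02 : K 0 2 = 0 := mul_left_cancel₀ hp (by linear_combination lam * e02 - τ₁ * e01)
  have z03 : K 0 3 = 0 := mul_left_cancel₀ hp' (by linear_combination lam * e03 + τ₂ * e04)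
  have z04 : K 0 4 = 0 := mul_left_cancel₀ hp' (by linear_combination lam * e04 - τ₂ * e03)
  have z15 : K 1 5 = 0 := mul_left_cancel₀ hp (by linear_combination -lam * e15 + τ₁ * e25)
  have z25 : K 2 5 = 0 := mul_left_cancel₀ hp (by linear_combination -lam * e25 - τ₁ * e15)
  have z35 : K 3 5 = 0 := mul_left_cancel₀ hp' (by linear_combination -lam * e35 + τ₂ * e45)
  have z45 : K 4 5 = 0 := mul_left_cancel₀ hp' (by linear_combination -lam * e45 - τ₂ * e35)
  have z12 : K 1 2 = 0 := mul_left_cancel₀ h1.ne' (by linarith)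
  have z34 : K 3 4 = 0 := mul_left_cancel₀ h2.ne' (by linarith)
  have z13 : K 1 3 = 0 := mul_left_cancel₀ hq (by linear_combination τ₂ * e14 - τ₁ * e23)
  have z24 : K 2 4 = 0 := mul_left_cancel₀ hq (by linear_combination -τ₂ * e23 + τ₁ * e14)
  have z14 : K 1 4 = 0 := mul_left_cancel₀ hq (by linear_combination -τ₂ * e13 - τ₁ * e24)
  have z23 : K 2 3 = 0 := mul_left_cancel₀ hq (by linear_combination τ₂ * e24 + τ₁ * e13)
  have z11 : K 1 1 = K 2 2 := mul_left_cancel₀ h1.ne' (by linarith)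
  have z33 : K 3 3 = K 4 4 := mul_left_cancel₀ h2.ne' (by linarith)
  ext i j
  fin_cases i <;> fin_cases j <;> simp [lorentzS] <;>
    first
      | assumption
      | (rw [hs]; assumption)
      | linarith

/-- The squared norm of an eigenvector of `Θ` in terms of the characteristic polynomial. -/
lemma theta_eigenvector_norm {x : ℝ} (hx : x ≠ 0) (hD : m ^ 2 + x ≠ 0)
    (h : thetaChi a m d c x = 0) :
    (-2 * (x + a + m ^ 2) - x + (m ^ 2 - x) * (1 + d ^ 2) / (m ^ 2 + x) ^ 2 - m ^ 2 * c ^ 2 / x) *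
      (m ^ 2 + x) = -2 * (3 * x ^ 2 + 2 * (2 * a + 3 * m ^ 2) * x -
        (1 + d ^ 2 - 2 * m ^ 4 - 2 * a * m ^ 2 + m ^ 2 * c ^ 2)) := by
  simp only [thetaChi] at h
  linear_combination (norm := (field_simp; ring)) ((3 * x + m ^ 2) / (x * (m ^ 2 + x))) * h

/-- The derivative of the characteristic cubic at its root A. Evaluation at 0, 1 and -1 suffices to
compare the coefficients. -/
lemma thetaChi_deriv_eq {A B C : ℝ} (h : ∀ x, thetaChi a m d c x = (x - A) * (x - B) * (x - C)) :
    3 * A ^ 2 + 2 * (2 * a + 3 * m ^ 2) * A -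
        (1 + d ^ 2 - 2 * m ^ 4 - 2 * a * m ^ 2 + m ^ 2 * c ^ 2) = (A - B) * (A - C) := by
  have h0 := h 0
  have h1 := h 1
  have h2 := h (-1)
  simp only [thetaChi] at h0 h1 h2
  linear_combination (A + 1 / 2) * h1 + (A - 1 / 2) * h2 - 2 * A * h0

/-- The explicit frame is orthonormal as soon as its first column is correctly normalized. -/
lemma explicitFrame_lorentz (hl : 0 < lam) (h1 : 0 < τ₁) (h12 : τ₁ < τ₂)
    (hD1 : τ₁ ^ 2 < m ^ 2) (hD2 : m ^ 2 < τ₂ ^ 2)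
    (h : ∀ x, thetaChi a m d c x = (x - lam ^ 2) * (x + τ₁ ^ 2) * (x + τ₂ ^ 2)) {v : V6}
    (hv : v 0 * v 5 = (m ^ 2 + lam ^ 2) / (2 * (lam ^ 2 + τ₁ ^ 2) * (lam ^ 2 + τ₂ ^ 2)))
    (hv1 : v 1 ^ 2 + v 2 ^ 2 = (m ^ 2 - τ₁ ^ 2) / ((τ₂ ^ 2 - τ₁ ^ 2) * (lam ^ 2 + τ₁ ^ 2)))
    (hv2 : v 3 ^ 2 + v 4 ^ 2 = (τ₂ ^ 2 - m ^ 2) / ((τ₂ ^ 2 - τ₁ ^ 2) * (lam ^ 2 + τ₂ ^ 2))) :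
    (explicitFrame lam τ₁ τ₂ a m d c v)ᵀ * lorentzS * explicitFrame lam τ₁ τ₂ a m d c v =
      lorentzS := by
  have h2 : 0 < τ₂ := h1.trans h12
  have n0 : m ^ 2 + lam ^ 2 ≠ 0 := by positivity
  have n1 : m ^ 2 - τ₁ ^ 2 ≠ 0 := by linarith
  have n2 : m ^ 2 - τ₂ ^ 2 ≠ 0 := by linarith
  have q1 : lam ^ 2 + τ₁ ^ 2 ≠ 0 := by positivity
  have q2 : lam ^ 2 + τ₂ ^ 2 ≠ 0 := by positivity
  have q3 : τ₂ ^ 2 - τ₁ ^ 2 ≠ 0 := by nlinarith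
  have cl : thetaChi a m d c (lam ^ 2) = 0 := by rw [h]; ring
  have c1 : thetaChi a m d c (-τ₁ ^ 2) = 0 := by rw [h]; ring
  have c2 : thetaChi a m d c (-τ₂ ^ 2) = 0 := by rw [h]; ring
  have hT := explicitFrame_mul_theta hl.ne' h1.ne' h2.ne' n0 n1 n2 cl c1 c2 v
  have bl := theta_eigenvector_norm (by positivity) n0 cl
  have b1 := theta_eigenvector_norm (x := -τ₁ ^ 2) (by simpa using h1.ne') (by linarith) c1
  have b2 := theta_eigenvector_norm (x := -τ₂ ^ 2) (by simpa using h2.ne') (by linarith) c2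
  rw [thetaChi_deriv_eq (A := lam ^ 2) (B := -τ₁ ^ 2) (C := -τ₂ ^ 2)
    (fun x => by rw [h]; ring)] at bl
  rw [thetaChi_deriv_eq (A := -τ₁ ^ 2) (B := lam ^ 2) (C := -τ₂ ^ 2)
    (fun x => by rw [h]; ring), ← sub_eq_add_neg] at b1
  rw [thetaChi_deriv_eq (A := -τ₂ ^ 2) (B := lam ^ 2) (C := -τ₁ ^ 2)
    (fun x => by rw [h]; ring), ← sub_eq_add_neg] at b2
  set E := explicitFrame lam τ₁ τ₂ a m d c v with hE
  set N := normalForm lam τ₁ τ₂ with hN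
  -- K = E S ᵗE is symmetric, and EΘ = NE with Θ in the Lie algebra gives NK + KᵗN = 0. This leaves
  -- only the norms of the eigenvectors free, and these are fixed by the normalization of v.
  have hK : E * lorentzS * Eᵀ = lorentzS := by
    refine eq_of_normalForm_mul hl h1 h12 ?_ ?_ ?_ ?_ ?_
    · simp [Matrix.transpose_mul, mul_assoc, lorentzS_transpose]
    · have : N * (E * lorentzS * Eᵀ) = E * (thetaValue a m d c * lorentzS) * Eᵀ := by
        simp only [← mul_assoc]; rw [hT]
      rw [this, thetaValue_mul_lorentzS]
      have : E * lorentzS * Eᵀ * Nᵀ = E * lorentzS * (N * E)ᵀ := by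
        rw [Matrix.transpose_mul, mul_assoc]
      rw [this, ← hT, Matrix.transpose_mul]
      simp [mul_assoc]
    · have : (E * lorentzS * Eᵀ) 0 5 = v 0 * v 5 * (-2 * (lam ^ 2 + a + m ^ 2) - lam ^ 2 +
          (m ^ 2 - lam ^ 2) * (1 + d ^ 2) / (m ^ 2 + lam ^ 2) ^ 2 -
          m ^ 2 * c ^ 2 / lam ^ 2) := by
        simp [Matrix.mul_apply, Fin.sum_univ_six, hE, explicitFrame, lorentzS]
        field_simp
        ring
      rw [this, hv, div_mul_eq_mul_div, mul_comm (m ^ 2 + lam ^ 2), bl]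
      field_simp
      ring
    · have : (E * lorentzS * Eᵀ) 1 1 + (E * lorentzS * Eᵀ) 2 2 = (v 1 ^ 2 + v 2 ^ 2) *
          (-2 * (-τ₁ ^ 2 + a + m ^ 2) - -τ₁ ^ 2 +
          (m ^ 2 - -τ₁ ^ 2) * (1 + d ^ 2) / (m ^ 2 - τ₁ ^ 2) ^ 2 -
          m ^ 2 * c ^ 2 / -τ₁ ^ 2) := by
        simp [Matrix.mul_apply, Fin.sum_univ_six, hE, explicitFrame, lorentzS]
        field_simp
        ring
      rw [this, hv1, div_mul_eq_mul_div, mul_comm (m ^ 2 - τ₁ ^ 2), b1]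
      field_simp
      ring
    · have : (E * lorentzS * Eᵀ) 3 3 + (E * lorentzS * Eᵀ) 4 4 = (v 3 ^ 2 + v 4 ^ 2) *
          (-2 * (-τ₂ ^ 2 + a + m ^ 2) - -τ₂ ^ 2 +
          (m ^ 2 - -τ₂ ^ 2) * (1 + d ^ 2) / (m ^ 2 - τ₂ ^ 2) ^ 2 -
          m ^ 2 * c ^ 2 / -τ₂ ^ 2) := by
        simp [Matrix.mul_apply, Fin.sum_univ_six, hE, explicitFrame, lorentzS]
        field_simp
        ring
      rw [this, hv2, div_mul_eq_mul_div, ← neg_sub (m ^ 2) (τ₂ ^ 2), neg_mul,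
        mul_comm (m ^ 2 - τ₂ ^ 2), b2]
      field_simp
      ring
  have h3 : E * (lorentzS * Eᵀ * lorentzS) = 1 := by
    rw [← mul_assoc, ← mul_assoc, hK, lorentzS_mul_self]
  have h4 := mul_eq_one_comm.1 h3
  calc Eᵀ * lorentzS * E = lorentzS * (lorentzS * Eᵀ * lorentzS * E) := by
        simp only [← mul_assoc]; rw [lorentzS_mul_self, one_mul]
    _ = lorentzS := by rw [h4, mul_one]

end Gram

section Det

variable {lam τ₁ τ₂ a m d c : ℝ}

/-- The components of a vector in the real eigenspaces of the normal form. -/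
def krylovBlocks (lam τ₁ τ₂ : ℝ) (w : V6) : M6 :=
  !![w 0, 0, 0, lam * w 0, 0, 0;
     0, w 1, 0, 0, -(τ₁ * w 2), 0;
     0, w 2, 0, 0, τ₁ * w 1, 0;
     0, 0, w 3, 0, 0, -(τ₂ * w 4);
     0, 0, w 4, 0, 0, τ₂ * w 3;
     w 5, 0, 0, -(lam * w 5), 0, 0]

/-- The values of the even and of the odd monomials at the eigenvalues. -/
def parityVandermonde (x y z : ℝ) : M6 :=
  !![1, 0, x, 0, x ^ 2, 0;
     1, 0, y, 0, y ^ 2, 0;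
     1, 0, z, 0, z ^ 2, 0;
     0, 1, 0, x, 0, x ^ 2;
     0, 1, 0, y, 0, y ^ 2;
     0, 1, 0, z, 0, z ^ 2]

/-- The columns of the explicit frame as polynomials in the normal form. -/
def krylovCoeffs (a m d c : ℝ) : M6 :=
  !![0, 0, 0, 0, m ^ 3 * c, 0;
     m ^ 2, m * d, 0, -m, 0, (a + m ^ 2) * m ^ 2;
     0, 1, m ^ 2, d, m * c, 0;
     1, 0, 0, 0, 0, a + 2 * m ^ 2;
     0, 0, 1, 0, 0, 0;
     0, 0, 0, 0, 0, 1]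

lemma det_krylovBlocks (w : V6) : (krylovBlocks lam τ₁ τ₂ w).det =
    2 * lam * τ₁ * τ₂ * (w 0 * w 5) * (w 1 ^ 2 + w 2 ^ 2) * (w 3 ^ 2 + w 4 ^ 2) := by
  simp [krylovBlocks, Matrix.det_succ_row_zero, Fin.sum_univ_succ, Fin.succAbove]
  ring

lemma det_parityVandermonde (x y z : ℝ) : (parityVandermonde x y z).det =
    -((y - x) * (z - x) * (z - y)) ^ 2 := by
  simp [parityVandermonde, Matrix.det_succ_row_zero, Fin.sum_univ_succ, Fin.succAbove]
  ring

lemma det_krylovCoeffs : (krylovCoeffs a m d c).det = -(m ^ 4 * c * (1 + d ^ 2)) := by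
  simp [krylovCoeffs, Matrix.det_succ_row_zero, Fin.sum_univ_succ, Fin.succAbove]
  ring

/-- With v = N(m² + N²)w the denominators disappear, and every column of the frame is a polynomial
in the normal form N applied to w. Its coefficients on N⁰, ..., N⁵ are a column of `krylovCoeffs`;
the other two factors apply the powers of N to w, split by parity. The determinant thereby becomes a
product. -/
lemma explicitFrame_eq_mul (hl : lam ≠ 0) (h1 : τ₁ ≠ 0) (h2 : τ₂ ≠ 0)
    (hD : m ^ 2 + lam ^ 2 ≠ 0) (hD1 : m ^ 2 - τ₁ ^ 2 ≠ 0) (hD2 : m ^ 2 - τ₂ ^ 2 ≠ 0) (w : V6) :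
    explicitFrame lam τ₁ τ₂ a m d c
      ![lam * (m ^ 2 + lam ^ 2) * w 0, -(τ₁ * (m ^ 2 - τ₁ ^ 2) * w 2),
        τ₁ * (m ^ 2 - τ₁ ^ 2) * w 1, -(τ₂ * (m ^ 2 - τ₂ ^ 2) * w 4),
        τ₂ * (m ^ 2 - τ₂ ^ 2) * w 3, -(lam * (m ^ 2 + lam ^ 2) * w 5)] =
      krylovBlocks lam τ₁ τ₂ w *
        (parityVandermonde (lam ^ 2) (-τ₁ ^ 2) (-τ₂ ^ 2) * krylovCoeffs a m d c) := by
  ext i j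
  rw [Matrix.mul_apply, Fin.sum_univ_six]
  simp only [Matrix.mul_apply, Fin.sum_univ_six]
  fin_cases i <;> fin_cases j <;>
    simp [explicitFrame, krylovBlocks, parityVandermonde, krylovCoeffs] <;> field_simp <;> ring

/-- The orientation of the explicit frame is opposite to the sign of the third curvature. -/
lemma mul_det_explicitFrame_neg (hl : 0 < lam) (h1 : 0 < τ₁) (h12 : τ₁ < τ₂) (hm : m ≠ 0)
    (hD1 : τ₁ ^ 2 < m ^ 2) (hD2 : m ^ 2 < τ₂ ^ 2) (hc : c ≠ 0) {v : V6} (hv : 0 < v 0 * v 5)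
    (hv1 : 0 < v 1 ^ 2 + v 2 ^ 2) (hv2 : 0 < v 3 ^ 2 + v 4 ^ 2) :
    c * (explicitFrame lam τ₁ τ₂ a m d c v).det < 0 := by
  have h2 : 0 < τ₂ := h1.trans h12
  have n0 : m ^ 2 + lam ^ 2 ≠ 0 := by positivity
  have n1 : m ^ 2 - τ₁ ^ 2 ≠ 0 := by linarith
  have n2 : m ^ 2 - τ₂ ^ 2 ≠ 0 := by linarith
  -- The vector w solves N(m² + N²)w = v. N has eigenvalues λ and -λ on coordinates 0 and 5, so w⁰w⁵
  -- is negative; this is the sign that survives in the determinant.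
  set w : V6 := ![v 0 / (lam * (m ^ 2 + lam ^ 2)), v 2 / (τ₁ * (m ^ 2 - τ₁ ^ 2)),
    -(v 1 / (τ₁ * (m ^ 2 - τ₁ ^ 2))), v 4 / (τ₂ * (m ^ 2 - τ₂ ^ 2)),
    -(v 3 / (τ₂ * (m ^ 2 - τ₂ ^ 2))), -(v 5 / (lam * (m ^ 2 + lam ^ 2)))] with hw
  have hvw : v = ![lam * (m ^ 2 + lam ^ 2) * w 0, -(τ₁ * (m ^ 2 - τ₁ ^ 2) * w 2),
        τ₁ * (m ^ 2 - τ₁ ^ 2) * w 1, -(τ₂ * (m ^ 2 - τ₂ ^ 2) * w 4),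
        τ₂ * (m ^ 2 - τ₂ ^ 2) * w 3, -(lam * (m ^ 2 + lam ^ 2) * w 5)] := by
    ext i
    fin_cases i <;> simp [hw] <;> field_simp
  rw [hvw, explicitFrame_eq_mul hl.ne' h1.ne' h2.ne' n0 n1 n2, Matrix.det_mul, Matrix.det_mul,
    det_krylovBlocks, det_parityVandermonde, det_krylovCoeffs]
  have w05 : w 0 * w 5 = -(v 0 * v 5 / (lam * (m ^ 2 + lam ^ 2)) ^ 2) := by
    simp [hw]; field_simp
  have w12 : w 1 ^ 2 + w 2 ^ 2 = (v 1 ^ 2 + v 2 ^ 2) / (τ₁ * (m ^ 2 - τ₁ ^ 2)) ^ 2 := by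
    simp [hw]; field_simp; ring
  have w34 : w 3 ^ 2 + w 4 ^ 2 = (v 3 ^ 2 + v 4 ^ 2) / (τ₂ * (m ^ 2 - τ₂ ^ 2)) ^ 2 := by
    simp [hw]; field_simp; ring
  rw [w05, w12, w34]
  have p0 : 0 < v 0 * v 5 / (lam * (m ^ 2 + lam ^ 2)) ^ 2 := by positivity
  have p1 : 0 < (v 1 ^ 2 + v 2 ^ 2) / (τ₁ * (m ^ 2 - τ₁ ^ 2)) ^ 2 := by positivity
  have p2 : 0 < (v 3 ^ 2 + v 4 ^ 2) / (τ₂ * (m ^ 2 - τ₂ ^ 2)) ^ 2 := by positivity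
  generalize v 0 * v 5 / (lam * (m ^ 2 + lam ^ 2)) ^ 2 = A at p0
  generalize (v 1 ^ 2 + v 2 ^ 2) / (τ₁ * (m ^ 2 - τ₁ ^ 2)) ^ 2 = B at p1
  generalize (v 3 ^ 2 + v 4 ^ 2) / (τ₂ * (m ^ 2 - τ₂ ^ 2)) ^ 2 = C at p2
  have q1 : -τ₁ ^ 2 - lam ^ 2 ≠ 0 := by nlinarith
  have q2 : -τ₂ ^ 2 - lam ^ 2 ≠ 0 := by nlinarith
  have q3 : -τ₂ ^ 2 - -τ₁ ^ 2 ≠ 0 := by nlinarith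
  have hV : 0 < ((-τ₁ ^ 2 - lam ^ 2) * (-τ₂ ^ 2 - lam ^ 2) * (-τ₂ ^ 2 - -τ₁ ^ 2)) ^ 2 := by
    positivity
  generalize ((-τ₁ ^ 2 - lam ^ 2) * (-τ₂ ^ 2 - lam ^ 2) * (-τ₂ ^ 2 - -τ₁ ^ 2)) ^ 2 = X at hV
  have : 0 < 2 * lam * τ₁ * τ₂ * A * B * C * X * (m ^ 4 * c ^ 2 * (1 + d ^ 2)) := by positivity
  linarith

end Det

/-! ### The explicit curve -/

section ExplicitCurve

lemma hasDerivAt_integral_of_mem {I : Set ℝ} (hI : IsOpen I) (hIc : I.OrdConnected) {g : ℝ → ℝ}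
    (hg : ContinuousOn g I) {s₀ s : ℝ} (hs₀ : s₀ ∈ I) (hs : s ∈ I) :
    HasDerivAt (fun u => ∫ t in s₀..u, g t) (g s) s := by
  refine intervalIntegral.integral_hasDerivAt_right
    (hg.mono (hIc.uIcc_subset hs₀ hs)).intervalIntegrable ?_ (hg.continuousAt (hI.mem_nhds hs))
  exact hg.stronglyMeasurableAtFilter hI s hs

lemma contDiffOn_integral {I : Set ℝ} (hI : IsOpen I) (hIc : I.OrdConnected) {g : ℝ → ℝ}
    (hg : ContDiffOn ℝ ∞ g I) {s₀ : ℝ} (hs₀ : s₀ ∈ I) :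
    ContDiffOn ℝ ∞ (fun u => ∫ t in s₀..u, g t) I := by
  have hd := fun s (hs : s ∈ I) => hasDerivAt_integral_of_mem hI hIc hg.continuousOn hs₀ hs
  rw [contDiffOn_infty_iff_deriv_of_isOpen hI]
  exact ⟨fun s hs => (hd s hs).differentiableAt.differentiableWithinAt,
    hg.congr fun s hs => (hd s hs).deriv⟩

variable {I : Set ℝ} {lam τ₁ τ₂ s₀ : ℝ} {μ₂ : ℝ → ℝ}

lemma contDiffOn_explicitCurve (hI : IsOpen I) (hIc : I.OrdConnected) (hl : 0 < lam)
    (hμ : ContDiffOn ℝ ∞ μ₂ I) (hlt : ∀ s ∈ I, τ₁ ^ 2 < μ₂ s ^ 2 ∧ μ₂ s ^ 2 < τ₂ ^ 2)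
    (hs₀ : s₀ ∈ I) : ContDiffOn ℝ ∞ (explicitCurve lam τ₁ τ₂ μ₂ s₀) I := by
  have n0 : ∀ s ∈ I, μ₂ s ^ 2 + lam ^ 2 ≠ 0 := fun s _ => by positivity
  have n1 : ∀ s ∈ I, μ₂ s ^ 2 - τ₁ ^ 2 ≠ 0 := fun s hs => by linarith [(hlt s hs).1]
  have n1' : ∀ s ∈ I, τ₁ ^ 2 - μ₂ s ^ 2 ≠ 0 := fun s hs => by linarith [(hlt s hs).1]
  have n2 : ∀ s ∈ I, τ₂ ^ 2 - μ₂ s ^ 2 ≠ 0 := fun s hs => by linarith [(hlt s hs).2]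
  have i0 : ContDiffOn ℝ ∞ (fun s => lam * ∫ t in s₀..s, 1 / (μ₂ t ^ 2 + lam ^ 2)) I :=
    contDiffOn_const.mul (contDiffOn_integral hI hIc
      (contDiffOn_const.div ((hμ.pow 2).add contDiffOn_const) n0) hs₀)
  have i1 : ContDiffOn ℝ ∞ (fun s => τ₁ * ∫ t in s₀..s, 1 / (τ₁ ^ 2 - μ₂ t ^ 2)) I :=
    contDiffOn_const.mul (contDiffOn_integral hI hIc
      (contDiffOn_const.div (contDiffOn_const.sub (hμ.pow 2)) n1') hs₀)
  have i2 : ContDiffOn ℝ ∞ (fun s => τ₂ * ∫ t in s₀..s, 1 / (τ₂ ^ 2 - μ₂ t ^ 2)) I :=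
    contDiffOn_const.mul (contDiffOn_integral hI hIc
      (contDiffOn_const.div (contDiffOn_const.sub (hμ.pow 2)) n2) hs₀)
  have r0 : ContDiffOn ℝ ∞ (fun s => √(μ₂ s ^ 2 + lam ^ 2)) I :=
    ((hμ.pow 2).add contDiffOn_const).sqrt n0
  have r1 : ContDiffOn ℝ ∞ (fun s => √(μ₂ s ^ 2 - τ₁ ^ 2)) I :=
    ((hμ.pow 2).sub contDiffOn_const).sqrt n1
  have r2 : ContDiffOn ℝ ∞ (fun s => √(τ₂ ^ 2 - μ₂ s ^ 2)) I :=
    (contDiffOn_const.sub (hμ.pow 2)).sqrt n2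
  rw [contDiffOn_pi]
  intro i
  fin_cases i
  · exact (contDiffOn_const.mul r0).mul i0.exp
  · exact (contDiffOn_const.mul r1).mul i1.sin
  · exact (contDiffOn_const.mul r1).mul i1.cos
  · exact (contDiffOn_const.mul r2).mul i2.sin
  · exact (contDiffOn_const.mul r2).mul i2.cos
  · exact (contDiffOn_const.mul r0).mul i0.neg.exp

/-- The defining property of the explicit curve: its derivative is column 1 of the explicit frame
built on it. That column does not involve a and c, which are therefore arbitrary. -/
lemma hasDerivAt_explicitCurve (hI : IsOpen I) (hIc : I.OrdConnected) (hl : 0 < lam)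
    (hμ : ContDiffOn ℝ ∞ μ₂ I) (hlt : ∀ s ∈ I, τ₁ ^ 2 < μ₂ s ^ 2 ∧ μ₂ s ^ 2 < τ₂ ^ 2)
    (hs₀ : s₀ ∈ I) {s : ℝ} (hs : s ∈ I) (a c : ℝ) (i : Fin 6) :
    HasDerivAt (fun u => explicitCurve lam τ₁ τ₂ μ₂ s₀ u i)
      (explicitFrame lam τ₁ τ₂ a (μ₂ s) (deriv μ₂ s) c (explicitCurve lam τ₁ τ₂ μ₂ s₀ s) i 1) s := by
  have n0 : ∀ s ∈ I, μ₂ s ^ 2 + lam ^ 2 ≠ 0 := fun s _ => by positivity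
  have n1 : ∀ s ∈ I, τ₁ ^ 2 - μ₂ s ^ 2 ≠ 0 := fun s hs => by linarith [(hlt s hs).1]
  have n2 : ∀ s ∈ I, τ₂ ^ 2 - μ₂ s ^ 2 ≠ 0 := fun s hs => by linarith [(hlt s hs).2]
  have hp : HasDerivAt (fun u => μ₂ u ^ 2) (2 * μ₂ s * deriv μ₂ s) s := by
    simpa using (hasDerivAt_of_contDiffOn hμ hI hs).fun_pow 2
  have i0 := (hasDerivAt_integral_of_mem hI hIc (g := fun t => 1 / (μ₂ t ^ 2 + lam ^ 2))
    (contDiffOn_const.div ((hμ.pow 2).add contDiffOn_const) n0).continuousOn hs₀ hs).const_mul lam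
  have i1 := (hasDerivAt_integral_of_mem hI hIc (g := fun t => 1 / (τ₁ ^ 2 - μ₂ t ^ 2))
    (contDiffOn_const.div (contDiffOn_const.sub (hμ.pow 2)) n1).continuousOn hs₀ hs).const_mul τ₁
  have i2 := (hasDerivAt_integral_of_mem hI hIc (g := fun t => 1 / (τ₂ ^ 2 - μ₂ t ^ 2))
    (contDiffOn_const.div (contDiffOn_const.sub (hμ.pow 2)) n2).continuousOn hs₀ hs).const_mul τ₂
  have p0 : 0 < μ₂ s ^ 2 + lam ^ 2 := by positivity
  have p1 : 0 < μ₂ s ^ 2 - τ₁ ^ 2 := by linarith [(hlt s hs).1]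
  have p2 : 0 < τ₂ ^ 2 - μ₂ s ^ 2 := by linarith [(hlt s hs).2]
  have r0 := (hp.add_const (lam ^ 2)).sqrt p0.ne'
  have r1 := (hp.sub_const (τ₁ ^ 2)).sqrt p1.ne'
  have r2 := (hp.const_sub (τ₂ ^ 2)).sqrt p2.ne'
  have n1s := n1 s hs
  -- Product rule for an amplitude A√P times an exponential or trigonometric factor x with
  -- derivative z; over the common denominator P it has the shape of column 1.
  have key : ∀ P A P' x z : ℝ, 0 < P →
      A * (P' / (2 * √P)) * x + A * √P * z = (P' / 2 * (A * √P * x) + A * √P * (P * z)) / P := by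
    intro P A P' x z hP
    have h1 := Real.sqrt_pos.2 hP
    rw [← Real.sq_sqrt hP.le, Real.sqrt_sq h1.le]
    field_simp
  -- The amplitude and the integrand of the τ₁ block contain opposite differences, hence the sign
  -- here and not in the τ₂ block.
  have e1 : (μ₂ s ^ 2 - τ₁ ^ 2) * (τ₁ * (1 / (τ₁ ^ 2 - μ₂ s ^ 2))) = -τ₁ := by
    field_simp; ring
  have e2 : (τ₂ ^ 2 - μ₂ s ^ 2) * (τ₂ * (1 / (τ₂ ^ 2 - μ₂ s ^ 2))) = τ₂ := by
    field_simp
  have e0 : (μ₂ s ^ 2 + lam ^ 2) * (lam * (1 / (μ₂ s ^ 2 + lam ^ 2))) = lam := by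
    field_simp
  have f2 : ∀ x : ℝ, x / (τ₂ ^ 2 - μ₂ s ^ 2) = -x / (μ₂ s ^ 2 - τ₂ ^ 2) := by
    intro x; rw [← neg_sub (μ₂ s ^ 2), div_neg, neg_div]
  fin_cases i
  · refine ((r0.const_mul _).mul i0.exp).congr_deriv ?_
    refine (key _ _ _ _ _ p0).trans (congrArg (· / _) ?_)
    rw [mul_left_comm (μ₂ s ^ 2 + lam ^ 2), e0]
    simp only [explicitCurve, Matrix.cons_val]
    ring
  · refine ((r1.const_mul _).mul i1.sin).congr_deriv ?_
    refine (key _ _ _ _ _ p1).trans (congrArg (· / _) ?_)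
    rw [mul_left_comm (μ₂ s ^ 2 - τ₁ ^ 2), e1]
    simp only [explicitCurve, Matrix.cons_val]
    ring
  · refine ((r1.const_mul _).mul i1.cos).congr_deriv ?_
    refine (key _ _ _ _ _ p1).trans (congrArg (· / _) ?_)
    rw [mul_left_comm (μ₂ s ^ 2 - τ₁ ^ 2), e1]
    simp only [explicitCurve, Matrix.cons_val]
    ring
  · refine ((r2.const_mul _).mul i2.sin).congr_deriv ?_
    refine (key _ _ _ _ _ p2).trans ((f2 _).trans (congrArg (· / _) ?_))
    rw [mul_left_comm (τ₂ ^ 2 - μ₂ s ^ 2), e2]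
    simp only [explicitCurve, Matrix.cons_val]
    ring
  · refine ((r2.const_mul _).mul i2.cos).congr_deriv ?_
    refine (key _ _ _ _ _ p2).trans ((f2 _).trans (congrArg (· / _) ?_))
    rw [mul_left_comm (τ₂ ^ 2 - μ₂ s ^ 2), e2]
    simp only [explicitCurve, Matrix.cons_val]
    ring
  · refine ((r0.const_mul _).mul i0.fun_neg.exp).congr_deriv ?_
    refine (key _ _ _ _ _ p0).trans (congrArg (· / _) ?_)
    rw [mul_left_comm (μ₂ s ^ 2 + lam ^ 2), mul_neg (μ₂ s ^ 2 + lam ^ 2), e0]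
    simp only [explicitCurve, Matrix.cons_val]
    ring

/-- The explicit homogeneous coordinates, normalized so that they are the first column of a Frenet
frame. -/
def explicitLift (lam τ₁ τ₂ : ℝ) (μ₂ : ℝ → ℝ) (s₀ s : ℝ) : V6 :=
  (√((τ₂ ^ 2 - τ₁ ^ 2) * (lam ^ 2 + τ₁ ^ 2) * (lam ^ 2 + τ₂ ^ 2)))⁻¹ •
    explicitCurve lam τ₁ τ₂ μ₂ s₀ s

/-- The exponentials multiply to 1 and the squares of sine and cosine add to 1. The constants of the
curve are those that make these norms the ones required by `explicitFrame_lorentz`. -/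
lemma explicitLift_norm (hl : 0 < lam) (h1 : 0 < τ₁) {s : ℝ}
    (hlt : τ₁ ^ 2 < μ₂ s ^ 2 ∧ μ₂ s ^ 2 < τ₂ ^ 2) :
    let v := explicitLift lam τ₁ τ₂ μ₂ s₀ s
    v 0 * v 5 = (μ₂ s ^ 2 + lam ^ 2) / (2 * (lam ^ 2 + τ₁ ^ 2) * (lam ^ 2 + τ₂ ^ 2)) ∧
    v 1 ^ 2 + v 2 ^ 2 = (μ₂ s ^ 2 - τ₁ ^ 2) / ((τ₂ ^ 2 - τ₁ ^ 2) * (lam ^ 2 + τ₁ ^ 2)) ∧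
    v 3 ^ 2 + v 4 ^ 2 = (τ₂ ^ 2 - μ₂ s ^ 2) / ((τ₂ ^ 2 - τ₁ ^ 2) * (lam ^ 2 + τ₂ ^ 2)) ∧
    0 < v 0 + v 5 := by
  intro v
  have hq : 0 < τ₂ ^ 2 - τ₁ ^ 2 := by linarith [hlt.1, hlt.2]
  have ha : 0 < lam ^ 2 + τ₁ ^ 2 := by positivity
  have hb : 0 < lam ^ 2 + τ₂ ^ 2 := by positivity
  have p0 : 0 < μ₂ s ^ 2 + lam ^ 2 := by positivity
  have p1 : 0 < μ₂ s ^ 2 - τ₁ ^ 2 := by linarith [hlt.1]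
  have p2 : 0 < τ₂ ^ 2 - μ₂ s ^ 2 := by linarith [hlt.2]
  have hD : 0 < (τ₂ ^ 2 - τ₁ ^ 2) * (lam ^ 2 + τ₁ ^ 2) * (lam ^ 2 + τ₂ ^ 2) := by positivity
  have sD := Real.sq_sqrt hD.le
  have sDp := Real.sqrt_pos.2 hD
  have sq := Real.sq_sqrt hq.le
  have sa := Real.sq_sqrt ha.le
  have sb := Real.sq_sqrt hb.le
  have s0 := Real.sq_sqrt p0.le
  have s1 := Real.sq_sqrt p1.le
  have s2 := Real.sq_sqrt p2.le
  have st := Real.sq_sqrt (zero_le_two (α := ℝ))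
  have hE : ∀ x : ℝ, Real.exp x * Real.exp (-x) = 1 := fun x => by
    rw [← Real.exp_add, add_neg_cancel, Real.exp_zero]
  refine ⟨?_, ?_, ?_, ?_⟩
  · have h : v 0 * v 5 = √(τ₂ ^ 2 - τ₁ ^ 2) ^ 2 * √(μ₂ s ^ 2 + lam ^ 2) ^ 2 /
        (√2 ^ 2 * √((τ₂ ^ 2 - τ₁ ^ 2) * (lam ^ 2 + τ₁ ^ 2) * (lam ^ 2 + τ₂ ^ 2)) ^ 2) := by
      simp only [v, explicitLift, explicitCurve, Pi.smul_apply, smul_eq_mul, Matrix.cons_val]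
      linear_combination (norm := (field_simp; ring)) (√(τ₂ ^ 2 - τ₁ ^ 2) ^ 2 *
        √(μ₂ s ^ 2 + lam ^ 2) ^ 2 / (√2 ^ 2 *
        √((τ₂ ^ 2 - τ₁ ^ 2) * (lam ^ 2 + τ₁ ^ 2) * (lam ^ 2 + τ₂ ^ 2)) ^ 2)) *
        hE (lam * ∫ t in s₀..s, 1 / (μ₂ t ^ 2 + lam ^ 2))
    rw [h, sq, s0, st, sD]
    field_simp
  · have h : v 1 ^ 2 + v 2 ^ 2 = √(lam ^ 2 + τ₂ ^ 2) ^ 2 * √(μ₂ s ^ 2 - τ₁ ^ 2) ^ 2 /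
        √((τ₂ ^ 2 - τ₁ ^ 2) * (lam ^ 2 + τ₁ ^ 2) * (lam ^ 2 + τ₂ ^ 2)) ^ 2 := by
      simp only [v, explicitLift, explicitCurve, Pi.smul_apply, smul_eq_mul, Matrix.cons_val]
      linear_combination (norm := (field_simp; ring)) (√(lam ^ 2 + τ₂ ^ 2) ^ 2 *
        √(μ₂ s ^ 2 - τ₁ ^ 2) ^ 2 /
        √((τ₂ ^ 2 - τ₁ ^ 2) * (lam ^ 2 + τ₁ ^ 2) * (lam ^ 2 + τ₂ ^ 2)) ^ 2) *
        Real.sin_sq_add_cos_sq (τ₁ * ∫ t in s₀..s, 1 / (τ₁ ^ 2 - μ₂ t ^ 2))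
    rw [h, sb, s1, sD]
    field_simp
  · have h : v 3 ^ 2 + v 4 ^ 2 = √(lam ^ 2 + τ₁ ^ 2) ^ 2 * √(τ₂ ^ 2 - μ₂ s ^ 2) ^ 2 /
        √((τ₂ ^ 2 - τ₁ ^ 2) * (lam ^ 2 + τ₁ ^ 2) * (lam ^ 2 + τ₂ ^ 2)) ^ 2 := by
      simp only [v, explicitLift, explicitCurve, Pi.smul_apply, smul_eq_mul, Matrix.cons_val]
      linear_combination (norm := (field_simp; ring)) (√(lam ^ 2 + τ₁ ^ 2) ^ 2 *
        √(τ₂ ^ 2 - μ₂ s ^ 2) ^ 2 /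
        √((τ₂ ^ 2 - τ₁ ^ 2) * (lam ^ 2 + τ₁ ^ 2) * (lam ^ 2 + τ₂ ^ 2)) ^ 2) *
        Real.sin_sq_add_cos_sq (τ₂ * ∫ t in s₀..s, 1 / (τ₂ ^ 2 - μ₂ t ^ 2))
    rw [h, sa, s2, sD]
    field_simp
  · simp only [v, explicitLift, explicitCurve, Pi.smul_apply, smul_eq_mul, Matrix.cons_val]
    positivity

end ExplicitCurve

/-! ### The Frenet system of the explicit frame -/

/-- Solutions of the Euler-Lagrange equations with first integrals `C₁, C₂, C₃` and spectrum
`lam, τ₁, τ₂`. -/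
structure IsSpectralSolution (I : Set ℝ) (μ₁ μ₂ μ₃ : ℝ → ℝ) (C₁ C₂ C₃ lam τ₁ τ₂ : ℝ) : Prop where
  eulerLagrange : IsEulerLagrange I μ₁ μ₂ μ₃
  pos : ∀ s ∈ I, 0 < μ₂ s
  integrals : ∀ s ∈ I, μ₁ s = -(3 / 2) * μ₂ s ^ 2 + C₁ ∧ μ₃ s = C₂ / μ₂ s ^ 2 ∧
    EnergyEquation C₁ C₂ C₃ μ₂ s
  ne_zero : C₂ ≠ 0
  spectral : IsSpectralTriple C₁ C₂ C₃ lam τ₁ τ₂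
  bounds : ∀ s ∈ I, τ₁ ^ 2 < μ₂ s ^ 2 ∧ μ₂ s ^ 2 < τ₂ ^ 2

/-- The explicit frame along the explicit curve. -/
def spectralFrame (lam τ₁ τ₂ : ℝ) (μ₁ μ₂ μ₃ : ℝ → ℝ) (s₀ s : ℝ) : M6 :=
  explicitFrame lam τ₁ τ₂ (μ₁ s) (μ₂ s) (deriv μ₂ s) (μ₃ s) (explicitLift lam τ₁ τ₂ μ₂ s₀ s)

lemma explicitFrame_col_zero (lam τ₁ τ₂ a m d c : ℝ) (v : V6) (i : Fin 6) :
    explicitFrame lam τ₁ τ₂ a m d c v i 0 = v i := by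
  fin_cases i <;> rfl

lemma explicitFrame_smul (lam τ₁ τ₂ a m d c k : ℝ) (v : V6) :
    explicitFrame lam τ₁ τ₂ a m d c (k • v) = k • explicitFrame lam τ₁ τ₂ a m d c v := by
  ext i j
  fin_cases i <;> fin_cases j <;> simp [explicitFrame] <;> ring

namespace IsSpectralSolution

variable {I : Set ℝ} {μ₁ μ₂ μ₃ : ℝ → ℝ} {C₁ C₂ C₃ lam τ₁ τ₂ s₀ : ℝ}

/-- The first integrals turn the coefficients of the characteristic cubic into the constants of
P(-x) - x. -/
lemma thetaChi_eq (h : IsSpectralSolution I μ₁ μ₂ μ₃ C₁ C₂ C₃ lam τ₁ τ₂) {s : ℝ} (hs : s ∈ I) (x : ℝ) :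
    thetaChi (μ₁ s) (μ₂ s) (deriv μ₂ s) (μ₃ s) x =
      (x - lam ^ 2) * (x + τ₁ ^ 2) * (x + τ₂ ^ 2) := by
  obtain ⟨h1, h3, hE⟩ := h.integrals s hs
  have hp := (h.pos s hs).ne'
  have hC := hE.cubicP_eq (h.pos s hs)
  rw [← h.spectral.2.2.2 x]
  simp only [thetaChi, cubicP, h1, h3] at hC ⊢
  linear_combination (norm := (field_simp; ring)) (x / μ₂ s ^ 2) * hC

lemma nonzero (h : IsSpectralSolution I μ₁ μ₂ μ₃ C₁ C₂ C₃ lam τ₁ τ₂)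
    {s : ℝ} (hs : s ∈ I) : lam ≠ 0 ∧ τ₁ ≠ 0 ∧ τ₂ ≠ 0 ∧ μ₂ s ^ 2 + lam ^ 2 ≠ 0 ∧
      μ₂ s ^ 2 - τ₁ ^ 2 ≠ 0 ∧ μ₂ s ^ 2 - τ₂ ^ 2 ≠ 0 := by
  obtain ⟨hl, h1, h12, -⟩ := h.spectral
  obtain ⟨b1, b2⟩ := h.bounds s hs
  exact ⟨hl.ne', h1.ne', (h1.trans h12).ne', by positivity, by linarith, by linarith⟩

lemma spectralFrame_mul_theta (h : IsSpectralSolution I μ₁ μ₂ μ₃ C₁ C₂ C₃ lam τ₁ τ₂)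
    {s : ℝ} (hs : s ∈ I) : spectralFrame lam τ₁ τ₂ μ₁ μ₂ μ₃ s₀ s * thetaMatrix μ₁ μ₂ μ₃ s =
      normalForm lam τ₁ τ₂ * spectralFrame lam τ₁ τ₂ μ₁ μ₂ μ₃ s₀ s := by
  obtain ⟨hl, h1, h2, n0, n1, n2⟩ := h.nonzero hs
  exact explicitFrame_mul_theta hl h1 h2 n0 n1 n2 (by rw [h.thetaChi_eq hs]; ring)
    (by rw [h.thetaChi_eq hs]; ring) (by rw [h.thetaChi_eq hs]; ring) _

lemma spectralFrame_lorentz (h : IsSpectralSolution I μ₁ μ₂ μ₃ C₁ C₂ C₃ lam τ₁ τ₂)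
    {s : ℝ} (hs : s ∈ I) : (spectralFrame lam τ₁ τ₂ μ₁ μ₂ μ₃ s₀ s)ᵀ * lorentzS *
      spectralFrame lam τ₁ τ₂ μ₁ μ₂ μ₃ s₀ s = lorentzS := by
  obtain ⟨hl, h1, h12, -⟩ := h.spectral
  obtain ⟨b1, b2⟩ := h.bounds s hs
  obtain ⟨v0, v1, v2, -⟩ := explicitLift_norm (s₀ := s₀) hl h1 (h.bounds s hs)
  exact explicitFrame_lorentz hl h1 h12 b1 b2 (h.thetaChi_eq hs) v0 v1 v2

lemma mul_det_spectralFrame_neg (h : IsSpectralSolution I μ₁ μ₂ μ₃ C₁ C₂ C₃ lam τ₁ τ₂)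
    {s : ℝ} (hs : s ∈ I) : C₂ * (spectralFrame lam τ₁ τ₂ μ₁ μ₂ μ₃ s₀ s).det < 0 := by
  obtain ⟨hl, h1, h12, -⟩ := h.spectral
  obtain ⟨b1, b2⟩ := h.bounds s hs
  obtain ⟨v0, v1, v2, -⟩ := explicitLift_norm (s₀ := s₀) hl h1 (h.bounds s hs)
  have hp := h.pos s hs
  have hC := h.ne_zero
  have h3 := (h.integrals s hs).2.1
  have q1 : 0 < lam ^ 2 + τ₁ ^ 2 := by positivity
  have q2 : 0 < lam ^ 2 + τ₂ ^ 2 := by positivity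
  have q3 : 0 < τ₂ ^ 2 - τ₁ ^ 2 := by linarith
  have p1 : 0 < μ₂ s ^ 2 - τ₁ ^ 2 := by linarith
  have p2 : 0 < τ₂ ^ 2 - μ₂ s ^ 2 := by linarith
  have := mul_det_explicitFrame_neg (a := μ₁ s) (d := deriv μ₂ s) (c := μ₃ s) hl h1 h12 hp.ne'
    b1 b2 (by rw [h3]; positivity) (by rw [v0]; positivity) (by rw [v1]; positivity)
    (by rw [v2]; positivity)
  have hC3 : C₂ = μ₂ s ^ 2 * μ₃ s := by rw [h3]; field_simp
  rw [hC3, mul_assoc]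
  exact mul_neg_of_pos_of_neg (by positivity) this

lemma isConformalMotion_spectralFrame (h : IsSpectralSolution I μ₁ μ₂ μ₃ C₁ C₂ C₃ lam τ₁ τ₂)
    {s : ℝ} (hs : s ∈ I) : IsConformalMotion (spectralFrame lam τ₁ τ₂ μ₁ μ₂ μ₃ s₀ s) := by
  obtain ⟨hl, h1, h12, -⟩ := h.spectral
  have hL := h.spectralFrame_lorentz (s₀ := s₀) hs
  have hv := (explicitLift_norm (s₀ := s₀) hl h1 (h.bounds s hs)).2.2.2
  refine isConformalMotion_of_col hL ⟨?_, ?_⟩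
  · have := congrFun (congrFun hL 0) 0
    rw [lorentz_eq_transpose_mul] at this
    exact this.trans (by simp [lorentzS])
  · simpa only [spectralFrame, explicitFrame_col_zero] using hv

lemma contDiffOn_spectralFrame (h : IsSpectralSolution I μ₁ μ₂ μ₃ C₁ C₂ C₃ lam τ₁ τ₂)
    (hI : IsOpen I) (hIc : I.OrdConnected) (hs₀ : s₀ ∈ I) (i j : Fin 6) :
    ContDiffOn ℝ ∞ (fun s => spectralFrame lam τ₁ τ₂ μ₁ μ₂ μ₃ s₀ s i j) I := by
  have m1 := h.eulerLagrange.smooth₁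
  have m2 := h.eulerLagrange.smooth₂
  have m3 := h.eulerLagrange.smooth₃
  have m2' := contDiffOn_deriv m2 hI
  have hv : ContDiffOn ℝ ∞ (explicitLift lam τ₁ τ₂ μ₂ s₀) I :=
    (contDiffOn_explicitCurve hI hIc h.spectral.1 m2 h.bounds hs₀).const_smul _
  rw [contDiffOn_pi] at hv
  have n0 : ∀ s ∈ I, μ₂ s ^ 2 + lam ^ 2 ≠ 0 := fun s hs => (h.nonzero hs).2.2.2.1
  have n1 : ∀ s ∈ I, μ₂ s ^ 2 - τ₁ ^ 2 ≠ 0 := fun s hs => (h.nonzero hs).2.2.2.2.1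
  have n2 : ∀ s ∈ I, μ₂ s ^ 2 - τ₂ ^ 2 ≠ 0 := fun s hs => (h.nonzero hs).2.2.2.2.2
  have v0 := hv 0
  have v1 := hv 1
  have v2 := hv 2
  have v3 := hv 3
  have v4 := hv 4
  have v5 := hv 5
  fin_cases i <;> fin_cases j <;> simp [spectralFrame, explicitFrame] <;>
    fun_prop (disch := assumption)

lemma hasDerivAt_explicitLift (h : IsSpectralSolution I μ₁ μ₂ μ₃ C₁ C₂ C₃ lam τ₁ τ₂)
    (hI : IsOpen I) (hIc : I.OrdConnected) (hs₀ : s₀ ∈ I) {s : ℝ} (hs : s ∈ I) (i : Fin 6) :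
    HasDerivAt (fun u => explicitLift lam τ₁ τ₂ μ₂ s₀ u i)
      (spectralFrame lam τ₁ τ₂ μ₁ μ₂ μ₃ s₀ s i 1) s := by
  have := (hasDerivAt_explicitCurve hI hIc h.spectral.1 h.eulerLagrange.smooth₂ h.bounds hs₀ hs
    (μ₁ s) (μ₃ s) i).const_mul
    (√((τ₂ ^ 2 - τ₁ ^ 2) * (lam ^ 2 + τ₁ ^ 2) * (lam ^ 2 + τ₂ ^ 2)))⁻¹
  rw [spectralFrame, explicitLift, explicitFrame_smul]
  exact this

/-- Only column 0 of E' = Eφ is checked by differentiation. The other columns follow because X = E'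
- Eφ satisfies XΘ = NX, by the Lax equation, and such a matrix is determined by its column 0. -/
lemma isFrenetSystem (h : IsSpectralSolution I μ₁ μ₂ μ₃ C₁ C₂ C₃ lam τ₁ τ₂)
    (hI : IsOpen I) (hIc : I.OrdConnected) (hs₀ : s₀ ∈ I) :
    IsFrenetSystem (spectralFrame lam τ₁ τ₂ μ₁ μ₂ μ₃ s₀) I μ₁ μ₂ μ₃ where
  frame := ⟨h.contDiffOn_spectralFrame hI hIc hs₀, fun _ hs => h.spectralFrame_lorentz hs⟩
  smooth₁ := h.eulerLagrange.smooth₁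
  smooth₂ := h.eulerLagrange.smooth₂
  smooth₃ := h.eulerLagrange.smooth₃
  mc s hs := by
    set E := spectralFrame lam τ₁ τ₂ μ₁ μ₂ μ₃ s₀ with hE
    set φ := frenetMatrix (μ₁ s) (μ₂ s) (μ₃ s) with hφ
    set Θ := thetaMatrix μ₁ μ₂ μ₃ s with hΘ
    set N := normalForm lam τ₁ τ₂ with hN
    have hd : ∀ i j, HasDerivAt (fun u => E u i j) (frameDeriv E s i j) s := fun i j =>
      hasDerivAt_of_contDiffOn (h.contDiffOn_spectralFrame hI hIc hs₀ i j) hI hs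
    have hEs : E s * Θ = N * E s := h.spectralFrame_mul_theta hs
    have hL := h.spectralFrame_lorentz (s₀ := s₀) hs
    have key : frameDeriv E s * Θ + E s * ⁅Θ, φ⁆ = N * frameDeriv E s := by
      ext i j
      have h1 := hasDerivAt_matrix_mul hd (fun i j => h.eulerLagrange.lax hI hs i j) i j
      have h2 := hasDerivAt_matrix_mul (A := fun _ => N) (A' := 0)
        (fun i j => hasDerivAt_const s (N i j)) hd i j
      have h3 := h1.congr_of_eventuallyEq (f₁ := fun u => (N * E u) i j) <| by
        filter_upwards [hI.mem_nhds hs] with u hu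
        rw [h.spectralFrame_mul_theta hu]
      have := h3.unique h2
      simpa using this
    have hX : (frameDeriv E s - E s * φ) * Θ = N * (frameDeriv E s - E s * φ) := by
      rw [Ring.lie_def, mul_sub, ← mul_assoc, ← mul_assoc, hEs] at key
      rw [sub_mul, mul_sub, ← key]
      simp only [mul_assoc]
      abel
    obtain ⟨hl, h1, h2, n0, n1, n2⟩ := h.nonzero hs
    have hz : frameDeriv E s - E s * φ = 0 := by
      refine eq_zero_of_mul_theta hl h1 h2 (h.pos s hs).ne' n0 n1 n2 hX fun i => ?_
      -- The only nonzero entry in column 0 of φ is φ¹₀ = 1, so column 0 of Eφ is column 1 of E, the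
      -- derivative of the lift.
      have d0 := h.hasDerivAt_explicitLift hI hIc hs₀ hs i
      have d1 : HasDerivAt (fun u => explicitLift lam τ₁ τ₂ μ₂ s₀ u i) (frameDeriv E s i 0) s := by
        simpa only [hE, spectralFrame, explicitFrame_col_zero] using hd i 0
      rw [Matrix.sub_apply, d1.unique d0, Matrix.mul_apply, Fin.sum_univ_six]
      simp [hφ, frenetMatrix, hE]
    rw [sub_eq_zero] at hz
    rw [mcForm]
    change (E s)⁻¹ * frameDeriv E s = φ
    rw [hz, ← mul_assoc, Matrix.nonsing_inv_mul _ (isUnit_det_of_lorentz hL), one_mul]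

end IsSpectralSolution

/-! ### Conformal geodesics are explicit -/

lemma lorentz_inv {G : M6} (h : Gᵀ * lorentzS * G = lorentzS) :
    (G⁻¹)ᵀ * lorentzS * G⁻¹ = lorentzS := by
  have h1 := Matrix.mul_nonsing_inv G (isUnit_det_of_lorentz h)
  calc (G⁻¹)ᵀ * lorentzS * G⁻¹ = (G⁻¹)ᵀ * (Gᵀ * lorentzS * G) * G⁻¹ := by rw [h]
    _ = (G * G⁻¹)ᵀ * lorentzS * (G * G⁻¹) := by
      rw [Matrix.transpose_mul]; simp only [mul_assoc]
    _ = lorentzS := by rw [h1]; simp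

lemma mem_posCone_or_neg_mem {u : V6} (hu : lorentz u u = 0) (hne : u ≠ 0) :
    u ∈ posCone ∨ -u ∈ posCone := by
  rcases lt_trichotomy (u 0 + u 5) 0 with h | h | h
  · refine Or.inr ⟨by simp [lorentz_neg_left, lorentz_neg_right, hu], ?_⟩
    simp only [Pi.neg_apply]
    linarith
  · refine absurd ?_ hne
    rw [lorentz_eq] at hu
    have h5 : u 5 = -u 0 := by linarith
    rw [h5] at hu
    ext i
    fin_cases i <;> simp <;> nlinarith [sq_nonneg (u 0), sq_nonneg (u 1), sq_nonneg (u 2),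
      sq_nonneg (u 3), sq_nonneg (u 4)]
  · exact Or.inl ⟨hu, h⟩

lemma IsConformalMotion.inv {G : M6} (h : IsConformalMotion G) : IsConformalMotion G⁻¹ := by
  have hL := lorentz_inv h.1
  have hG := Matrix.mul_nonsing_inv G (isUnit_det_of_lorentz h.1)
  have e0 : (fun i => G⁻¹ i 0) = G⁻¹ *ᵥ (Pi.single 0 1) := by ext i; simp
  have hb : G *ᵥ (fun i => G⁻¹ i 0) = Pi.single 0 1 := by
    rw [e0, Matrix.mulVec_mulVec, hG, Matrix.one_mulVec]
  refine isConformalMotion_of_col hL ?_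
  have h0 : lorentz (fun i => G⁻¹ i 0) (fun i => G⁻¹ i 0) = 0 := by
    rw [e0, lorentz_mulVec hL]
    simp [lorentz_eq]
  have hne : (fun i => G⁻¹ i 0) ≠ 0 := fun h0 => by
    rw [h0, Matrix.mulVec_zero] at hb
    simpa using congrFun hb 0
  -- If the negative of column 0 of G⁻¹ were in the cone, G would map it to the negative of the
  -- first basis vector, which is outside the cone.
  refine (mem_posCone_or_neg_mem h0 hne).resolve_right fun h1 => ?_
  have := (h.2 _ h1).2
  rw [Matrix.mulVec_neg, hb] at this
  simp at this
  linarith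

lemma conj_theta_mem {e : M6} (he : eᵀ * lorentzS * e = lorentzS) (μ₁ μ₂ μ₃ : ℝ → ℝ) (s : ℝ) :
    e * thetaMatrix μ₁ μ₂ μ₃ s * e⁻¹ ∈ moebAlg := by
  have hΘ : thetaMatrix μ₁ μ₂ μ₃ s * lorentzS = -(lorentzS * (thetaMatrix μ₁ μ₂ μ₃ s)ᵀ) :=
    thetaValue_mul_lorentzS
  rw [inv_eq_of_lorentz he]
  set Θ := thetaMatrix μ₁ μ₂ μ₃ s
  have hS : ∀ M : M6, lorentzS * (lorentzS * M) = M := fun M => by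
    rw [← mul_assoc, lorentzS_mul_self, one_mul]
  have h1 : Θᵀ = -(lorentzS * Θ * lorentzS) := by
    rw [mul_assoc, hΘ, mul_neg, neg_neg, hS]
  change (e * Θ * (lorentzS * eᵀ * lorentzS))ᵀ * lorentzS +
    lorentzS * (e * Θ * (lorentzS * eᵀ * lorentzS)) = 0
  simp only [Matrix.transpose_mul, Matrix.transpose_transpose, lorentzS_transpose, h1, mul_assoc,
    neg_mul, mul_neg, hS]
  simp

section Explicit

variable {I : Set ℝ} {μ₁ μ₂ μ₃ : ℝ → ℝ}

/-- Two solutions of the same Frenet system differ by a constant motion. -/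
lemma IsFrenetSystem.mul_inv_eq (hI : IsOpen I) (hIc : I.OrdConnected) {e e' : ℝ → M6}
    (S : IsFrenetSystem e I μ₁ μ₂ μ₃) (S' : IsFrenetSystem e' I μ₁ μ₂ μ₃) {s t : ℝ} (hs : s ∈ I)
    (ht : t ∈ I) : e' s * (e s)⁻¹ = e' t * (e t)⁻¹ := by
  rw [inv_eq_of_lorentz (S.frame.lorentz s hs), inv_eq_of_lorentz (S.frame.lorentz t ht)]
  ext i j
  refine eq_of_hasDerivAt_zero hI hIc
    (g := fun u => (e' u * (lorentzS * (e u)ᵀ * lorentzS)) i j) ?_ hs ht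
  intro u hu
  have hd : ∀ {c : ℝ → M6}, IsFrenetSystem c I μ₁ μ₂ μ₃ → ∀ i j,
      HasDerivAt (fun v => c v i j)
        ((c u * frenetMatrix (μ₁ u) (μ₂ u) (μ₃ u)) i j) u := by
    intro c hc i j
    rw [← hc.mc u hu, ← hc.frame.frameDeriv_eq hu]
    exact hasDerivAt_of_contDiffOn (hc.frame.smooth i j) hI hu
  have hc : ∀ i j, HasDerivAt (fun _ : ℝ => lorentzS i j) ((0 : M6) i j) u := fun i j =>
    hasDerivAt_const u _
  have h1 := hasDerivAt_matrix_mul (hd S') (hasDerivAt_matrix_mul (hasDerivAt_matrix_mul hc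
    (B := fun v => (e v)ᵀ) (B' := (e u * frenetMatrix (μ₁ u) (μ₂ u) (μ₃ u))ᵀ)
    fun i j => hd S j i) hc) i j
  refine h1.congr_deriv ?_
  have hφ := lorentzS_mul_transpose_of_mem (S.frame.mcForm_mem hI hu)
  rw [S.mc u hu] at hφ
  change _ = (0 : M6) i j
  refine congrFun (congrFun ?_ i) j
  rw [Matrix.transpose_mul, zero_mul, zero_add, mul_zero, add_zero,
    ← mul_assoc lorentzS (frenetMatrix _ _ _)ᵀ, hφ]
  noncomm_ring

/-- The explicit form of a conformal geodesic with spectral curvatures. -/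
lemma IsSpectralSolution.exists_motion {C₁ C₂ C₃ lam τ₁ τ₂ s₀ : ℝ}
    (h : IsSpectralSolution I μ₁ μ₂ μ₃ C₁ C₂ C₃ lam τ₁ τ₂) (hI : IsOpen I) (hIc : I.OrdConnected)
    (hs₀ : s₀ ∈ I) {e : ℝ → M6} {f : ℝ → Q4} (he : IsFrame e f I)
    (S : IsFrenetSystem e I μ₁ μ₂ μ₃) :
    ∃ A : M6, IsConformalMotion A ∧ C₂ * A.det < 0 ∧
      A * (e s₀ * thetaMatrix μ₁ μ₂ μ₃ s₀ * (e s₀)⁻¹) * A⁻¹ = normalForm lam τ₁ τ₂ ∧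
      ∀ s ∈ I, A *ᵥ (fun i => e s i 0) = explicitLift lam τ₁ τ₂ μ₂ s₀ s ∧
        Represents (A⁻¹ *ᵥ explicitCurve lam τ₁ τ₂ μ₂ s₀ s) (f s) := by
  set E := spectralFrame lam τ₁ τ₂ μ₁ μ₂ μ₃ s₀ with hE
  have hu : ∀ s ∈ I, IsUnit (e s).det := fun s hs => isUnit_det_of_lorentz (S.frame.lorentz s hs)
  have hU : IsUnit (E s₀).det := isUnit_det_of_lorentz (h.spectralFrame_lorentz hs₀)
  -- Both frames solve the same Frenet system, so Ee⁻¹ is constant; its value at s₀ is the required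
  -- motion.
  have hA : ∀ s ∈ I, E s₀ * (e s₀)⁻¹ * e s = E s := by
    intro s hs
    rw [S.mul_inv_eq hI hIc (h.isFrenetSystem hI hIc hs₀) hs₀ hs, mul_assoc,
      Matrix.nonsing_inv_mul _ (hu s hs), mul_one]
  have hAm : IsConformalMotion (E s₀ * (e s₀)⁻¹) :=
    (h.isConformalMotion_spectralFrame hs₀).mul (he.2 s₀ hs₀).1.1.inv
  have hAu := isUnit_det_of_lorentz hAm.1
  have hcol : ∀ s ∈ I, (E s₀ * (e s₀)⁻¹) *ᵥ (fun i => e s i 0) =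
      explicitLift lam τ₁ τ₂ μ₂ s₀ s := by
    intro s hs
    ext i
    have := congrFun (congrFun (hA s hs) i) 0
    rw [Matrix.mul_apply] at this
    rw [Matrix.mulVec, dotProduct, this, hE, spectralFrame, explicitFrame_col_zero]
  refine ⟨E s₀ * (e s₀)⁻¹, hAm, ?_, ?_, fun s hs => ⟨hcol s hs, ?_⟩⟩
  · rw [Matrix.det_mul, Matrix.det_nonsing_inv, (he.2 s₀ hs₀).1.2]
    simpa using h.mul_det_spectralFrame_neg hs₀
  · have h1 : ((E s₀ * (e s₀)⁻¹) * (e s₀ * thetaMatrix μ₁ μ₂ μ₃ s₀ * (e s₀)⁻¹)) =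
        normalForm lam τ₁ τ₂ * (E s₀ * (e s₀)⁻¹) := by
      rw [← mul_assoc, ← mul_assoc, hA s₀ hs₀, h.spectralFrame_mul_theta hs₀, mul_assoc]
    rw [h1, mul_assoc, Matrix.mul_nonsing_inv _ hAu, mul_one]
  · obtain ⟨hl, h1, h12, -⟩ := h.spectral
    have hq : 0 < τ₂ ^ 2 - τ₁ ^ 2 := by nlinarith
    have hD : 0 < √((τ₂ ^ 2 - τ₁ ^ 2) * (lam ^ 2 + τ₁ ^ 2) * (lam ^ 2 + τ₂ ^ 2)) :=
      Real.sqrt_pos.2 (by positivity)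
    have h2 : explicitCurve lam τ₁ τ₂ μ₂ s₀ s =
        √((τ₂ ^ 2 - τ₁ ^ 2) * (lam ^ 2 + τ₁ ^ 2) * (lam ^ 2 + τ₂ ^ 2)) •
          explicitLift lam τ₁ τ₂ μ₂ s₀ s := by
      rw [explicitLift, smul_smul, mul_inv_cancel₀ hD.ne', one_smul]
    rw [h2, ← hcol s hs, Matrix.mulVec_smul, Matrix.mulVec_mulVec, Matrix.nonsing_inv_mul _ hAu,
      Matrix.one_mulVec]
    exact (he.2 s hs).2.smul hD.ne'

/-- Nonconstant solutions of the Euler-Lagrange equations have an admissible triple of first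
integrals and a spectrum. -/
lemma IsEulerLagrange.exists_isSpectralSolution (h : IsEulerLagrange I μ₁ μ₂ μ₃) (hI : IsOpen I)
    (hIc : I.OrdConnected) (hpos : ∀ s ∈ I, 0 < μ₂ s) (h3 : ∀ s ∈ I, μ₃ s ≠ 0)
    (hne : ∃ s ∈ I, ∃ t ∈ I, μ₁ s ≠ μ₁ t ∨ μ₂ s ≠ μ₂ t ∨ μ₃ s ≠ μ₃ t) :
    ∃ C₁ C₂ C₃ ξ₀ ξ₁ ξ₂ lam τ₁ τ₂, IsSpectralSolution I μ₁ μ₂ μ₃ C₁ C₂ C₃ lam τ₁ τ₂ ∧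
      IsAdmissibleTriple C₁ C₂ C₃ ξ₀ ξ₁ ξ₂ ∧ -ξ₀ < lam ^ 2 ∧ τ₁ ^ 2 < ξ₁ ∧ ξ₂ < τ₂ ^ 2 ∧
      ∀ s ∈ I, ξ₁ ≤ μ₂ s ^ 2 ∧ μ₂ s ^ 2 ≤ ξ₂ := by
  obtain ⟨s, hs, t, ht, hst⟩ := hne
  obtain ⟨C₁, C₂, C₃, hC⟩ := h.firstIntegrals hI hIc ⟨s, hs⟩ hpos
  have hC2 : C₂ ≠ 0 := by
    rintro rfl
    exact h3 s hs (by rw [(hC s hs).2.1, zero_div])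
  -- All curvatures are functions of μ₂, so a constant μ₂ would make all three constant. At u the
  -- value P(μ₂²) = (μ₂μ₂')² is strictly positive.
  obtain ⟨u, hu, hdu⟩ : ∃ u ∈ I, deriv μ₂ u ≠ 0 := by
    by_contra! hd
    have h2 : μ₂ s = μ₂ t := eq_of_hasDerivAt_zero hI hIc (fun x hx => by
      rw [← hd x hx]; exact hasDerivAt_of_contDiffOn h.smooth₂ hI hx) hs ht
    rw [(hC s hs).1, (hC t ht).1, (hC s hs).2.1, (hC t ht).2.1, h2] at hst
    simp at hst
  have hP := fun x (hx : x ∈ I) => (hC x hx).2.2.cubicP_eq (hpos x hx)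
  have hpu := hpos u hu
  obtain ⟨ξ₀, ξ₁, ξ₂, hA⟩ := exists_isAdmissibleTriple (C₁ := C₁) (C₃ := C₃) hC2
    (t := μ₂ u ^ 2) (by positivity) (by rw [hP u hu]; positivity)
  have hb : ∀ x ∈ I, ξ₁ ≤ μ₂ x ^ 2 ∧ μ₂ x ^ 2 ≤ ξ₂ := fun x hx =>
    hA.mem_Icc (by have := hpos x hx; positivity) (by rw [hP x hx]; positivity)
  obtain ⟨lam, τ₁, τ₂, hS, b0, b1, b2⟩ := exists_isSpectralTriple hA
  exact ⟨C₁, C₂, C₃, ξ₀, ξ₁, ξ₂, lam, τ₁, τ₂, ⟨h, hpos, hC, hC2, hS, fun x hx =>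
    ⟨b1.trans_le (hb x hx).1, (hb x hx).2.trans_lt b2⟩⟩, hA, b0, b1, b2, hb⟩

end Explicit

/-! ### The energy equation -/

/-- Nonconstant solutions of the energy equation solve the differentiated equation. -/
lemma deriv_deriv_of_energyEquation {I : Set ℝ} {μ₂ : ℝ → ℝ} {C₁ C₂ C₃ ξ₀ ξ₁ ξ₂ : ℝ} (hI : IsOpen I)
    (hIc : I.OrdConnected) (hA : IsAdmissibleTriple C₁ C₂ C₃ ξ₀ ξ₁ ξ₂) (hμ : ContDiffOn ℝ ∞ μ₂ I)
    (hpos : ∀ s ∈ I, 0 < μ₂ s) (hne : ∃ s ∈ I, ∃ t ∈ I, μ₂ s ≠ μ₂ t)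
    (hE : ∀ s ∈ I, EnergyEquation C₁ C₂ C₃ μ₂ s) {s : ℝ} (hs : s ∈ I) :
    deriv (deriv μ₂) s = -2 * μ₂ s ^ 3 + 2 * C₁ * μ₂ s + C₂ ^ 2 / μ₂ s ^ 3 := by
  set R : ℝ → ℝ := fun s => -2 * μ₂ s ^ 3 + 2 * C₁ * μ₂ s + C₂ ^ 2 / μ₂ s ^ 3 with hR
  have h1 := contDiffOn_deriv hμ hI
  have h2 := contDiffOn_deriv h1 hI
  have hRc : ContinuousOn R I :=
    ((continuousOn_const.mul (hμ.continuousOn.pow 3)).add (continuousOn_const.mul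
      hμ.continuousOn)).add (continuousOn_const.div (hμ.continuousOn.pow 3)
        fun x hx => pow_ne_zero 3 (hpos x hx).ne')
  -- Differentiating the energy equation gives μ₂'(μ₂'' - R) = 0.
  have hprod : ∀ x ∈ I, deriv μ₂ x = 0 ∨ deriv (deriv μ₂) x = R x := by
    intro x hx
    have hp := (hpos x hx).ne'
    have d0 := hasDerivAt_of_contDiffOn hμ hI hx
    have d1 := hasDerivAt_of_contDiffOn h1 hI hx
    have hd := ((((d1.fun_pow 2).const_mul (1 / 2)).fun_add ((d0.fun_pow 4).const_mul
      (1 / 2))).fun_sub ((d0.fun_pow 2).const_mul C₁)).fun_add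
      ((hasDerivAt_const x (C₂ ^ 2)).fun_div ((d0.fun_pow 2).const_mul 2) (by positivity))
    have hz : HasDerivAt (fun y => 1 / 2 * deriv μ₂ y ^ 2 + 1 / 2 * μ₂ y ^ 4 - C₁ * μ₂ y ^ 2 +
        C₂ ^ 2 / (2 * μ₂ y ^ 2)) 0 x :=
      (hasDerivAt_const x (C₃ / 2)).congr_of_eventuallyEq <| by
        filter_upwards [hI.mem_nhds hx] with y hy using hE y hy
    have h := hd.unique hz
    have : deriv μ₂ x * (deriv (deriv μ₂) x - R x) = 0 := by
      rw [← h, hR]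
      field_simp
      push_cast
      ring
    exact (mul_eq_zero.1 this).imp_right sub_eq_zero.1
  have oU : IsOpen (I ∩ (fun x => deriv (deriv μ₂) x - R x) ⁻¹' {0}ᶜ) :=
    (h2.continuousOn.sub hRc).isOpen_inter_preimage hI isOpen_compl_singleton
  have oV1 : IsOpen (I ∩ deriv μ₂ ⁻¹' {0}ᶜ) :=
    h1.continuousOn.isOpen_inter_preimage hI isOpen_compl_singleton
  have oV2 : IsOpen (I ∩ deriv (deriv μ₂) ⁻¹' {0}ᶜ) :=
    h2.continuousOn.isOpen_inter_preimage hI isOpen_compl_singleton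
  -- At a critical point ξ = μ₂² is a root of P, and μ₂³R = ξP'(ξ) - P(ξ). If R vanished, ξ would be
  -- a double root, but the roots of P are simple.
  have hRne : ∀ x ∈ I, deriv μ₂ x = 0 → R x ≠ 0 := by
    intro x hx hd hRx
    have hp := hpos x hx
    have hP := (hE x hx).cubicP_eq hp
    rw [hd, mul_zero, zero_pow two_ne_zero] at hP
    have hq : μ₂ x ^ 3 * R x = -2 * (μ₂ x ^ 2) ^ 3 + 2 * C₁ * (μ₂ x ^ 2) ^ 2 + C₂ ^ 2 := by
      rw [hR]; field_simp
    rw [hRx, mul_zero] at hq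
    have hξ : 0 < μ₂ x ^ 2 := by positivity
    generalize μ₂ x ^ 2 = ξ at hP hq hξ
    have hf := fun t => hA.cubicP_eq t
    have hP' := hP
    rw [hf] at hP'
    have a0 := hf 0
    have a1 := hf 1
    have a2 := hf (-1)
    obtain ⟨b0, b1, b2, -⟩ := hA
    simp only [cubicP] at hP a0 a1 a2
    have hz : (ξ - ξ₀) * (ξ - ξ₁) + (ξ - ξ₀) * (ξ - ξ₂) + (ξ - ξ₁) * (ξ - ξ₂) = 0 := by
      refine mul_left_cancel₀ hξ.ne' ?_
      linear_combination hq - hP + (ξ ^ 2 + ξ / 2) * a1 + (ξ ^ 2 - ξ / 2) * a2 - 2 * ξ ^ 2 * a0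
    have hc : (ξ - ξ₁) * (ξ - ξ₂) = 0 := by
      refine mul_left_cancel₀ (show ξ - ξ₀ ≠ 0 by linarith) ?_
      linarith
    rcases mul_eq_zero.1 hc with h | h
    · have : (ξ - ξ₀) * (ξ - ξ₂) = 0 := by rw [h] at hz; linarith
      rcases mul_eq_zero.1 this with h' | h' <;> linarith
    · have : (ξ - ξ₀) * (ξ - ξ₁) = 0 := by rw [h] at hz; linarith
      rcases mul_eq_zero.1 this with h' | h' <;> linarith
  -- The open sets {μ₂'' ≠ R} and {μ₂' ≠ 0 or μ₂'' ≠ 0} cover I and cannot meet, since μ₂' is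
  -- locally zero on the former. The latter is nonempty, so connectedness makes the former empty.
  have hcover : I ⊆ (I ∩ (fun x => deriv (deriv μ₂) x - R x) ⁻¹' {0}ᶜ) ∪
      ((I ∩ deriv μ₂ ⁻¹' {0}ᶜ) ∪ (I ∩ deriv (deriv μ₂) ⁻¹' {0}ᶜ)) := by
    intro x hx
    by_cases hd : deriv μ₂ x = 0
    · by_cases hd2 : deriv (deriv μ₂) x = 0
      · exact Or.inl ⟨hx, by simpa [hd2] using hRne x hx hd⟩
      · exact Or.inr (Or.inr ⟨hx, hd2⟩)
    · exact Or.inr (Or.inl ⟨hx, hd⟩)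
  by_contra hcon
  have hVne : ∃ x ∈ I, deriv μ₂ x ≠ 0 := by
    by_contra! hd
    obtain ⟨a, ha, b, hb, hab⟩ := hne
    exact hab (eq_of_hasDerivAt_zero hI hIc (fun x hx => by
      rw [← hd x hx]; exact hasDerivAt_of_contDiffOn hμ hI hx) ha hb)
  obtain ⟨v, hvI, hv⟩ := hVne
  obtain ⟨x, hx, hxU, hxV⟩ := hIc.isPreconnected _ _ oU (oV1.union oV2) hcover
    ⟨s, hs, hs, sub_ne_zero.2 hcon⟩ ⟨v, hvI, Or.inl ⟨hvI, hv⟩⟩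
  have hloc : deriv μ₂ =ᶠ[𝓝 x] fun _ => 0 := by
    filter_upwards [oU.mem_nhds hxU] with y hy
    exact (hprod y hy.1).resolve_right fun h => hy.2 (sub_eq_zero.2 h)
  rcases hxV with h | h
  · exact h.2 hloc.eq_of_nhds
  · exact h.2 (by rw [mem_singleton_iff, hloc.deriv_eq, deriv_const])

/-- The curvatures of the converse statement solve the Euler-Lagrange equations. -/
lemma isSpectralSolution_of_energyEquation {I : Set ℝ} {μ₂ : ℝ → ℝ}
    {C₁ C₂ C₃ ξ₀ ξ₁ ξ₂ lam τ₁ τ₂ : ℝ} (hI : IsOpen I) (hIc : I.OrdConnected)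
    (hA : IsAdmissibleTriple C₁ C₂ C₃ ξ₀ ξ₁ ξ₂) (hS : IsSpectralTriple C₁ C₂ C₃ lam τ₁ τ₂)
    (hμ : ContDiffOn ℝ ∞ μ₂ I) (hpos : ∀ s ∈ I, 0 < μ₂ s) (hne : ∃ s ∈ I, ∃ t ∈ I, μ₂ s ≠ μ₂ t)
    (hE : ∀ s ∈ I, EnergyEquation C₁ C₂ C₃ μ₂ s) :
    IsSpectralSolution I (fun s => -(3 / 2) * μ₂ s ^ 2 + C₁) μ₂ (fun s => C₂ / μ₂ s ^ 2)
      C₁ C₂ C₃ lam τ₁ τ₂ where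
  eulerLagrange :=
    { smooth₁ := (contDiffOn_const.mul (hμ.pow 2)).add contDiffOn_const
      smooth₂ := hμ
      smooth₃ := contDiffOn_const.div (hμ.pow 2) fun x hx => pow_ne_zero 2 (hpos x hx).ne'
      eq₁ := fun s hs => by
        have d0 := hasDerivAt_of_contDiffOn hμ hI hs
        rw [(((d0.fun_pow 2).const_mul (-(3 / 2))).add_const C₁).deriv]
        push_cast
        ring
      eq₂ := fun s hs => by
        have := (hpos s hs).ne'
        rw [deriv_deriv_of_energyEquation hI hIc hA hμ hpos hne hE hs]
        field_simp
        ring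
      eq₃ := fun s hs => by
        have d0 := hasDerivAt_of_contDiffOn hμ hI hs
        have := (hpos s hs).ne'
        rw [((hasDerivAt_const s C₂).fun_div (d0.fun_pow 2) (by positivity)).deriv]
        field_simp
        push_cast
        ring }
  pos := hpos
  integrals s hs := ⟨rfl, rfl, hE s hs⟩
  ne_zero := hA.ne_zero
  spectral := hS
  bounds s hs := by
    obtain ⟨b1, b2⟩ := hS.bounds hA
    have hp := hpos s hs
    have h := hA.mem_Icc (t := μ₂ s ^ 2) (by positivity)
      (by rw [(hE s hs).cubicP_eq hp]; positivity)
    exact ⟨b1.trans_le h.1, h.2.trans_lt b2⟩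

/-! ### Solutions of the Euler-Lagrange equations are critical -/

section Converse

variable {e : ℝ → M6} {I : Set ℝ} {μ₁ μ₂ μ₃ : ℝ → ℝ} {f : ℝ → Q4}

/-- Frames that solve a Frenet system with positive `μ₂` are Frenet frames. -/
lemma IsFrenetSystem.isFrenetFrame (S : IsFrenetSystem e I μ₁ μ₂ μ₃) (he : IsFrame e f I)
    (hpos : ∀ s ∈ I, 0 < μ₂ s) : IsFrenetFrame e f I := by
  refine ⟨⟨⟨⟨⟨he, fun y hy => ?_⟩, fun y hy => ?_⟩, fun y hy => ?_⟩, fun y hy => ?_⟩,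
    fun y hy => ?_⟩ <;> rw [S.mc y hy] <;> simp [frenetMatrix, hpos y, hy]

lemma IsFrenetSystem.hasCurvatures (S : IsFrenetSystem e I μ₁ μ₂ μ₃) :
    HasCurvatures e I μ₁ μ₂ μ₃ := fun y hy => by
  rw [S.mc y hy]; simp [frenetMatrix]

lemma IsFrenetSystem.pSq_eq (S : IsFrenetSystem e I μ₁ μ₂ μ₃) {s : ℝ} (hs : s ∈ I) :
    pSq e s = 1 := by
  rw [pSq, S.mc s hs]; simp [frenetMatrix]

lemma IsFrenetSystem.is3Generic (S : IsFrenetSystem e I μ₁ μ₂ μ₃) (hI : IsOpen I)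
    (he : IsFrame e f I) (hpos : ∀ s ∈ I, 0 < μ₂ s) {s : ℝ} (hs : s ∈ I) (h3 : μ₃ s ≠ 0) :
    Is3Generic f s := by
  have hF := S.isFrenetFrame he hpos
  refine ⟨⟨⟨I, hI, hs, e, hF.1.1.1, by simp [S.pSq_eq hs]⟩, I, hI, hs, e, hF.1.1, Or.inl ?_⟩,
    I, hI, hs, e, hF, ?_⟩
  · rw [S.mc s hs]; simpa [frenetMatrix] using (hpos s hs).ne'
  · rw [S.mc s hs]; simpa [frenetMatrix] using h3

lemma IsFrame.col_mem (he : IsFrame e f I) : ∀ y ∈ I,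
    frameCol e 0 y ∈ posCone ∧ Represents (frameCol e 0 y) (f y) := fun y hy =>
  ⟨(he.2 y hy).1.1.col_mem, (he.2 y hy).2⟩

lemma IsFrenetSystem.isImmersedCurve (S : IsFrenetSystem e I μ₁ μ₂ μ₃) (hI : IsOpen I)
    (he : IsFrame e f I) : IsImmersedCurve f I := by
  refine isImmersedCurve_of_lift hI (S.frame.contDiffOn_col 0) he.col_mem fun y hy => ?_
  rw [(S.hasDerivAt_cols hI hy).1.deriv, S.frame.lorentz_col 1 1 hy]
  simp [lorentzS]

lemma IsFrenetSystem.isConformalArclength (S : IsFrenetSystem e I μ₁ μ₂ μ₃) (hI : IsOpen I)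
    (he : IsFrame e f I) (hpos : ∀ s ∈ I, 0 < μ₂ s) : IsConformalArclength f I fun s => s := by
  intro s hs
  have hF := S.isFrenetFrame he hpos
  rw [arclengthDensity_eq hI (S.isImmersedCurve hI he) (S.frame.contDiffOn_col 0) he.col_mem hs,
    ← hF.1.1.1.density_eq hI hs hI hs (S.frame.contDiffOn_col 0) he.col_mem, S.pSq_eq hs,
    S.mc s hs]
  simpa [frenetMatrix] using hasDerivAt_id' s

/-- Solutions of the Euler-Lagrange equations are conformal geodesics. -/
theorem IsFrenetSystem.isConformalGeodesic (S : IsFrenetSystem e I μ₁ μ₂ μ₃) (hI : IsOpen I)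
    (he : IsFrame e f I) (hpos : ∀ s ∈ I, 0 < μ₂ s) (hEL : IsEulerLagrange I μ₁ μ₂ μ₃) :
    IsConformalGeodesic f I := by
  have hF := S.isFrenetFrame he hpos
  refine ⟨S.isImmersedCurve hI he, fun s hs => ⟨I, hI, hs, e, hF.1.1.1, by simp [S.pSq_eq hs]⟩, ?_⟩
  intro ε a b v hε hab habI hv
  obtain ⟨F, hFs, hFv⟩ := hv.smooth
  have h0 : (0 : ℝ) ∈ Ioo (-ε) ε := ⟨neg_lt_zero.2 hε, hε⟩
  have hΩ : IsOpen (I ×ˢ Ioo (-ε) ε) := hI.prod isOpen_Ioo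
  -- The lift of an arbitrary variation is divided by this factor so that it starts at e₀, as the
  -- first variation formula requires.
  set r : ℝ → ℝ := fun x => (F (x, 0) 0 + F (x, 0) 5) / (frameCol e 0 x 0 + frameCol e 0 x 5)
    with hr
  have hF0 : ContDiffOn ℝ ∞ (fun x => F (x, 0)) I := hFs.comp (by fun_prop) fun x hx => ⟨hx, h0⟩
  have hrs : ContDiffOn ℝ ∞ r I := by
    have h1 := contDiffOn_pi.1 hF0
    have h2 := contDiffOn_pi.1 (S.frame.contDiffOn_col 0)
    exact ((h1 0).add (h1 5)).div ((h2 0).add (h2 5)) fun x hx => (he.col_mem x hx).1.2.ne'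
  have hrpos : ∀ x ∈ I, 0 < r x := fun x hx =>
    div_pos (hFv x hx 0 h0).1.2 (he.col_mem x hx).1.2
  have hrF : ∀ x ∈ I, F (x, 0) = r x • frameCol e 0 x := by
    intro x hx
    have h1 := (hFv x hx 0 h0).2
    rw [hv.initial x hx] at h1
    exact h1.eq_smul (he.col_mem x hx).2 (he.col_mem x hx).1
  set H : ℝ × ℝ → V6 := fun p => (r p.1)⁻¹ • F p with hH
  have hHs : ContDiffOn ℝ ∞ H (I ×ˢ Ioo (-ε) ε) :=
    ((hrs.comp contDiffOn_fst fun p hp => hp.1).inv fun p hp => (hrpos p.1 hp.1).ne').smul hFs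
  have hHv : ∀ x ∈ I, ∀ t ∈ Ioo (-ε) ε, H (x, t) ∈ posCone ∧ Represents (H (x, t)) (v x t) := by
    intro x hx t ht
    have hp := inv_pos.2 (hrpos x hx)
    obtain ⟨⟨h1, h2⟩, h3⟩ := hFv x hx t ht
    refine ⟨⟨?_, ?_⟩, h3.smul hp.ne'⟩
    · simp [hH, lorentz_smul_left, lorentz_smul_right, h1]
    · simp only [hH, Pi.smul_apply, smul_eq_mul, ← mul_add]
      exact mul_pos hp h2
  have hFV : IsFrenetVariation e I H (I ×ˢ Ioo (-ε) ε) :=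
    ⟨hΩ, fun s hs => ⟨hs, h0⟩, hHs, fun p hp => (hHv p.1 hp.1 p.2 hp.2).1.1, fun s hs => by
      simp only [hH, hrF s hs, smul_smul, inv_mul_cancel₀ (hrpos s hs).ne', one_smul]⟩
  -- Outside [a, b] the points do not move, so the lift stays on the line of e₀ and only its scale
  -- may depend on t.
  have hfield : ∀ s ∈ I \ Icc a b, ∃ c : ℝ, variationField H s = c • frameCol e 0 s := by
    intro s hs
    set q : ℝ → ℝ := fun t => (H (s, t) 0 + H (s, t) 5) / (frameCol e 0 s 0 + frameCol e 0 s 5)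
      with hq
    have hd := hasDerivAt_pdt hHs hΩ (show (s, (0 : ℝ)) ∈ I ×ˢ Ioo (-ε) ε from ⟨hs.1, h0⟩)
    have hdq : HasDerivAt q ((variationField H s 0 + variationField H s 5) /
        (frameCol e 0 s 0 + frameCol e 0 s 5)) 0 :=
      (((hasDerivAt_pi.1 hd) 0).add ((hasDerivAt_pi.1 hd) 5)).div_const _
    have heq : (fun t => H (s, t)) =ᶠ[𝓝 0] fun t => q t • frameCol e 0 s := by
      filter_upwards [Ioo_mem_nhds h0.1 h0.2] with t ht
      have h1 := (hHv s hs.1 t ht).2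
      rw [hv.support s hs t ht] at h1
      exact h1.eq_smul (he.col_mem s hs.1).2 (he.col_mem s hs.1).1
    exact ⟨_, hd.unique ((hdq.smul_const _).congr_of_eventuallyEq heq)⟩
  have hfv := hFV.firstVariation S hI hab habI hfield
  have hzero : ∫ s in a..b, eulerLagrange e μ₁ μ₂ μ₃ s (variationField H s) = 0 := by
    rw [← intervalIntegral.integral_zero (a := a) (b := b) (μ := MeasureTheory.volume)]
    refine intervalIntegral.integral_congr fun s hs => ?_
    rw [uIcc_of_le hab] at hs
    have hsI := habI hs
    simp only [eulerLagrange, hEL.eq₁ s hsI, hEL.eq₂ s hsI, hEL.eq₃ s hsI]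
    ring
  rw [hzero, mul_zero] at hfv
  refine hfv.congr_of_eventuallyEq ?_
  filter_upwards [Ioo_mem_nhds h0.1 h0.2] with t ht
  refine intervalIntegral.integral_congr fun x hx => ?_
  rw [uIcc_of_le hab] at hx
  have hxI := habI hx
  have hslice : ContDiffOn ℝ ∞ (fun x => H (x, t)) I :=
    hHs.comp (by fun_prop) fun x hx => ⟨hx, ht⟩
  change arclengthDensity (fun y => v y t) x = familyDensityPow H (x, t) ^ (1 / 4 : ℝ)
  rw [arclengthDensity_eq hI (hv.immersed t ht) hslice (fun x hx => hHv x hx t ht) hxI,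
    arclengthDensityPow_slice hHs hΩ ⟨hxI, ht⟩]

end Converse

/-! ### Moving frames by a conformal motion -/

section Motion

variable {e : ℝ → M6} {I : Set ℝ} {μ₁ μ₂ μ₃ : ℝ → ℝ} {f : ℝ → Q4}

lemma IsFrenetSystem.const_mul (S : IsFrenetSystem e I μ₁ μ₂ μ₃) (hI : IsOpen I) {G : M6}
    (hG : Gᵀ * lorentzS * G = lorentzS) : IsFrenetSystem (fun s => G * e s) I μ₁ μ₂ μ₃ where
  frame := by
    refine ⟨fun i j => ?_, fun y hy => ?_⟩
    · simp only [Matrix.mul_apply]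
      exact ContDiffOn.sum fun k _ => contDiffOn_const.mul (S.frame.smooth k j)
    · have := S.frame.lorentz y hy
      rw [Matrix.transpose_mul]
      calc (e y)ᵀ * Gᵀ * lorentzS * (G * e y) = (e y)ᵀ * (Gᵀ * lorentzS * G) * e y := by
            simp only [mul_assoc]
        _ = lorentzS := by rw [hG, this]
  smooth₁ := S.smooth₁
  smooth₂ := S.smooth₂
  smooth₃ := S.smooth₃
  mc s hs := by
    have hd : frameDeriv (fun s => G * e s) s = G * frameDeriv e s := by
      ext i j
      simp only [frameDeriv, Matrix.of_apply, Matrix.mul_apply]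
      exact (HasDerivAt.fun_sum fun k _ =>
        (hasDerivAt_of_contDiffOn (S.frame.smooth k j) hI hs).const_mul (G i k)).deriv
    have hGu := Matrix.nonsing_inv_mul G (isUnit_det_of_lorentz hG)
    rw [← S.mc s hs]
    change (G * e s)⁻¹ * frameDeriv (fun s => G * e s) s = (e s)⁻¹ * frameDeriv e s
    rw [hd, Matrix.mul_inv_rev, mul_assoc, ← mul_assoc G⁻¹, hGu, one_mul]

end Motion

/-- The determinants of G and of the explicit frame both have the sign opposite to that of C₂, so
their product is 1 and the moved frame takes values in the Möbius group. -/
lemma IsSpectralSolution.isFrame {I : Set ℝ} {μ₁ μ₂ μ₃ : ℝ → ℝ} {C₁ C₂ C₃ lam τ₁ τ₂ s₀ : ℝ}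
    (h : IsSpectralSolution I μ₁ μ₂ μ₃ C₁ C₂ C₃ lam τ₁ τ₂) (hI : IsOpen I) (hIc : I.OrdConnected)
    (hs₀ : s₀ ∈ I) {G : M6} (hG : IsConformalMotion G) (hdet : C₂ * G.det < 0) {f : ℝ → Q4}
    (hf : ∀ s ∈ I, Represents (G *ᵥ explicitCurve lam τ₁ τ₂ μ₂ s₀ s) (f s)) :
    IsFrame (fun s => G * spectralFrame lam τ₁ τ₂ μ₁ μ₂ μ₃ s₀ s) f I := by
  refine ⟨((h.isFrenetSystem hI hIc hs₀).const_mul hI hG.1).frame.smooth, fun y hy =>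
    ⟨⟨hG.mul (h.isConformalMotion_spectralFrame hy), ?_⟩, ?_⟩⟩
  · have h1 := h.mul_det_spectralFrame_neg (s₀ := s₀) hy
    have h2 := det_sq_of_lorentz (h.spectralFrame_lorentz (s₀ := s₀) hy)
    have h3 := det_sq_of_lorentz hG.1
    have h4 := mul_pos_of_neg_of_neg hdet h1
    rw [Matrix.det_mul]
    generalize (spectralFrame lam τ₁ τ₂ μ₁ μ₂ μ₃ s₀ y).det = q at h1 h2 h4
    have h5 : (G.det * q) ^ 2 = 1 := by rw [mul_pow, h2, h3, one_mul]
    refine (sq_eq_one_iff.1 h5).resolve_right fun h6 => ?_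
    have : C₂ * G.det * (C₂ * q) = C₂ ^ 2 * (G.det * q) := by ring
    rw [this, h6] at h4
    linarith [sq_nonneg C₂]
  · obtain ⟨hl, h1, h12, -⟩ := h.spectral
    have hq : 0 < τ₂ ^ 2 - τ₁ ^ 2 := by nlinarith
    have hD : 0 < √((τ₂ ^ 2 - τ₁ ^ 2) * (lam ^ 2 + τ₁ ^ 2) * (lam ^ 2 + τ₂ ^ 2)) :=
      Real.sqrt_pos.2 (by positivity)
    have hc : (fun i => (G * spectralFrame lam τ₁ τ₂ μ₁ μ₂ μ₃ s₀ y) i 0) =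
        (√((τ₂ ^ 2 - τ₁ ^ 2) * (lam ^ 2 + τ₁ ^ 2) * (lam ^ 2 + τ₂ ^ 2)))⁻¹ •
          G *ᵥ explicitCurve lam τ₁ τ₂ μ₂ s₀ y := by
      rw [← Matrix.mulVec_smul]
      ext i
      simp only [Matrix.mul_apply, spectralFrame, explicitFrame_col_zero]
      rfl
    rw [hc]
    exact (hf y hy).smul (inv_pos.2 hD).ne'

end

end ConformalGeodesics

/-! ### The classification of 3-generic conformal geodesics with non-constant curvatures. -/

theorem mainTheorem6 :
    -- every 3-generic conformal geodesic with non-constant curvatures is of the explicit form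
    (∀ (I : Set ℝ) (f : ℝ → Q4), IsOpen I → I.OrdConnected →
      IsConformalGeodesic f I → IsConformalArclength f I (fun s => s) →
      (∀ s ∈ I, Is3Generic f s) →
      (∃ e, IsFrenetFrame e f I) ∧
      ∀ (e : ℝ → M6) (μ₁ μ₂ μ₃ : ℝ → ℝ), IsFrenetFrame e f I → HasCurvatures e I μ₁ μ₂ μ₃ →
        (∃ s ∈ I, ∃ t ∈ I, μ₁ s ≠ μ₁ t ∨ μ₂ s ≠ μ₂ t ∨ μ₃ s ≠ μ₃ t) →
        -- the Lax equation
        (∀ s ∈ I, ∀ i j, HasDerivAt (fun u => thetaMatrix μ₁ μ₂ μ₃ u i j)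
          (⁅thetaMatrix μ₁ μ₂ μ₃ s, mcForm e s⁆ i j) s) ∧
        -- the conserved element of the Lie algebra
        ∃ ω ∈ moebAlg, (∀ s ∈ I, e s * thetaMatrix μ₁ μ₂ μ₃ s * (e s)⁻¹ = ω) ∧
        ∃ C₁ C₂ C₃ ξ₀ ξ₁ ξ₂ lam τ₁ τ₂ : ℝ,
          -- the curvatures
          IsAdmissibleTriple C₁ C₂ C₃ ξ₀ ξ₁ ξ₂ ∧
          (∀ s ∈ I, μ₁ s = -(3 / 2) * μ₂ s ^ 2 + C₁ ∧ μ₃ s = C₂ / μ₂ s ^ 2 ∧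
            EnergyEquation C₁ C₂ C₃ μ₂ s) ∧
          -- the eigenvalues
          IsSpectralTriple C₁ C₂ C₃ lam τ₁ τ₂ ∧
          -ξ₀ < lam ^ 2 ∧ τ₁ ^ 2 < ξ₁ ∧ ξ₂ < τ₂ ^ 2 ∧
          (∀ s ∈ I, ξ₁ ≤ μ₂ s ^ 2 ∧ μ₂ s ^ 2 ≤ ξ₂) ∧
          (∀ x : ℝ, ω.charpoly.eval x = x ^ 6 + 2 * C₁ * x ^ 4 - (1 + C₃) * x ^ 2 - C₂ ^ 2 ∧
            ω.charpoly.eval x = (x ^ 2 - lam ^ 2) * (x ^ 2 + τ₁ ^ 2) * (x ^ 2 + τ₂ ^ 2)) ∧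
          -- the normal form of `ω` and the explicit formula, up to a conformal motion
          ∀ s₀ ∈ I, ∃ A : M6, IsConformalMotion A ∧ C₂ * A.det < 0 ∧
            A * ω * A⁻¹ = normalForm lam τ₁ τ₂ ∧
            ∀ s ∈ I,
              A.mulVec (fun i => e s i 0) =
                (√((τ₂ ^ 2 - τ₁ ^ 2) * (lam ^ 2 + τ₁ ^ 2) * (lam ^ 2 + τ₂ ^ 2)))⁻¹ •
                  explicitCurve lam τ₁ τ₂ μ₂ s₀ s ∧
              Represents (A⁻¹.mulVec (explicitCurve lam τ₁ τ₂ μ₂ s₀ s)) (f s)) ∧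
    -- conversely, the explicit formula always gives such conformal geodesics
    (∀ (I : Set ℝ) (μ₂ : ℝ → ℝ) (C₁ C₂ C₃ ξ₀ ξ₁ ξ₂ lam τ₁ τ₂ s₀ : ℝ) (G : M6) (f : ℝ → Q4),
      IsOpen I → I.OrdConnected → s₀ ∈ I →
      IsAdmissibleTriple C₁ C₂ C₃ ξ₀ ξ₁ ξ₂ → IsSpectralTriple C₁ C₂ C₃ lam τ₁ τ₂ →
      ContDiffOn ℝ (⊤ : ℕ∞) μ₂ I → (∀ s ∈ I, 0 < μ₂ s) → (∃ s ∈ I, ∃ t ∈ I, μ₂ s ≠ μ₂ t) →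
      (∀ s ∈ I, EnergyEquation C₁ C₂ C₃ μ₂ s) →
      IsConformalMotion G → C₂ * G.det < 0 →
      (∀ s ∈ I, Represents (G.mulVec (explicitCurve lam τ₁ τ₂ μ₂ s₀ s)) (f s)) →
      IsConformalGeodesic f I ∧ IsConformalArclength f I (fun s => s) ∧
      (∀ s ∈ I, Is3Generic f s) ∧
      ∃ e, IsFrenetFrame e f I ∧
        HasCurvatures e I (fun s => -(3 / 2) * μ₂ s ^ 2 + C₁) μ₂ (fun s => C₂ / μ₂ s ^ 2)) := by
  refine ⟨fun I f hI hIc hf hs h3 => ⟨exists_isFrenetFrame hI hf.1 hs h3, ?_⟩, ?_⟩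
  · intro e μ₁ μ₂ μ₃ he hc hne
    have h1 : ∀ x ∈ I, mcForm e x 1 0 = 1 := fun x hx =>
      he.1.1.mcForm_one_zero hI hI hf.1 hs hx hx
    have S := he.isFrenetSystem hI h1 hc
    have hEL : IsEulerLagrange I μ₁ μ₂ μ₃ :=
      ⟨S.smooth₁, S.smooth₂, S.smooth₃,
        fun s hs => (hf.eulerLagrange_equations hI hIc he.isFrame S hs).1,
        fun s hs => (hf.eulerLagrange_equations hI hIc he.isFrame S hs).2.1,
        fun s hs => (hf.eulerLagrange_equations hI hIc he.isFrame S hs).2.2⟩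
    have hpos : ∀ s ∈ I, 0 < μ₂ s := fun s hs => by
      have := (he.2 s hs).1
      rwa [(hc s hs).2.1, h1 s hs, mul_one] at this
    have hμ₃ : ∀ s ∈ I, μ₃ s ≠ 0 := fun s hsI => by
      have := he.mcForm_four_three_ne_zero hI hf.1 hs h3 hsI
      rwa [(hc s hsI).2.2, h1 s hsI, mul_one] at this
    obtain ⟨C₁, C₂, C₃, ξ₀, ξ₁, ξ₂, lam, τ₁, τ₂, h, hA, b0, b1, b2, hb⟩ :=
      hEL.exists_isSpectralSolution hI hIc hpos hμ₃ hne
    obtain ⟨t, ht, -⟩ := hne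
    have hω : ∀ s ∈ I, e s * thetaMatrix μ₁ μ₂ μ₃ s * (e s)⁻¹ =
        e t * thetaMatrix μ₁ μ₂ μ₃ t * (e t)⁻¹ := fun s hs => hEL.conj_theta_eq hI hIc S hs ht
    refine ⟨fun s hs i j => ?_, _, conj_theta_mem (S.frame.lorentz t ht) _ _ _ _, hω,
      C₁, C₂, C₃, ξ₀, ξ₁, ξ₂, lam, τ₁, τ₂, hA, h.integrals, h.spectral, b0, b1, b2, hb,
      fun x => ?_, fun s₀ hs₀ => ?_⟩
    · rw [S.mc s hs]
      exact hEL.lax hI hs i j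
    · obtain ⟨i1, i2, i3⟩ := h.integrals t ht
      have hχ := charpoly_conj_theta (S.frame.lorentz t ht) (hpos t ht) i1 i2 i3 x
      refine ⟨hχ, hχ.trans ?_⟩
      -- The characteristic polynomial of ω at x is P(-y) - y with y = x².
      rw [← h.spectral.2.2.2 (x ^ 2), cubicP]
      ring
    · obtain ⟨A, hAm, hdet, hN, hcurve⟩ := h.exists_motion hI hIc hs₀ he.isFrame S
      exact ⟨A, hAm, hdet, by rwa [hω s₀ hs₀] at hN, hcurve⟩
  · intro I μ₂ C₁ C₂ C₃ ξ₀ ξ₁ ξ₂ lam τ₁ τ₂ s₀ G f hI hIc hs₀ hA hT hμ hpos hne hE hG hdet hf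
    have h := isSpectralSolution_of_energyEquation hI hIc hA hT hμ hpos hne hE
    have he := h.isFrame hI hIc hs₀ hG hdet hf
    have S := (h.isFrenetSystem hI hIc hs₀).const_mul hI hG.1
    exact ⟨S.isConformalGeodesic hI he hpos h.eulerLagrange, S.isConformalArclength hI he hpos,
      fun s hs => S.is3Generic hI he hpos hs
        (div_ne_zero h.ne_zero (pow_ne_zero 2 (hpos s hs).ne')),
      _, S.isFrenetFrame he hpos, S.hasCurvatures⟩
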